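/- **Theorem (least squares estimation error).** There are universal constants $c, C > 0$ such that the following holds. *System.* Let $A^\star \in \mathbb{R}^{d_x\times d_x}$, $B^\star\in\mathbb{R}^{d_x\times d_u}$ with $\mathrm{vec}\,[A^\star\ B^\star] = \Phi^\star\theta^\star$, where $\mathrm{vec}$ stacks columns, $\Phi^\star \in \mathbb{R}^{d_x(d_x+d_u)\times d_\theta}$ and $\theta^\star\in\mathbb{R}^{d_\theta}$. Let $K \in \mathbb{R}^{d_u\times d_x}$ be such that $A_K = A^\star+B^\star K$ has spectral radius less than $1$, let $\sigma_u^2\le 1$, let $Q\succeq I$ be symmetric, and put $P_K=\sum_{j\ge 0}(A_K^\top)^j(Q+K^\top K)A_K^j$ (the solution of $P = A_K^\top P A_K + Q + K^\top K$) and $\Psi_{B^\star}=\max\{1,\|B^\star\|\}$. Matrix norms are spectral norms and vector norms are Euclidean. *Data.* Let $x_{s+1} = A^\star x_s + B^\star u_s + w_s$, $u_s = Kx_s+\sigma_u g_s$ for $s \ge 1$, where $x_1$ is a random vector independent of the noise $(w_s,g_s)_{s\ge 1}$, all coordinates of all the $w_s$ and $g_s$ are mutually independent, the coordinates of $g_s$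 are standard normal, $\mathbb{E}[w_sw_s^\top]=I$, and each coordinate $w_{s,i}$ is $\sigma^2$-sub-Gaussian, that is, $\mathbb{E}\,e^{\lambda w_{s,i}}\le e^{\sigma^2\lambda^2/2}$ for all $\lambda\in\mathbb{R}$. *Estimate.* Let $\hat\Phi\in\mathbb{R}^{d_x(d_x+d_u)\times d_\theta}$ be a fixed matrix with orthonormal columns, let $z_s=\begin{bmatrix}x_s\\u_s\end{bmatrix}$, and let $$\hat\theta=\Lambda^\dagger\sum_{s=1}^t\hat\Phi^\top(z_s\otimes I_{d_x})x_{s+1},\qquad \Lambda=\sum_{s=1}^t\hat\Phi^\top(z_sz_s^\top\otimes I_{d_x})\hat\Phi .$$ Let $d(\hat\Phi,\Phi^\star)=\|\hat\Phi_\perp^\top\Phi^\star\| = \|(I-\hat\Phi\hat\Phi^\top)\Phi^\star\|$, where $\hat\Phi_\perp$ completes $\hat\Phi$ to an orthogonal matrix $[\hat\Phi\ \hat\Phi_\perp]$. *Claim.* For $\delta\in(0,1/2)$ and $\bar x \ge 0$ put $$\tau_{\rm ls}(K,\bar x,\delta)=\max\Big\{\sigma^4\|P_K\|^3\Psi_{B^\star}^2\big(d_x+d_u+\log\tfrac1\delta\big),\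 \bar x\,\|P_K\|+1\Big\},$$ $$\bar\Delta^t=\hat\Phi^\top\left(\left(\frac1t\sum_{s=0}^{t-2}\sum_{j=0}^{s}\begin{bmatrix}I\\K\end{bmatrix}A_K^j(\sigma_u^2B^\star B^{\star\top}+I)(A_K^j)^\top\begin{bmatrix}I\\K\end{bmatrix}^\top+\begin{bmatrix}0&0\\0&\sigma_u^2I_{d_u}\end{bmatrix}\right)\otimes I_{d_x}\right)\hat\Phi ,$$ and suppose $\lambda_{\min}(\bar\Delta^t)>0$ (otherwise the bound below is to be read as $+\infty$). Then there is an event $\mathcal{E}$ of probability at least $1-\delta$ such that, at every outcome in $\mathcal{E}$ at which $t\ge c\,\tau_{\rm ls}(K,\|x_1\|^2,\delta)$, $$\|\hat\Phi\hat\theta-\Phi^\star\theta^\star\|^2\le C\left[\frac{d_\theta\sigma^2}{t\,\lambda_{\min}(\bar\Delta^t)}\log\frac1\delta+\left(1+\frac{\sigma^4\|P_K\|^7\Psi_{B^\star}^6\big(d_x+d_u+\log\frac1\delta\big)}{t\,\lambda_{\min}(\bar\Delta^t)^2}\right)\frac{\|P_K\|^2\Psi_{B^\star}^2\,d(\hat\Phi,\Phi^\star)^2\,\|\theta^\star\|^2}{\lambda_{\min}(\bar\Delta^t)}\right].$$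 -/

import Mathlib

open Matrix MeasureTheory ProbabilityTheory
open scoped NNReal Kronecker

noncomputable section

namespace LSEst

/-- Euclidean norm of a real vector. -/
def vnorm {ι : Type*} [Fintype ι] (v : ι → ℝ) : ℝ :=
  ‖(WithLp.toLp 2 v : EuclideanSpace ℝ ι)‖

open scoped Matrix.Norms.L2Operator in
/-- Spectral norm of a real matrix (operator norm for the Euclidean norms). -/
def opNorm {m n : Type*} [Fintype m] [Fintype n] [DecidableEq n] (M : Matrix m n ℝ) : ℝ :=
  ‖M‖

/-- Smallest eigenvalue of a (nonempty) real symmetric matrix. -/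
def lambdaMin {n : Type*} [Fintype n] [DecidableEq n] (S : Matrix n n ℝ) : ℝ :=
  sInf (spectrum ℝ S)

/-- All complex eigenvalues of the real matrix lie in the open unit disc. -/
def IsStable {n : Type*} [Fintype n] [DecidableEq n] (M : Matrix n n ℝ) : Prop :=
  ∀ z ∈ spectrum ℂ (M.map (fun r : ℝ => (r : ℂ))), ‖z‖ < 1

/-- For stable `M`, the solution `P = ∑_{j ≥ 0} (Mᵀ)^j S M^j` of the discrete Lyapunov equation
`P = Mᵀ P M + S`. -/
def dlyap {n : Type*} [Fintype n] [DecidableEq n] (M S : Matrix n n ℝ) : Matrix n n ℝ :=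
  ∑' j : ℕ, Mᵀ ^ j * S * M ^ j

/-- Moore-Penrose pseudoinverse of a real symmetric matrix: the functional calculus of
`r ↦ r⁻¹` (where `0⁻¹ = 0`). -/
def symPinv {n : Type*} [Fintype n] [DecidableEq n] (S : Matrix n n ℝ) : Matrix n n ℝ :=
  cfc (fun r : ℝ => r⁻¹) S

/-- `M M† M = M` and `M† M M† = M†`, and `M M† = M† M` is symmetric. -/
theorem symPinv_spec {n : Type*} [Fintype n] [DecidableEq n] (S : Matrix n n ℝ)
    (hS : S.IsHermitian) :
    S * symPinv S * S = S ∧ symPinv S * S * symPinv S = symPinv S ∧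
      (S * symPinv S)ᵀ = S * symPinv S ∧ (symPinv S * S)ᵀ = symPinv S * S := by
  have hsa : IsSelfAdjoint S := hS
  have hc : ∀ f : ℝ → ℝ, ContinuousOn f (spectrum ℝ S) :=
    fun f => (Matrix.finite_real_spectrum (A := S)).continuousOn f
  have hid : cfc (fun r : ℝ => r) S = S := cfc_id' ℝ S
  have h1 : S * symPinv S = cfc (fun r : ℝ => r * r⁻¹) S := by
    rw [cfc_mul _ _ S (hc _) (hc _), hid, symPinv]
  have h2 : symPinv S * S = cfc (fun r : ℝ => r * r⁻¹) S := by
    have : (fun r : ℝ => r * r⁻¹) = fun r : ℝ => r⁻¹ * r := by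
      funext r; ring
    rw [this, cfc_mul _ _ S (hc _) (hc _), hid, symPinv]
  have h3 : (cfc (fun r : ℝ => r * r⁻¹) S)ᵀ = cfc (fun r : ℝ => r * r⁻¹) S := by
    have h : IsSelfAdjoint (cfc (fun r : ℝ => r * r⁻¹) S) := cfc_predicate _ S
    have h' := h.star_eq
    rwa [Matrix.star_eq_conjTranspose, Matrix.conjTranspose_eq_transpose_of_trivial] at h'
  refine ⟨?_, ?_, by rw [h1, h3], by rw [h2, h3]⟩
  · rw [h1]
    calc cfc (fun r : ℝ => r * r⁻¹) S * S
        = cfc (fun r : ℝ => r * r⁻¹) S * cfc (fun r : ℝ => r) S := by rw [hid]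
      _ = cfc (fun r : ℝ => r * r⁻¹ * r) S := (cfc_mul _ _ S (hc _) (hc _)).symm
      _ = cfc (fun r : ℝ => r) S := by simp only [mul_inv_mul_cancel]
      _ = S := hid
  · rw [h2]
    calc cfc (fun r : ℝ => r * r⁻¹) S * symPinv S
        = cfc (fun r : ℝ => r * r⁻¹ * r⁻¹) S := (cfc_mul _ _ S (hc _) (hc _)).symm
      _ = symPinv S := by
        unfold symPinv
        congr 1
        funext r
        by_cases hr : r = 0
        · simp [hr]
        · rw [mul_inv_cancel₀ hr, one_mul]

/-- Subspace distance: the spectral norm of `(I - Φ̂ Φ̂ᵀ) Φ`. -/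
def subspaceDist {N p q : Type*} [Fintype N] [DecidableEq N] [Fintype p] [Fintype q]
    [DecidableEq q] (Φhat : Matrix N p ℝ) (Φ : Matrix N q ℝ) : ℝ :=
  opNorm ((1 - Φhat * Φhatᵀ) * Φ)

open scoped Matrix.Norms.L2Operator in
/-- If `Φperp` completes `Φhat` to an orthogonal matrix, the distance is `‖Φperpᵀ Φ‖`. -/
theorem subspaceDist_eq {N p q r : Type*} [Fintype N] [DecidableEq N] [Fintype p] [Fintype q]
    [DecidableEq q] [Fintype r] [DecidableEq r] [DecidableEq p]
    (Φhat : Matrix N p ℝ) (Φ : Matrix N q ℝ) (Φperp : Matrix N r ℝ)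
    (h1 : (fromCols Φhat Φperp)ᵀ * fromCols Φhat Φperp = 1)
    (h2 : fromCols Φhat Φperp * (fromCols Φhat Φperp)ᵀ = 1) :
    subspaceDist Φhat Φ = opNorm (Φperpᵀ * Φ) := by
  have hp : Φperpᵀ * Φperp = 1 := by
    have h := congrArg Matrix.toBlocks₂₂ h1
    rw [Matrix.transpose_fromCols, Matrix.fromRows_mul_fromCols] at h
    rw [Matrix.toBlocks_fromBlocks₂₂, ← Matrix.fromBlocks_one, Matrix.toBlocks_fromBlocks₂₂] at h
    exact h
  have hs : 1 - Φhat * Φhatᵀ = Φperp * Φperpᵀ := by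
    rw [Matrix.transpose_fromCols, Matrix.fromCols_mul_fromRows] at h2
    rw [← h2, add_sub_cancel_left]
  have key : ((1 - Φhat * Φhatᵀ) * Φ)ᴴ * ((1 - Φhat * Φhatᵀ) * Φ)
      = (Φperpᵀ * Φ)ᴴ * (Φperpᵀ * Φ) := by
    rw [hs]
    simp only [Matrix.conjTranspose_eq_transpose_of_trivial, Matrix.transpose_mul,
      Matrix.transpose_transpose, Matrix.mul_assoc]
    rw [← Matrix.mul_assoc Φperpᵀ Φperp, hp, Matrix.one_mul]
  have e : opNorm ((1 - Φhat * Φhatᵀ) * Φ) * opNorm ((1 - Φhat * Φhatᵀ) * Φ)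
      = opNorm (Φperpᵀ * Φ) * opNorm (Φperpᵀ * Φ) := by
    unfold opNorm
    rw [← Matrix.l2_opNorm_conjTranspose_mul_self, ← Matrix.l2_opNorm_conjTranspose_mul_self, key]
  have nn : ∀ X : Matrix N q ℝ, 0 ≤ opNorm X := fun X => by unfold opNorm; exact norm_nonneg X
  have nn' : 0 ≤ opNorm (Φperpᵀ * Φ) := by unfold opNorm; exact norm_nonneg _
  exact (mul_self_inj (nn _) nn').mp e

attribute [local instance] Matrix.linftyOpNormedRing Matrix.linftyOpNormedAlgebra in
theorem IsStable.exists_bound {n : Type*} [Fintype n] [DecidableEq n] {M : Matrix n n ℝ}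
    (hM : IsStable M) :
    ∃ C r : ℝ, 0 ≤ C ∧ 0 ≤ r ∧ r < 1 ∧ ∀ (k : ℕ) (a b : n), |(M ^ k) a b| ≤ C * r ^ k := by
  rcases isEmpty_or_nonempty n with hn | hn
  · exact ⟨0, 0, le_rfl, le_rfl, one_pos, fun k a => (hn.false a).elim⟩
  set Z : Matrix n n ℂ := M.map (fun r : ℝ => (r : ℂ)) with hZ
  have hpow : ∀ k : ℕ, Z ^ k = (M ^ k).map (fun r : ℝ => (r : ℂ)) := fun k =>
    (map_pow (Complex.ofRealHom.mapMatrix : Matrix n n ℝ →+* Matrix n n ℂ) M k).symm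
  have hρ : spectralRadius ℂ Z < ((1 : ℝ≥0) : ENNReal) :=
    spectrum.spectralRadius_lt_of_forall_lt Z fun z hz => by
      have := hM z hz
      exact_mod_cast this
  obtain ⟨r, hr1, hr2⟩ := ENNReal.lt_iff_exists_nnreal_btwn.mp hρ
  have hr0 : 0 < r := by
    have h0 : (0 : ENNReal) < r := lt_of_le_of_lt bot_le hr1
    exact_mod_cast h0
  have hG := (spectrum.pow_nnnorm_pow_one_div_tendsto_nhds_spectralRadius Z).eventually
    (gt_mem_nhds hr1)
  have hO : (fun k : ℕ => Z ^ k) =O[Filter.atTop] (fun k : ℕ => (r : ℝ) ^ k) := by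
    refine Asymptotics.IsBigO.of_bound 1 ?_
    filter_upwards [hG, Filter.eventually_gt_atTop 0] with k hk hk0
    have h1 : (‖Z ^ k‖₊ : ENNReal) ≤ (r : ENNReal) ^ k := by
      have h2 := ENNReal.rpow_le_rpow hk.le (Nat.cast_nonneg (α := ℝ) k)
      rwa [← ENNReal.rpow_mul, one_div, inv_mul_cancel₀ (by positivity), ENNReal.rpow_one,
        ENNReal.rpow_natCast] at h2
    have h3 : ‖Z ^ k‖₊ ≤ r ^ k := by exact_mod_cast h1
    have h4 : ‖Z ^ k‖ ≤ (r : ℝ) ^ k := by exact_mod_cast h3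
    simpa [abs_of_nonneg] using h4
  obtain ⟨C, hC⟩ := (Asymptotics.isBigO_nat_atTop_iff (fun k hk =>
    absurd hk (pow_pos (NNReal.coe_pos.mpr hr0) k).ne')).mp hO
  have hle : ∀ k : ℕ, ‖Z ^ k‖ ≤ C * (r : ℝ) ^ k := fun k => by
    simpa [abs_of_nonneg] using hC k
  refine ⟨C, r, ?_, r.2, by exact_mod_cast hr2, fun k a b => ?_⟩
  · have := (norm_nonneg _).trans (hle 0)
    simpa using this
  · refine le_trans ?_ (hle k)
    have h5 : |(M ^ k) a b| = ‖(Z ^ k) a b‖ := by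
      rw [hpow, Matrix.map_apply, Complex.norm_real, Real.norm_eq_abs]
    have h6 : ‖(Z ^ k) a b‖₊ ≤ ‖Z ^ k‖₊ := by
      rw [Matrix.linfty_opNNNorm_def]
      exact (Finset.single_le_sum (f := fun j => ‖(Z ^ k) a j‖₊)
        (fun _ _ => bot_le) (Finset.mem_univ b)).trans
        (Finset.le_sup (f := fun i => ∑ j, ‖(Z ^ k) i j‖₊) (Finset.mem_univ a))
    rw [h5]
    exact_mod_cast h6

/-- The series `dlyap M S` solves the discrete Lyapunov equation when `M` is stable. -/
theorem dlyap_eq {n : Type*} [Fintype n] [DecidableEq n] (M S : Matrix n n ℝ)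
    (hM : IsStable M) : dlyap M S = Mᵀ * dlyap M S * M + S := by
  obtain ⟨C, r, hC, hr0, hr1, hb⟩ := hM.exists_bound
  have hsum : Summable (fun j : ℕ => Mᵀ ^ j * S * M ^ j) := by
    refine Pi.summable.mpr fun a => Pi.summable.mpr fun b => ?_
    have hg : Summable (fun j : ℕ => (∑ c, ∑ d, C * |S d c| * C) * (r * r) ^ j) :=
      (summable_geometric_of_lt_one (mul_nonneg hr0 hr0)
        (by nlinarith)).mul_left _
    refine Summable.of_norm_bounded hg fun j => ?_
    rw [Matrix.mul_apply, Finset.sum_mul]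
    refine (norm_sum_le _ _).trans (Finset.sum_le_sum fun c _ => ?_)
    rw [Matrix.mul_apply, Finset.sum_mul, Finset.sum_mul]
    refine (norm_sum_le _ _).trans (Finset.sum_le_sum fun d _ => ?_)
    rw [← Matrix.transpose_pow, Matrix.transpose_apply, Real.norm_eq_abs, abs_mul, abs_mul]
    calc |(M ^ j) d a| * |S d c| * |(M ^ j) c b|
        ≤ (C * r ^ j) * |S d c| * (C * r ^ j) := by
          gcongr
          · exact hb j d a
          · exact hb j c b
      _ = C * |S d c| * C * (r * r) ^ j := by rw [mul_pow]; ring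
  unfold dlyap
  have hT : ∀ j : ℕ, Mᵀ ^ (j + 1) * S * M ^ (j + 1) = Mᵀ * (Mᵀ ^ j * S * M ^ j) * M := fun j => by
    rw [pow_succ' Mᵀ, pow_succ M]
    simp only [Matrix.mul_assoc]
  conv_lhs => rw [hsum.tsum_eq_zero_add]
  simp only [hT]
  rw [(hsum.mul_left Mᵀ).tsum_mul_right, hsum.tsum_mul_left]
  simp [add_comm]

/-- `Ψ_B = max {1, ‖B‖}`. -/
def Psi {n m : ℕ} (B : Matrix (Fin n) (Fin m) ℝ) : ℝ := max 1 (opNorm B)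

/-- `P_K`, the solution of the Lyapunov equation for the closed loop `A + B K` with stage cost
`xᵀ Q x + uᵀ u`, that is, with `S = Q + Kᵀ K`. -/
def lyapP {n m : ℕ} (A : Matrix (Fin n) (Fin n) ℝ) (B : Matrix (Fin n) (Fin m) ℝ)
    (Q : Matrix (Fin n) (Fin n) ℝ) (K : Matrix (Fin m) (Fin n) ℝ) : Matrix (Fin n) (Fin n) ℝ :=
  dlyap (A + B * K) (Q + Kᵀ * K)

/-- The burn-in time `max {σ⁴ ‖P‖³ Ψ² (n + m + log (1/δ)), xbar ‖P‖ + 1}`. -/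
def tauLS (n m : ℕ) (σ normP Ψ xbar δ : ℝ) : ℝ :=
  max (σ ^ 4 * normP ^ 3 * Ψ ^ 2 * ((n : ℝ) + (m : ℝ) + Real.log (1 / δ))) (xbar * normP + 1)

/-- The matrix `t⁻¹ ∑_{s=0}^{t-2} ∑_{j=0}^{s} [I; K] A_K^j (σu² B Bᵀ + I) (A_K^j)ᵀ [I; K]ᵀ
+ diag (0, σu² I)` with `A_K = A + B K`. -/
def avgCov {n m : ℕ} (A : Matrix (Fin n) (Fin n) ℝ) (B : Matrix (Fin n) (Fin m) ℝ)
    (K : Matrix (Fin m) (Fin n) ℝ) (σu : ℝ) (t : ℕ) :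
    Matrix (Fin n ⊕ Fin m) (Fin n ⊕ Fin m) ℝ :=
  (t : ℝ)⁻¹ • (∑ s ∈ Finset.range (t - 1), ∑ j ∈ Finset.range (s + 1),
      fromRows (1 : Matrix (Fin n) (Fin n) ℝ) K * (A + B * K) ^ j *
        (σu ^ 2 • (B * Bᵀ) + (1 : Matrix (Fin n) (Fin n) ℝ)) *
        ((A + B * K) ^ j)ᵀ * (fromRows (1 : Matrix (Fin n) (Fin n) ℝ) K)ᵀ)
    + fromBlocks 0 0 0 (σu ^ 2 • (1 : Matrix (Fin m) (Fin m) ℝ))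

/-- The projected excitation matrix `Φᵀ (avgCov ⊗ I) Φ`. -/
def Delta {n m d : ℕ} (A : Matrix (Fin n) (Fin n) ℝ) (B : Matrix (Fin n) (Fin m) ℝ)
    (K : Matrix (Fin m) (Fin n) ℝ) (σu : ℝ) (t : ℕ)
    (Φ : Matrix ((Fin n ⊕ Fin m) × Fin n) (Fin d) ℝ) : Matrix (Fin d) (Fin d) ℝ :=
  Φᵀ * (avgCov A B K σu t ⊗ₖ (1 : Matrix (Fin n) (Fin n) ℝ)) * Φ

/-- The matrix `z ⊗ I_n` for a column vector `z`. -/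
def kronId {ι : Type*} (n : ℕ) (z : ι → ℝ) : Matrix (ι × Fin n) (Fin n) ℝ :=
  Matrix.of fun p r => z p.1 * (1 : Matrix (Fin n) (Fin n) ℝ) p.2 r

/-- `Λ = ∑_s Φᵀ ([x_s; u_s] [x_s; u_s]ᵀ ⊗ I) Φ`, over the first `t` samples. -/
def lsGram {n m d : ℕ} (Φ : Matrix ((Fin n ⊕ Fin m) × Fin n) (Fin d) ℝ) (t : ℕ)
    (x : ℕ → Fin n → ℝ) (u : ℕ → Fin m → ℝ) : Matrix (Fin d) (Fin d) ℝ :=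
  ∑ s ∈ Finset.range t,
    Φᵀ * (vecMulVec (Sum.elim (x s) (u s)) (Sum.elim (x s) (u s)) ⊗ₖ
      (1 : Matrix (Fin n) (Fin n) ℝ)) * Φ

/-- The least squares estimate `Λ† ∑_s Φᵀ ([x_s; u_s] ⊗ I) x_{s+1}`, over the first `t`
samples. -/
def lsEstimate {n m d : ℕ} (Φ : Matrix ((Fin n ⊕ Fin m) × Fin n) (Fin d) ℝ) (t : ℕ)
    (x : ℕ → Fin n → ℝ) (u : ℕ → Fin m → ℝ) : Fin d → ℝ :=
  symPinv (lsGram Φ t x u) *ᵥ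
    ∑ s ∈ Finset.range t, Φᵀ *ᵥ (kronId n (Sum.elim (x s) (u s)) *ᵥ x (s + 1))

/-- The random data. Time is counted from `0`: `x s`, `u s`, `w s`, `g s` are the state, input,
process noise and exploration noise at time `s + 1`, so that `x 0` is the initial state. The
initial state is random and independent of the noise; all noise coordinates are independent, the
process noise has identity covariance and `σ²`-sub-Gaussian mean-zero coordinates (zero mean
follows from the moment generating function bound), the exploration noise is standard normal. -/
structure IsRollout {Ω : Type*} [MeasurableSpace Ω] (μ : Measure Ω) {n m : ℕ}
    (A : Matrix (Fin n) (Fin n) ℝ) (B : Matrix (Fin n) (Fin m) ℝ)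
    (K : Matrix (Fin m) (Fin n) ℝ) (σu : ℝ) (σ : ℝ≥0)
    (x : ℕ → Ω → Fin n → ℝ) (u : ℕ → Ω → Fin m → ℝ)
    (w : ℕ → Ω → Fin n → ℝ) (g : ℕ → Ω → Fin m → ℝ) : Prop where
  state_eq : ∀ s ω, x (s + 1) ω = A *ᵥ x s ω + B *ᵥ u s ω + w s ω
  input_eq : ∀ s ω, u s ω = K *ᵥ x s ω + σu • g s ω
  measurable_init : Measurable (x 0)
  measurable_w : ∀ s, Measurable (w s)
  measurable_g : ∀ s, Measurable (g s)
  subgaussian_w : ∀ s i, HasSubgaussianMGF (fun ω => w s ω i) (σ ^ 2) μ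
  cov_w : ∀ s i j, ∫ ω, w s ω i * w s ω j ∂μ = if i = j then 1 else 0
  gaussian_g : ∀ s j, μ.map (fun ω => g s ω j) = gaussianReal 0 1
  indep_noise : iIndepFun
    (fun (p : ℕ × (Fin n ⊕ Fin m)) (ω : Ω) => Sum.elim (w p.1 ω) (g p.1 ω) p.2) μ
  indep_init : IndepFun (x 0)
    (fun (ω : Ω) (p : ℕ × (Fin n ⊕ Fin m)) => Sum.elim (w p.1 ω) (g p.1 ω) p.2) μ

end LSEst

end

/-!
The regressor `z_s = [x_s; u_s]` is the sum of a drift, which the Lyapunov function `P_K` makes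
square summable over time, and a linear function of the noise up to time `s`. In a fixed direction,
the energy of the noise part over `t` steps is a quadratic form in independent sub-Gaussian
variables, and `P_K` controls the norm of its matrix. The Hanson–Wright inequality and a union bound
over a net of directions, chosen in the geometry of the covariance itself, show that the empirical
second moments of the noise part agree with the true ones up to a constant factor in all directions
at once. After the burn-in time the drift is negligible, so the Gram matrix of the regressors is
comparable to `t` times their average covariance.

On that event, the sums `∑ ⟨M z_s, w_s⟩` have a known quadratic variation, and an exponential
supermartingale bounds them for each fixed `M`. A union bound over a net of the `d`-dimensional
model makes this uniform in the geometry of `Δ`.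

The rest is deterministic. Split the true parameter `q = Φ* θ*` into its projection onto the range
of the orthonormal matrix `Φ` and the residual `v`. The normal equations, tested against the error
`e` within the range, read `∑ ‖E_s Φ e‖² = ∑ ⟨E_s Φ e, E_s v⟩ + ∑ ⟨E_s Φ e, w_s⟩`, where
`E_s = (z_s ⊗ I)ᵀ`. Both terms on the right are absorbed by the left one, at the cost of the energy
of the residual and of the noise bound, and the total error is `‖e‖² + ‖v‖²` by Pythagoras.
-/

noncomputable section

namespace LSEst

open Real (exp log)
open Finset (range)
open ENNReal (ofReal)
open scoped ENNReal

section Euclidean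

variable {m n p : Type*} [Fintype m] [Fintype n] [Fintype p]

theorem vnorm_sq (v : n → ℝ) : vnorm v ^ 2 = v ⬝ᵥ v := by
  rw [vnorm, EuclideanSpace.real_norm_sq_eq]
  simp only [dotProduct, sq]

theorem vnorm_nonneg (v : n → ℝ) : 0 ≤ vnorm v := norm_nonneg _

theorem dotProduct_self_nonneg (v : n → ℝ) : 0 ≤ v ⬝ᵥ v := by
  simpa only [star_trivial] using dotProduct_star_self_nonneg v

theorem abs_dotProduct_le (u v : n → ℝ) : |u ⬝ᵥ v| ≤ vnorm u * vnorm v := by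
  have h := abs_real_inner_le_norm (WithLp.toLp 2 v) (WithLp.toLp 2 u)
  rwa [EuclideanSpace.inner_eq_star_dotProduct, star_trivial, mul_comm] at h

theorem dotProduct_transpose_mulVec (M : Matrix m n ℝ) (u : m → ℝ) (v : n → ℝ) :
    (Mᵀ *ᵥ u) ⬝ᵥ v = u ⬝ᵥ M *ᵥ v := by
  rw [mulVec_transpose, dotProduct_mulVec]

theorem dotProduct_transpose_mul_self_mulVec (M : Matrix m n ℝ) (v : n → ℝ) :
    v ⬝ᵥ (Mᵀ * M) *ᵥ v = (M *ᵥ v) ⬝ᵥ (M *ᵥ v) := by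
  rw [← mulVec_mulVec, dotProduct_comm, dotProduct_transpose_mulVec]

theorem dotProduct_transpose_mul_mul_mulVec (M : Matrix m n ℝ) (S : Matrix m m ℝ) (v : n → ℝ) :
    v ⬝ᵥ (Mᵀ * S * M) *ᵥ v = (M *ᵥ v) ⬝ᵥ S *ᵥ (M *ᵥ v) := by
  rw [Matrix.mul_assoc, ← mulVec_mulVec, ← mulVec_mulVec, dotProduct_comm,
    dotProduct_transpose_mulVec, dotProduct_comm]

theorem dotProduct_mul_transpose_self_mulVec (M : Matrix m n ℝ) (v : m → ℝ) :
    v ⬝ᵥ (M * Mᵀ) *ᵥ v = (Mᵀ *ᵥ v) ⬝ᵥ (Mᵀ *ᵥ v) := by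
  rw [← mulVec_mulVec, dotProduct_transpose_mulVec]

theorem dotProduct_sum_type (v w : m ⊕ n → ℝ) :
    v ⬝ᵥ w = (v ∘ Sum.inl) ⬝ᵥ (w ∘ Sum.inl) + (v ∘ Sum.inr) ⬝ᵥ (w ∘ Sum.inr) :=
  Fintype.sum_sum_type _

theorem dotProduct_mulVec_fromBlocks_diagonal (S : Matrix m m ℝ) (T : Matrix n n ℝ)
    (v : m ⊕ n → ℝ) : v ⬝ᵥ fromBlocks S 0 0 T *ᵥ v
      = (v ∘ Sum.inl) ⬝ᵥ S *ᵥ (v ∘ Sum.inl) + (v ∘ Sum.inr) ⬝ᵥ T *ᵥ (v ∘ Sum.inr) := by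
  simp only [fromBlocks_mulVec, dotProduct_sum_type v, Sum.elim_comp_inl, Sum.elim_comp_inr,
    zero_mulVec, add_zero, zero_add]

omit [Fintype n] in
theorem posSemidef_transpose_mul_self [Finite n] (M : Matrix m n ℝ) : (Mᵀ * M).PosSemidef := by
  simpa only [conjTranspose_eq_transpose_of_trivial] using posSemidef_conjTranspose_mul_self M

theorem trace_transpose_mul_self_nonneg (M : Matrix m n ℝ) : 0 ≤ (Mᵀ * M).trace :=
  (posSemidef_transpose_mul_self M).trace_nonneg

theorem trace_transpose_mul_self (M : Matrix m n ℝ) : (Mᵀ * M).trace = ∑ i, ∑ j, M i j ^ 2 := by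
  simp only [trace, diag, mul_apply, transpose_apply, ← sq]
  exact Finset.sum_comm

section OpNorm

open scoped Matrix.Norms.L2Operator

variable [DecidableEq n]

theorem opNorm_nonneg (M : Matrix m n ℝ) : 0 ≤ opNorm M := norm_nonneg M

theorem vnorm_mulVec_le (M : Matrix m n ℝ) (v : n → ℝ) : vnorm (M *ᵥ v) ≤ opNorm M * vnorm v :=
  Matrix.l2_opNorm_mulVec M (WithLp.toLp 2 v)

theorem dotProduct_mulVec_self_le (M : Matrix m n ℝ) (v : n → ℝ) :
    (M *ᵥ v) ⬝ᵥ (M *ᵥ v) ≤ opNorm M ^ 2 * (v ⬝ᵥ v) := by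
  rw [← vnorm_sq, ← vnorm_sq, ← mul_pow]
  exact pow_le_pow_left₀ (vnorm_nonneg _) (vnorm_mulVec_le M v) 2

theorem opNorm_sq_le_of_forall {M : Matrix m n ℝ} {β : ℝ} (hβ : 0 ≤ β)
    (h : ∀ v, (M *ᵥ v) ⬝ᵥ (M *ᵥ v) ≤ β * (v ⬝ᵥ v)) : opNorm M ^ 2 ≤ β := by
  have hbound : opNorm M ≤ √β := by
    rw [opNorm, Matrix.l2_opNorm_def]
    refine ContinuousLinearMap.opNorm_le_bound _ (Real.sqrt_nonneg _) fun v => ?_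
    have hv := h v.ofLp
    rw [← vnorm_sq, ← vnorm_sq] at hv
    refine abs_le_of_sq_le_sq' ?_ (by positivity) |>.2
    rw [mul_pow, Real.sq_sqrt hβ]
    exact hv
  exact Real.sq_sqrt hβ ▸ pow_le_pow_left₀ (opNorm_nonneg M) hbound 2

theorem opNorm_smul (c : ℝ) (M : Matrix m n ℝ) : opNorm (c • M) = |c| * opNorm M :=
  norm_smul c M

theorem opNorm_transpose [DecidableEq m] (M : Matrix m n ℝ) : opNorm Mᵀ = opNorm M := by
  rw [← conjTranspose_eq_transpose_of_trivial]
  exact Matrix.l2_opNorm_conjTranspose M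

theorem opNorm_transpose_mul_self (M : Matrix m n ℝ) : opNorm (Mᵀ * M) = opNorm M ^ 2 := by
  rw [← conjTranspose_eq_transpose_of_trivial, sq]
  exact Matrix.l2_opNorm_conjTranspose_mul_self M

theorem abs_dotProduct_mulVec_le (M : Matrix m n ℝ) (u : m → ℝ) (v : n → ℝ) :
    |u ⬝ᵥ M *ᵥ v| ≤ opNorm M * (vnorm u * vnorm v) := by
  calc |u ⬝ᵥ M *ᵥ v| ≤ vnorm u * vnorm (M *ᵥ v) := abs_dotProduct_le _ _
    _ ≤ vnorm u * (opNorm M * vnorm v) := by gcongr; exacts [vnorm_nonneg u, vnorm_mulVec_le M v]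
    _ = opNorm M * (vnorm u * vnorm v) := by ring

theorem abs_dotProduct_mulVec_self_le (M : Matrix n n ℝ) (v : n → ℝ) :
    |v ⬝ᵥ M *ᵥ v| ≤ opNorm M * (v ⬝ᵥ v) := by
  simpa only [← vnorm_sq, sq] using abs_dotProduct_mulVec_le M v v

theorem dotProduct_mulVec_self_le_opNorm_mul (M : Matrix n n ℝ) (v : n → ℝ) :
    v ⬝ᵥ M *ᵥ v ≤ opNorm M * (v ⬝ᵥ v) :=
  (le_abs_self _).trans (abs_dotProduct_mulVec_self_le M v)

theorem abs_apply_self_le_opNorm (M : Matrix n n ℝ) (i : n) : |M i i| ≤ opNorm M := by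
  simpa using abs_dotProduct_mulVec_self_le M (Pi.single i 1)

theorem trace_transpose_mul_self_mul_le (M : Matrix m n ℝ) (N : Matrix n p ℝ) :
    ((M * N)ᵀ * (M * N)).trace ≤ opNorm M ^ 2 * (Nᵀ * N).trace := by
  rw [trace, trace, Finset.mul_sum]
  exact Finset.sum_le_sum fun j _ => dotProduct_mulVec_self_le M (N.col j)

theorem eigenvalues_le_opNorm {S : Matrix n n ℝ} (hS : S.IsHermitian) (i : n) :
    hS.eigenvalues i ≤ opNorm S :=
  have : Nonempty n := ⟨i⟩
  (Real.le_norm_self _).trans (spectrum.norm_le_norm_of_mem (hS.eigenvalues_mem_spectrum_real i))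

end OpNorm

theorem exists_orthogonal_diagonalization [DecidableEq n] {S : Matrix n n ℝ}
    (hS : S.IsHermitian) :
    ∃ U : Matrix n n ℝ, Uᵀ * U = 1 ∧ S = U * diagonal hS.eigenvalues * Uᵀ := by
  refine ⟨hS.eigenvectorUnitary, ?_, ?_⟩
  · rw [← conjTranspose_eq_transpose_of_trivial, ← star_eq_conjTranspose]
    exact mem_unitaryGroup_iff'.mp hS.eigenvectorUnitary.2
  · rw [← conjTranspose_eq_transpose_of_trivial, ← star_eq_conjTranspose]
    exact hS.spectral_theorem

theorem exists_mul_transpose_eq_of_posSemidef [DecidableEq n] {S : Matrix n n ℝ}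
    (hS : S.PosSemidef) :
    ∃ (V : Matrix n n ℝ) (l : n → ℝ), V * Vᵀ = S ∧ Vᵀ * V = diagonal l ∧
      ∀ j, 0 ≤ l j ∧ l j ≤ opNorm S := by
  obtain ⟨U, hU, hUS⟩ := exists_orthogonal_diagonalization hS.1
  have hsqrt : (diagonal fun j => √(hS.1.eigenvalues j)) * (diagonal fun j => √(hS.1.eigenvalues j))
      = diagonal hS.1.eigenvalues := by
    rw [diagonal_mul_diagonal]
    simp only [Real.mul_self_sqrt (hS.eigenvalues_nonneg _)]
  refine ⟨U * diagonal fun j => √(hS.1.eigenvalues j), hS.1.eigenvalues, ?_, ?_,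
    fun j => ⟨hS.eigenvalues_nonneg j, eigenvalues_le_opNorm hS.1 j⟩⟩
  · rw [transpose_mul, diagonal_transpose, Matrix.mul_assoc, ← Matrix.mul_assoc (diagonal _),
      hsqrt, ← Matrix.mul_assoc, ← hUS]
  · rw [transpose_mul, diagonal_transpose, Matrix.mul_assoc, ← Matrix.mul_assoc Uᵀ, hU,
      Matrix.one_mul, hsqrt]

end Euclidean

section ExpMoment

variable {Ω : Type*} [MeasurableSpace Ω] {μ : Measure Ω} {X Y : Ω → ℝ}

/-- The exponential moment `E exp X`, as an element of `[0, ∞]`: a finite bound on it includes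
the integrability of `exp X`. -/
def expMoment (μ : Measure Ω) (X : Ω → ℝ) : ℝ≥0∞ := ∫⁻ ω, ofReal (exp (X ω)) ∂μ

theorem expMoment_add_const (X : Ω → ℝ) (c : ℝ) :
    expMoment μ (fun ω => X ω + c) = expMoment μ X * ofReal (exp c) := by
  simp only [expMoment, Real.exp_add, ENNReal.ofReal_mul (Real.exp_nonneg _)]
  exact lintegral_mul_const' _ _ ENNReal.ofReal_ne_top

theorem expMoment_eq_ofReal_integral (h : Integrable (fun ω => exp (X ω)) μ) :
    expMoment μ X = ofReal (∫ ω, exp (X ω) ∂μ) :=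
  (ofReal_integral_eq_lintegral_ofReal h (.of_forall fun _ => Real.exp_nonneg _)).symm

theorem expMoment_map {α : Type*} [MeasurableSpace α] {U : Ω → α} {f : α → ℝ} (hU : Measurable U)
    (hf : Measurable f) : expMoment (μ.map U) f = expMoment μ (fun ω => f (U ω)) :=
  lintegral_map (by fun_prop) hU

theorem integrable_exp_of_expMoment_le (hX : Measurable X) {c : ℝ}
    (h : expMoment μ X ≤ ofReal c) : Integrable (fun ω => exp (X ω)) μ := by
  refine ⟨hX.exp.aestronglyMeasurable, ?_⟩
  rw [hasFiniteIntegral_iff_ofReal (.of_forall fun _ => Real.exp_nonneg _)]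
  exact h.trans_lt ENNReal.ofReal_lt_top

theorem ofReal_exp_sum {ι : Type*} (s : Finset ι) (f : ι → ℝ) :
    ofReal (exp (∑ i ∈ s, f i)) = ∏ i ∈ s, ofReal (exp (f i)) := by
  rw [Real.exp_sum, ENNReal.ofReal_prod_of_nonneg fun _ _ => Real.exp_nonneg _]

theorem expMoment_sum_of_iIndepFun {ι : Type*} [Fintype ι] {X : ι → Ω → ℝ}
    (hX : ∀ i, Measurable (X i)) (hind : iIndepFun X μ) :
    expMoment μ (fun ω => ∑ i, X i ω) = ∏ i, expMoment μ (X i) := by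
  simp only [expMoment, ofReal_exp_sum]
  exact lintegral_prod_eq_prod_lintegral_of_indepFun Finset.univ
    (fun i ω => ofReal (exp (X i ω)))
    (hind.comp (fun _ x => ofReal (exp x)) fun _ => by fun_prop)
    fun i => (hX i).exp.ennreal_ofReal

theorem measure_le_exp_neg_mul_expMoment (hX : Measurable X) (r : ℝ) :
    μ {ω | r ≤ X ω} ≤ ofReal (exp (-r)) * expMoment μ X := by
  have hmarkov := mul_meas_ge_le_lintegral (μ := μ) hX.exp.ennreal_ofReal (ofReal (exp r))
  simp only [ENNReal.ofReal_le_ofReal_iff (Real.exp_nonneg _), Real.exp_le_exp] at hmarkov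
  calc μ {ω | r ≤ X ω} = ofReal (exp (-r)) * (ofReal (exp r) * μ {ω | r ≤ X ω}) := by
        rw [← mul_assoc, ← ENNReal.ofReal_mul (Real.exp_nonneg _), ← Real.exp_add]
        simp only [neg_add_cancel, Real.exp_zero, ENNReal.ofReal_one, one_mul]
    _ ≤ ofReal (exp (-r)) * expMoment μ X := by gcongr; exact hmarkov

theorem expMoment_sum_smul_le {ι : Type*} {s : Finset ι} {w : ι → ℝ} {X : ι → Ω → ℝ} {R : ℝ≥0∞}
    (hX : ∀ i ∈ s, Measurable (X i)) (hw : ∀ i ∈ s, 0 ≤ w i) (hw_sum : ∑ i ∈ s, w i = 1)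
    (hR : ∀ i ∈ s, expMoment μ (X i) ≤ R) :
    expMoment μ (fun ω => ∑ i ∈ s, w i * X i ω) ≤ R := by
  calc expMoment μ (fun ω => ∑ i ∈ s, w i * X i ω)
      ≤ ∫⁻ ω, ∑ i ∈ s, ofReal (w i) * ofReal (exp (X i ω)) ∂μ := by
        refine lintegral_mono fun ω => ?_
        simp only
        rw [Finset.sum_congr rfl fun i hi => (ENNReal.ofReal_mul (hw i hi)).symm,
          ← ENNReal.ofReal_sum_of_nonneg fun i hi => mul_nonneg (hw i hi) (Real.exp_nonneg _)]
        exact ENNReal.ofReal_le_ofReal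
          (convexOn_exp.map_sum_le hw hw_sum fun _ _ => Set.mem_univ _)
    _ = ∑ i ∈ s, ofReal (w i) * expMoment μ (X i) := by
        rw [lintegral_finsetSum' _ fun i hi =>
          ((hX i hi).exp.ennreal_ofReal.const_mul _).aemeasurable]
        exact Finset.sum_congr rfl fun i _ => lintegral_const_mul' _ _ ENNReal.ofReal_ne_top
    _ ≤ ∑ i ∈ s, ofReal (w i) * R := Finset.sum_le_sum fun i hi => by gcongr; exact hR i hi
    _ = R := by
        rw [← Finset.sum_mul, ← ENNReal.ofReal_sum_of_nonneg hw, hw_sum, ENNReal.ofReal_one,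
          one_mul]

theorem expMoment_add_le_of_two_mul (hX : Measurable X) (hY : Measurable Y) {a b : ℝ}
    (ha : expMoment μ (fun ω => 2 * X ω) ≤ ofReal (exp (2 * a)))
    (hb : expMoment μ (fun ω => 2 * Y ω) ≤ ofReal (exp (2 * b))) :
    expMoment μ (fun ω => X ω + Y ω) ≤ ofReal (exp (a + b)) := by
  have hshift : ∀ {Z : Ω → ℝ} {c : ℝ}, expMoment μ (fun ω => 2 * Z ω) ≤ ofReal (exp (2 * c)) →
      expMoment μ (fun ω => 2 * Z ω + -(2 * c)) ≤ 1 := fun {Z c} h => by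
    rw [expMoment_add_const, Real.exp_neg, ENNReal.ofReal_inv_of_pos (Real.exp_pos _)]
    exact ENNReal.div_le_of_le_mul (by rwa [one_mul])
  have hjensen := expMoment_sum_smul_le (μ := μ) (s := Finset.univ) (w := fun _ : Fin 2 => 1 / 2)
    (X := ![fun ω => 2 * X ω + -(2 * a), fun ω => 2 * Y ω + -(2 * b)]) (R := 1)
    (fun i _ => by fin_cases i; exacts [(hX.const_mul 2).add_const _, (hY.const_mul 2).add_const _])
    (by simp) (by simp)
    (by simpa using ⟨hshift ha, hshift hb⟩)
  have hsplit : ∀ ω, X ω + Y ω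
      = (1 / 2 * (2 * X ω + -(2 * a)) + 1 / 2 * (2 * Y ω + -(2 * b))) + (a + b) :=
    fun ω => by ring
  simp only [Fin.sum_univ_two, cons_val_zero, cons_val_one] at hjensen
  simp only [hsplit, expMoment_add_const]
  exact mul_le_of_le_one_left' hjensen

end ExpMoment

section Measurability

variable {α m n : Type*} [MeasurableSpace α] [Fintype n]

@[fun_prop]
theorem measurable_dotProduct {f g : α → n → ℝ} (hf : Measurable f) (hg : Measurable g) :
    Measurable fun a => f a ⬝ᵥ g a := by
  unfold dotProduct
  fun_prop

@[fun_prop]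
theorem measurable_mulVec (M : Matrix m n ℝ) {f : α → n → ℝ} (hf : Measurable f) :
    Measurable fun a => M *ᵥ f a := by
  unfold mulVec
  fun_prop

end Measurability

section SubgaussianVector

variable {Ω : Type*} [MeasurableSpace Ω] {μ : Measure Ω} {ι : Type*} [Fintype ι]
  {W : Ω → ι → ℝ} {k : ℝ≥0}

/-- The random vector `W` is sub-Gaussian with variance proxy `k`: every linear functional of it
has the moment generating function bound of a centred Gaussian vector of covariance `k • 1`. -/
def HasSubgaussianVec (W : Ω → ι → ℝ) (k : ℝ≥0) (μ : Measure Ω) : Prop :=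
  ∀ c : ι → ℝ, expMoment μ (fun ω => c ⬝ᵥ W ω) ≤ ofReal (exp (k / 2 * (c ⬝ᵥ c)))

theorem hasSubgaussianVec_of_iIndepFun {η : ι → Ω → ℝ} (hind : iIndepFun η μ)
    (hsub : ∀ i, HasSubgaussianMGF (η i) k μ) : HasSubgaussianVec (fun ω i => η i ω) k μ := by
  intro c
  have hsum : HasSubgaussianMGF (fun ω => ∑ i, c i * η i ω)
      (∑ i, NNReal.mk (c i ^ 2) (sq_nonneg _) * k) μ :=
    HasSubgaussianMGF.sum_of_iIndepFun (X := fun i ω => c i * η i ω)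
      (hind.comp (fun i y => c i * y) fun i => measurable_const_mul _)
      fun i _ => (hsub i).const_mul (c i)
  have hint := hsum.integrable_exp_mul 1
  have hmgf := hsum.mgf_le 1
  simp only [one_mul, mgf] at hint hmgf
  refine (expMoment_eq_ofReal_integral hint).trans_le
    (ENNReal.ofReal_le_ofReal (hmgf.trans_eq (congrArg exp ?_)))
  simp only [NNReal.coe_sum, NNReal.coe_mul, NNReal.coe_mk, dotProduct, ← sq, ← Finset.sum_mul]
  ring

theorem HasSubgaussianVec.expMoment_add_dotProduct_le [IsFiniteMeasure μ] {α : Type*}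
    [MeasurableSpace α] {U : Ω → α} (hsub : HasSubgaussianVec W k μ) (hUW : IndepFun U W μ)
    (hU : Measurable U) (hW : Measurable W) {f : α → ℝ} (hf : Measurable f) {h : α → ι → ℝ}
    (hh : Measurable h) :
    expMoment μ (fun ω => f (U ω) + h (U ω) ⬝ᵥ W ω)
      ≤ expMoment μ (fun ω => f (U ω) + k / 2 * (h (U ω) ⬝ᵥ h (U ω))) := by
  have hlaw := (indepFun_iff_map_prod_eq_prod_map_map hU.aemeasurable hW.aemeasurable).mp hUW
  have hjoint : Measurable fun p : α × (ι → ℝ) => f p.1 + h p.1 ⬝ᵥ p.2 := by fun_prop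
  calc expMoment μ (fun ω => f (U ω) + h (U ω) ⬝ᵥ W ω)
      = expMoment ((μ.map U).prod (μ.map W)) (fun p => f p.1 + h p.1 ⬝ᵥ p.2) := by
        rw [← hlaw, expMoment_map (hU.prodMk hW) hjoint]
    _ = ∫⁻ a, expMoment μ (fun ω => h a ⬝ᵥ W ω + f a) ∂(μ.map U) := by
        rw [expMoment, lintegral_prod _ hjoint.exp.ennreal_ofReal.aemeasurable]
        refine lintegral_congr fun a => ?_
        simp only [add_comm _ (f a)]
        exact expMoment_map (f := fun y => f a + h a ⬝ᵥ y) hW (by fun_prop)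
    _ ≤ ∫⁻ a, ofReal (exp (f a + k / 2 * (h a ⬝ᵥ h a))) ∂(μ.map U) := by
        refine lintegral_mono fun a => ?_
        rw [expMoment_add_const, add_comm (f a), Real.exp_add,
          ENNReal.ofReal_mul (Real.exp_nonneg _)]
        gcongr
        exact hsub (h a)
    _ = _ := expMoment_map (f := fun a => f a + k / 2 * (h a ⬝ᵥ h a)) hU (by fun_prop)

end SubgaussianVector

section Gaussian

variable {ι : Type*} [Fintype ι]

theorem expMoment_pi_sum {ν : ι → Measure ℝ} [∀ i, IsProbabilityMeasure (ν i)] {f : ι → ℝ → ℝ}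
    (hf : ∀ i, Measurable (f i)) :
    expMoment (Measure.pi ν) (fun x => ∑ i, f i (x i)) = ∏ i, expMoment (ν i) (f i) := by
  have hind : iIndepFun (fun i (x : ι → ℝ) => f i (x i)) (Measure.pi ν) :=
    iIndepFun_pi fun i => (hf i).aemeasurable
  have hprod := expMoment_sum_of_iIndepFun (fun i => (hf i).comp (measurable_pi_apply i)) hind
  exact hprod.trans (Finset.prod_congr rfl fun i _ =>
    (measurePreserving_eval ν i).lintegral_comp (hf i).exp.ennreal_ofReal)

theorem expMoment_gaussianReal_mul (a : ℝ) :
    expMoment (gaussianReal 0 1) (fun y => a * y) = ofReal (exp (a ^ 2 / 2)) := by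
  rw [expMoment_eq_ofReal_integral (integrable_exp_mul_gaussianReal a)]
  simpa [mgf] using congrArg ofReal (congrFun (mgf_fun_id_gaussianReal (μ := 0) (v := 1)) a)

theorem gaussianPDFReal_mul_exp_sq (c y : ℝ) :
    gaussianPDFReal 0 1 y * exp (c / 2 * y ^ 2)
      = (√(2 * Real.pi))⁻¹ * exp (-((1 - c) / 2) * y ^ 2) := by
  rw [gaussianPDFReal, mul_assoc, ← Real.exp_add, NNReal.coe_one, mul_one]
  congr 2
  ring

theorem expMoment_gaussianReal_sq {c : ℝ} (hc : c < 1) :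
    expMoment (gaussianReal 0 1) (fun y => c / 2 * y ^ 2) = ofReal (√(1 - c)⁻¹) := by
  have hint : Integrable fun y : ℝ => gaussianPDFReal 0 1 y * exp (c / 2 * y ^ 2) := by
    simp only [gaussianPDFReal_mul_exp_sq]
    exact (integrable_exp_neg_mul_sq (by linarith)).const_mul _
  have hval : ∫ y : ℝ, gaussianPDFReal 0 1 y * exp (c / 2 * y ^ 2) = √(1 - c)⁻¹ := by
    simp only [gaussianPDFReal_mul_exp_sq]
    rw [integral_const_mul, integral_gaussian, ← Real.sqrt_inv, ← Real.sqrt_mul (by positivity)]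
    have : 1 - c ≠ 0 := by linarith
    congr 1
    field_simp
  rw [expMoment, gaussianReal_of_var_ne_zero _ one_ne_zero,
    lintegral_withDensity_eq_lintegral_mul _ (measurable_gaussianPDF 0 1) (by fun_prop), ← hval,
    ofReal_integral_eq_lintegral_ofReal hint (.of_forall fun y =>
      mul_nonneg (gaussianPDFReal_nonneg _ _ _) (Real.exp_nonneg _))]
  exact lintegral_congr fun y => (ENNReal.ofReal_mul (gaussianPDFReal_nonneg _ _ _)).symm

theorem expMoment_gaussianReal_sq_le {c : ℝ} (hc0 : 0 ≤ c) (hc : c ≤ 1 / 2) :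
    expMoment (gaussianReal 0 1) (fun y => c / 2 * y ^ 2) ≤ ofReal (exp c) := by
  rw [expMoment_gaussianReal_sq (by linarith)]
  refine ENNReal.ofReal_le_ofReal (Real.sqrt_le_iff.mpr ⟨Real.exp_nonneg _, ?_⟩)
  rw [inv_le_iff_one_le_mul₀ (by linarith), ← Real.exp_nat_mul]
  calc 1 ≤ (2 * c + 1) * (1 - c) := by nlinarith
    _ ≤ exp (2 * c) * (1 - c) := by
        gcongr
        · linarith
        · exact Real.add_one_le_exp _

theorem expMoment_pi_gaussianReal_dotProduct (a : ι → ℝ) :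
    expMoment (Measure.pi fun _ : ι => gaussianReal 0 1) (fun h => a ⬝ᵥ h)
      = ofReal (exp (1 / 2 * (a ⬝ᵥ a))) := by
  calc expMoment (Measure.pi fun _ : ι => gaussianReal 0 1) (fun h => a ⬝ᵥ h)
      = ∏ i, ofReal (exp (a i ^ 2 / 2)) :=
        (expMoment_pi_sum fun i => measurable_const_mul (a i)).trans
          (Finset.prod_congr rfl fun i _ => expMoment_gaussianReal_mul (a i))
    _ = ofReal (exp (1 / 2 * (a ⬝ᵥ a))) := by
        rw [← ofReal_exp_sum, dotProduct, Finset.mul_sum]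
        simp only [sq, one_div, inv_mul_eq_div]

theorem expMoment_pi_gaussianReal_sq_le {c : ι → ℝ} (hc : ∀ i, 0 ≤ c i ∧ c i ≤ 1 / 2) :
    expMoment (Measure.pi fun _ : ι => gaussianReal 0 1) (fun h => ∑ i, c i / 2 * h i ^ 2)
      ≤ ofReal (exp (∑ i, c i)) := by
  rw [expMoment_pi_sum (f := fun i y => c i / 2 * y ^ 2) fun i => by fun_prop, ofReal_exp_sum]
  exact Finset.prod_le_prod' fun i _ => expMoment_gaussianReal_sq_le (hc i).1 (hc i).2

end Gaussian

section QuadraticForm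

variable {Ω : Type*} [MeasurableSpace Ω] {μ : Measure Ω} [SFinite μ] {ι : Type*} [Fintype ι]
  {W : Ω → ι → ℝ} {k : ℝ≥0}

/-- Writing `exp (½ ‖Vᵀ W‖²)` as the Gaussian average of `exp ⟨Vᵀ W, h⟩` makes the exponent linear
in `W`. -/
theorem HasSubgaussianVec.expMoment_quadratic_le [DecidableEq ι] (hsub : HasSubgaussianVec W k μ)
    (hW : Measurable W) {S : Matrix ι ι ℝ} (hS : S.PosSemidef) (hk : k * opNorm S ≤ 1 / 2) :
    expMoment μ (fun ω => 1 / 2 * (W ω ⬝ᵥ S *ᵥ W ω)) ≤ ofReal (exp (k * S.trace)) := by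
  obtain ⟨V, l, rfl, hVV, hl⟩ := exists_mul_transpose_eq_of_posSemidef hS
  have hform : ∀ ω, W ω ⬝ᵥ (V * Vᵀ) *ᵥ W ω = (Vᵀ *ᵥ W ω) ⬝ᵥ (Vᵀ *ᵥ W ω) := fun ω => by
    simpa only [transpose_transpose] using dotProduct_transpose_mul_self_mulVec Vᵀ (W ω)
  have hnorm : ∀ h : ι → ℝ, (k : ℝ) / 2 * ((V *ᵥ h) ⬝ᵥ (V *ᵥ h)) = ∑ j, k * l j / 2 * h j ^ 2 :=
    fun h => by
    rw [← dotProduct_transpose_mul_self_mulVec, hVV, dotProduct, Finset.mul_sum]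
    exact Finset.sum_congr rfl fun j _ => by rw [mulVec_diagonal]; ring
  have htrace : k * (V * Vᵀ).trace = ∑ j, k * l j := by
    rw [trace_mul_comm, hVV, trace_diagonal, Finset.mul_sum]
  calc expMoment μ (fun ω => 1 / 2 * (W ω ⬝ᵥ (V * Vᵀ) *ᵥ W ω))
      = ∫⁻ ω, ∫⁻ h, ofReal (exp ((V *ᵥ h) ⬝ᵥ W ω))
          ∂(Measure.pi fun _ : ι => gaussianReal 0 1) ∂μ := by
        refine lintegral_congr fun ω => ?_
        simp only [hform]
        rw [← expMoment_pi_gaussianReal_dotProduct, expMoment]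
        simp only [dotProduct_transpose_mulVec, dotProduct_comm (W ω)]
    _ = ∫⁻ h, expMoment μ (fun ω => (V *ᵥ h) ⬝ᵥ W ω)
          ∂(Measure.pi fun _ : ι => gaussianReal 0 1) := lintegral_lintegral_swap (by fun_prop)
    _ ≤ expMoment (Measure.pi fun _ : ι => gaussianReal 0 1)
          (fun h => ∑ j, k * l j / 2 * h j ^ 2) :=
        lintegral_mono fun h => by simpa only [hnorm] using hsub (V *ᵥ h)
    _ ≤ ofReal (exp (k * (V * Vᵀ).trace)) := by
        rw [htrace]
        exact expMoment_pi_gaussianReal_sq_le fun j => ⟨mul_nonneg k.2 (hl j).1,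
          (mul_le_mul_of_nonneg_left (hl j).2 k.2).trans hk⟩

end QuadraticForm

section SecondMoment

variable {Ω : Type*} [MeasurableSpace Ω] {μ : Measure Ω} {X : Ω → ℝ} {k : ℝ≥0}

theorem exp_le_one_add_add_sq_mul_exp_abs (x : ℝ) : exp x ≤ 1 + x + x ^ 2 * exp |x| := by
  have h := Complex.norm_exp_sub_sum_le_norm_mul_exp (x : ℂ) 2
  simp only [Finset.sum_range_succ, Finset.sum_range_zero, zero_add, pow_zero, pow_one,
    Nat.factorial, Nat.cast_one, div_one, mul_one] at h
  rw [← Complex.ofReal_exp, ← Complex.ofReal_one, ← Complex.ofReal_add, ← Complex.ofReal_sub,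
    Complex.norm_real, Complex.norm_real, Real.norm_eq_abs, Real.norm_eq_abs, sq_abs] at h
  linarith [le_abs_self (exp x - (1 + x))]

theorem one_add_sq_div_two_le_cosh (x : ℝ) : 1 + x ^ 2 / 2 ≤ Real.cosh x := by
  have h := (Real.hasSum_cosh x).summable.sum_le_tsum (range 2) fun i _ => by
    rw [pow_mul]
    positivity
  rw [(Real.hasSum_cosh x).tsum_eq] at h
  simpa [Finset.sum_range_succ] using h

theorem integrable_sq_of_hasSubgaussianMGF (h : HasSubgaussianMGF X k μ) :
    Integrable (fun ω => X ω ^ 2) μ := (h.memLp 2).integrable_sq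

theorem integral_sq_le_of_hasSubgaussianMGF [IsProbabilityMeasure μ]
    (h : HasSubgaussianMGF X k μ) : ∫ ω, X ω ^ 2 ∂μ ≤ k := by
  set v := ∫ ω, X ω ^ 2 ∂μ
  have hcosh : ∀ u : ℝ, 0 < u → v ≤ u⁻¹ • (exp (k * (0 + u)) - exp (k * 0)) := fun u hu => by
    set r := √(2 * u)
    have hr : r ^ 2 = 2 * u := Real.sq_sqrt (by linarith)
    have hlower : 1 + u * v ≤ ∫ ω, Real.cosh (r * X ω) ∂μ := by
      have hsq := (integrable_sq_of_hasSubgaussianMGF h).const_mul u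
      calc 1 + u * v = ∫ ω, (1 + u * X ω ^ 2) ∂μ := by
            rw [integral_add (integrable_const 1) hsq, integral_const_mul, integral_const,
              probReal_univ, one_smul]
        _ ≤ ∫ ω, Real.cosh (r * X ω) ∂μ := by
            refine integral_mono ((integrable_const 1).add hsq) ?_ fun ω => ?_
            · simpa only [Real.cosh_eq, ← neg_mul, Pi.add_apply] using
                ((h.integrable_exp_mul r).add (h.integrable_exp_mul (-r))).div_const 2
            · have := one_add_sq_div_two_le_cosh (r * X ω)
              rw [mul_pow, hr] at this
              linarith
    have hupper : ∫ ω, Real.cosh (r * X ω) ∂μ ≤ exp (k * u) := by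
      have hpos := h.mgf_le r
      have hneg := h.mgf_le (-r)
      rw [neg_sq, hr, mgf] at hneg
      rw [hr, mgf] at hpos
      simp only [Real.cosh_eq, ← neg_mul]
      rw [integral_div, integral_add (h.integrable_exp_mul r) (h.integrable_exp_mul (-r))]
      rw [show (k : ℝ) * (2 * u) / 2 = k * u by ring] at hpos hneg
      linarith
    rw [zero_add, mul_zero, Real.exp_zero, smul_eq_mul, ← div_eq_inv_mul, le_div_iff₀ hu]
    linarith
  have hderiv : HasDerivAt (fun u : ℝ => exp (k * u)) k 0 := by
    simpa using ((hasDerivAt_id (0 : ℝ)).const_mul (k : ℝ)).exp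
  exact ge_of_tendsto hderiv.tendsto_slope_zero_right
    (Filter.mem_of_superset self_mem_nhdsWithin hcosh)

theorem hasSubgaussianMGF_of_map_eq_gaussianReal (hX : Measurable X)
    (h : μ.map X = gaussianReal 0 1) : HasSubgaussianMGF X 1 μ := by
  rw [← HasSubgaussianMGF.id_map_iff hX.aemeasurable, h]
  exact ⟨fun r => integrable_exp_mul_gaussianReal r, fun r => by simp [mgf_id_gaussianReal]⟩

theorem hasSubgaussianMGF_mono {l : ℝ≥0} (h : HasSubgaussianMGF X k μ) (hkl : k ≤ l) :
    HasSubgaussianMGF X l μ :=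
  ⟨h.integrable_exp_mul, fun r => (h.mgf_le r).trans (by gcongr)⟩

theorem integral_sq_of_map_eq_gaussianReal (hX : Measurable X)
    (h : μ.map X = gaussianReal 0 1) : ∫ ω, X ω ^ 2 ∂μ = 1 := by
  have hvar := variance_eq_integral (μ := gaussianReal 0 1) (X := fun y : ℝ => y) (by fun_prop)
  rw [variance_fun_id_gaussianReal, integral_id_gaussianReal] at hvar
  rw [← integral_map (f := fun y : ℝ => y ^ 2) hX.aemeasurable (by fun_prop), h]
  simpa using hvar.symm

end SecondMoment

section CentredSquare

variable {Ω : Type*} [MeasurableSpace Ω] {μ : Measure Ω} [IsProbabilityMeasure μ] {X : Ω → ℝ}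
  {k : ℝ≥0}

theorem expMoment_sq_div_le (hX : Measurable X) (hsub : HasSubgaussianMGF X k μ) (hk : 0 < k) :
    expMoment μ (fun ω => X ω ^ 2 / (4 * k)) ≤ ofReal (exp (1 / 2)) := by
  have hvec := hasSubgaussianVec_of_iIndepFun (η := fun _ : Unit => X) .of_subsingleton
    fun _ => hsub
  have hS : ((1 / (2 * (k : ℝ))) • (1 : Matrix Unit Unit ℝ)).PosSemidef :=
    PosSemidef.one.smul (by positivity)
  have hnorm : k * opNorm ((1 / (2 * (k : ℝ))) • (1 : Matrix Unit Unit ℝ)) ≤ 1 / 2 := by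
    have hone : opNorm (1 : Matrix Unit Unit ℝ) ^ 2 ≤ 1 :=
      opNorm_sq_le_of_forall zero_le_one fun v => by rw [one_mulVec, one_mul]
    rw [opNorm_smul, abs_of_pos (by positivity)]
    calc k * (1 / (2 * k) * opNorm (1 : Matrix Unit Unit ℝ)) ≤ k * (1 / (2 * k) * 1) := by
          gcongr
          exact (sq_le_one_iff₀ (opNorm_nonneg _)).mp hone
      _ = 1 / 2 := by field_simp
  have hquad := hvec.expMoment_quadratic_le (by fun_prop) hS hnorm
  simp only [smul_mulVec, one_mulVec, Pi.smul_apply, smul_eq_mul, trace_smul, trace_one,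
    dotProduct, Finset.univ_unique, Finset.sum_singleton, Fintype.card_unit, Nat.cast_one] at hquad
  convert hquad using 4
  · ring
  · field_simp

theorem exp_five_div_eight_le : exp (5 / 8) ≤ 1.9 := by
  refine le_of_pow_le_pow_left₀ (n := 8) (by norm_num) (by norm_num) ?_
  calc exp (5 / 8) ^ 8 = exp 1 ^ 5 := by
        rw [← Real.exp_nat_mul, ← Real.exp_nat_mul]
        norm_num
    _ ≤ 2.7182818286 ^ 5 := by
        gcongr
        exact Real.exp_one_lt_d9.le
    _ ≤ 1.9 ^ 8 := by norm_num

theorem exp_mul_sq_sub_one_le {k s : ℝ} (hk : 1 ≤ k) (hs : |s| * (8 * k) ≤ 1) (x : ℝ) :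
    exp (s * (x ^ 2 - 1)) ≤ 1 + s * (x ^ 2 - 1)
      + 129 * s ^ 2 * k ^ 2 * exp (1 / 8) * exp (x ^ 2 / (4 * k)) := by
  obtain ⟨y, hy⟩ : ∃ y, y = x ^ 2 / (8 * k) := ⟨_, rfl⟩
  have hy0 : 0 ≤ y := hy ▸ by positivity
  have hxy : x ^ 2 = 8 * k * y := by rw [hy]; field_simp
  have hquarter : x ^ 2 / (4 * k) = y + y := by rw [hxy]; field_simp; ring
  rw [hquarter, hxy]
  have hky : 0 ≤ k * y := by positivity
  have habs : |s * (8 * k * y - 1)| ≤ y + 1 / 8 := by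
    have hs8 : |s| ≤ 1 / 8 := by nlinarith [abs_nonneg s]
    have hky1 : |8 * k * y - 1| ≤ 8 * k * y + 1 := abs_le.mpr ⟨by linarith, by linarith⟩
    calc |s * (8 * k * y - 1)| ≤ |s| * (8 * k * y + 1) := by rw [abs_mul]; gcongr
      _ = (|s| * (8 * k)) * y + |s| := by ring
      _ ≤ 1 * y + 1 / 8 := by gcongr
      _ = y + 1 / 8 := by ring
  have hsq : (8 * k * y - 1) ^ 2 ≤ 129 * k ^ 2 * exp y := by
    have hk2 : (1 : ℝ) ≤ k ^ 2 := one_le_pow₀ hk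
    calc (8 * k * y - 1) ^ 2 ≤ k ^ 2 * (64 * y ^ 2 + 1) := by nlinarith
      _ ≤ k ^ 2 * (129 * exp y) := by
          gcongr
          linarith [Real.quadratic_le_exp_of_nonneg hy0, Real.one_le_exp hy0]
      _ = 129 * k ^ 2 * exp y := by ring
  calc exp (s * (8 * k * y - 1))
      ≤ 1 + s * (8 * k * y - 1) + (s * (8 * k * y - 1)) ^ 2 * exp |s * (8 * k * y - 1)| :=
        exp_le_one_add_add_sq_mul_exp_abs _
    _ ≤ 1 + s * (8 * k * y - 1) + s ^ 2 * (129 * k ^ 2 * exp y) * exp (y + 1 / 8) := by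
        rw [mul_pow]
        gcongr
    _ = _ := by rw [Real.exp_add, Real.exp_add]; ring

theorem expMoment_mul_sq_sub_one_le (hX : Measurable X) (hsub : HasSubgaussianMGF X k μ)
    (hvar : ∫ ω, X ω ^ 2 ∂μ = 1) {s : ℝ} (hs : |s| * (8 * k) ≤ 1) :
    expMoment μ (fun ω => s * (X ω ^ 2 - 1)) ≤ ofReal (exp (256 * s ^ 2 * k ^ 2)) := by
  have hk : (1 : ℝ) ≤ k := hvar ▸ integral_sq_le_of_hasSubgaussianMGF hsub
  have hsq := expMoment_sq_div_le hX hsub (by exact_mod_cast one_pos.trans_le hk)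
  have hexp := integrable_exp_of_expMoment_le (by fun_prop) hsq
  rw [expMoment_eq_ofReal_integral hexp, ENNReal.ofReal_le_ofReal_iff (Real.exp_nonneg _)] at hsq
  have hlin : Integrable (fun ω => s * (X ω ^ 2 - 1)) μ :=
    ((integrable_sq_of_hasSubgaussianMGF hsub).sub (integrable_const 1)).const_mul s
  have hlin_zero : ∫ ω, s * (X ω ^ 2 - 1) ∂μ = 0 := by
    rw [integral_const_mul, integral_sub (integrable_sq_of_hasSubgaussianMGF hsub)
      (integrable_const 1), hvar, integral_const, probReal_univ, one_smul, sub_self, mul_zero]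
  have hone_add : Integrable (fun ω => 1 + s * (X ω ^ 2 - 1)) μ := (integrable_const 1).add hlin
  set D : ℝ := 129 * s ^ 2 * k ^ 2 * exp (1 / 8)
  have hbound : Integrable
      (fun ω => 1 + s * (X ω ^ 2 - 1) + D * exp (X ω ^ 2 / (4 * k))) μ :=
    hone_add.add (hexp.const_mul D)
  calc expMoment μ (fun ω => s * (X ω ^ 2 - 1))
      ≤ ∫⁻ ω, ofReal (1 + s * (X ω ^ 2 - 1) + D * exp (X ω ^ 2 / (4 * k))) ∂μ :=
        lintegral_mono fun ω => ENNReal.ofReal_le_ofReal (exp_mul_sq_sub_one_le hk hs (X ω))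
    _ = ofReal (1 + D * ∫ ω, exp (X ω ^ 2 / (4 * k)) ∂μ) := by
        rw [← ofReal_integral_eq_lintegral_ofReal hbound (.of_forall fun ω =>
          (Real.exp_nonneg _).trans (exp_mul_sq_sub_one_le hk hs (X ω))),
          integral_add hone_add (hexp.const_mul D),
          integral_add (integrable_const 1) hlin, hlin_zero, integral_const_mul, integral_const,
          probReal_univ, one_smul, add_zero]
    _ ≤ ofReal (exp (256 * s ^ 2 * k ^ 2)) := by
        refine ENNReal.ofReal_le_ofReal ?_
        calc 1 + D * ∫ ω, exp (X ω ^ 2 / (4 * k)) ∂μ ≤ 1 + D * exp (1 / 2) := by gcongr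
          _ = 1 + 129 * s ^ 2 * k ^ 2 * exp (5 / 8) := by
              rw [mul_assoc, ← Real.exp_add]; norm_num
          _ ≤ 1 + 129 * s ^ 2 * k ^ 2 * 1.9 := by gcongr; exact exp_five_div_eight_le
          _ ≤ 256 * s ^ 2 * k ^ 2 + 1 := by nlinarith [mul_nonneg (sq_nonneg s) (sq_nonneg (k : ℝ))]
          _ ≤ exp (256 * s ^ 2 * k ^ 2) := Real.add_one_le_exp _

end CentredSquare

section Masking

variable {Ω : Type*} [MeasurableSpace Ω] {μ : Measure Ω} {ι : Type*} [DecidableEq ι]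

@[fun_prop]
theorem measurable_piecewise_zero (S : Finset ι) {f : Ω → ι → ℝ} (hf : Measurable f) :
    Measurable fun ω => S.piecewise (f ω) 0 := by
  refine measurable_pi_lambda _ fun i => ?_
  by_cases hi : i ∈ S
  · simpa only [Finset.piecewise_eq_of_mem _ _ _ hi] using measurable_pi_iff.mp hf i
  · simpa only [Finset.piecewise_eq_of_notMem _ _ _ hi] using measurable_const

theorem indepFun_piecewise_zero {η : ι → Ω → ℝ} (hη : ∀ i, Measurable (η i))
    (hind : iIndepFun η μ) {S T : Finset ι} (hST : Disjoint S T) :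
    IndepFun (fun ω => S.piecewise (fun i => η i ω) 0)
      (fun ω => T.piecewise (fun i => η i ω) 0) μ := by
  let extend (R : Finset ι) (y : R → ℝ) (i : ι) : ℝ := if h : i ∈ R then y ⟨i, h⟩ else 0
  have hextend : ∀ R : Finset ι, Measurable (extend R) := fun R => by
    refine measurable_pi_lambda _ fun i => ?_
    by_cases h : i ∈ R
    · simpa only [extend, h, dif_pos] using measurable_pi_apply _
    · simpa only [extend, h, dif_neg, not_false_eq_true] using measurable_const
  exact (hind.indepFun_finset S T hST hη).comp (hextend S) (hextend T)

variable [Fintype ι]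

theorem dotProduct_piecewise_zero (S : Finset ι) (c x : ι → ℝ) :
    c ⬝ᵥ S.piecewise x 0 = S.piecewise c 0 ⬝ᵥ x := by
  refine Finset.sum_congr rfl fun i _ => ?_
  by_cases hi : i ∈ S <;> simp [hi]

theorem piecewise_zero_dotProduct_self_le (S : Finset ι) (c : ι → ℝ) :
    S.piecewise c 0 ⬝ᵥ S.piecewise c 0 ≤ c ⬝ᵥ c := by
  refine Finset.sum_le_sum fun i _ => ?_
  by_cases hi : i ∈ S
  · simp [hi]
  · simpa [hi] using mul_self_nonneg (c i)

theorem HasSubgaussianVec.piecewise_zero {W : Ω → ι → ℝ} {k : ℝ≥0} (h : HasSubgaussianVec W k μ)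
    (S : Finset ι) : HasSubgaussianVec (fun ω => S.piecewise (W ω) 0) k μ := by
  intro c
  simp only [dotProduct_piecewise_zero]
  refine (h _).trans ?_
  gcongr
  exact piecewise_zero_dotProduct_self_le S c

end Masking

section Decoupling

variable {ι : Type*} [Fintype ι] [DecidableEq ι]

theorem card_filter_mem_notMem_mul_four {i j : ι} (hij : i ≠ j) :
    (Finset.univ.filter fun S : Finset ι => i ∈ S ∧ j ∉ S).card * 4 = 2 ^ Fintype.card ι := by
  have hIcc : (Finset.univ.filter fun S : Finset ι => i ∈ S ∧ j ∉ S)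
      = Finset.Icc {i} (Finset.univ.erase j) := by
    ext S
    simp [Finset.subset_erase]
  have hcard : 2 ≤ Fintype.card ι := Finset.card_pair hij ▸ Finset.card_le_univ {i, j}
  rw [hIcc, Finset.card_Icc_finset (by simp [hij]), Finset.card_erase_of_mem (Finset.mem_univ j),
    Finset.card_univ, Finset.card_singleton, Nat.sub_sub]
  exact pow_sub_mul_pow 2 hcard

/-- Decoupling: a uniformly random set `S` separates two given distinct indices, in this order,
with probability `1 / 4`. -/
theorem dotProduct_offDiag_mulVec_eq_average (a : Matrix ι ι ℝ) (x : ι → ℝ) :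
    x ⬝ᵥ (a - diagonal a.diag) *ᵥ x = ∑ S : Finset ι, 1 / 2 ^ Fintype.card ι *
      (4 * (S.piecewise x 0 ⬝ᵥ a *ᵥ Sᶜ.piecewise x 0)) := by
  have hterm : ∀ S : Finset ι, S.piecewise x 0 ⬝ᵥ a *ᵥ Sᶜ.piecewise x 0
      = ∑ i, ∑ j, if i ∈ S ∧ j ∉ S then x i * (a i j * x j) else 0 := fun S => by
    simp only [dotProduct, mulVec, Finset.mul_sum]
    refine Finset.sum_congr rfl fun i _ => Finset.sum_congr rfl fun j _ => ?_
    by_cases hi : i ∈ S <;> by_cases hj : j ∈ S <;> simp [hi, hj]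
  have hcount : ∀ i j, x i * ((a - diagonal a.diag) i j * x j)
      = ∑ S : Finset ι, 1 / 2 ^ Fintype.card ι *
        (4 * if i ∈ S ∧ j ∉ S then x i * (a i j * x j) else 0) := fun i j => by
    rw [← Finset.mul_sum, ← Finset.mul_sum, ← Finset.sum_filter, Finset.sum_const, nsmul_eq_mul]
    obtain rfl | hij := eq_or_ne i j
    · simp
    · have hcard : ((Finset.univ.filter fun S : Finset ι => i ∈ S ∧ j ∉ S).card : ℝ) * 4
          = 2 ^ Fintype.card ι := by exact_mod_cast card_filter_mem_notMem_mul_four hij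
      rw [← hcard, Matrix.sub_apply, diagonal_apply_ne _ hij, sub_zero]
      have : ((Finset.univ.filter fun S : Finset ι => i ∈ S ∧ j ∉ S).card : ℝ) ≠ 0 := by
        intro h0
        rw [h0, zero_mul] at hcard
        exact (pow_pos two_pos _).ne hcard
      field_simp
  simp only [hterm]
  simp only [dotProduct, mulVec, Finset.mul_sum, hcount]
  simp only [Finset.sum_comm (γ := Finset ι)]

variable {Ω : Type*} [MeasurableSpace Ω] {μ : Measure Ω} [IsProbabilityMeasure μ]
  {η : ι → Ω → ℝ} {k : ℝ≥0} {a : Matrix ι ι ℝ} {s : ℝ}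

theorem expMoment_decoupled_le (hη : ∀ i, Measurable (η i)) (hind : iIndepFun η μ)
    (hsub : ∀ i, HasSubgaussianMGF (η i) k μ) (hs : |s| * (8 * k * opNorm a) ≤ 1)
    (S : Finset ι) :
    expMoment μ (fun ω => s * (4 * (S.piecewise (fun i => η i ω) 0
        ⬝ᵥ a *ᵥ Sᶜ.piecewise (fun i => η i ω) 0)))
      ≤ ofReal (exp (16 * s ^ 2 * k ^ 2 * (aᵀ * a).trace)) := by
  have hvec := hasSubgaussianVec_of_iIndepFun hind hsub
  have : Measurable fun ω i => η i ω := measurable_pi_lambda _ hη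
  set B : Matrix ι ι ℝ := (16 * s ^ 2 * k) • (aᵀ * a)
  have hB : B.PosSemidef := (posSemidef_transpose_mul_self a).smul (by positivity)
  have hnorm : k * opNorm B ≤ 1 / 2 := by
    rw [opNorm_smul, opNorm_transpose_mul_self, abs_of_nonneg (by positivity)]
    have := opNorm_nonneg a
    have hsq := pow_le_one₀ (n := 2) (by positivity) hs
    rw [mul_pow, sq_abs] at hsq
    nlinarith
  calc expMoment μ (fun ω => s * (4 * (S.piecewise (fun i => η i ω) 0
          ⬝ᵥ a *ᵥ Sᶜ.piecewise (fun i => η i ω) 0)))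
      = expMoment μ (fun ω => 0 + ((4 * s) • a *ᵥ Sᶜ.piecewise (fun i => η i ω) 0)
          ⬝ᵥ S.piecewise (fun i => η i ω) 0) := by
        congr 1 with ω
        rw [smul_dotProduct, dotProduct_comm, smul_eq_mul]
        ring
    _ ≤ expMoment μ (fun ω => 0 + k / 2 * (((4 * s) • a *ᵥ Sᶜ.piecewise (fun i => η i ω) 0)
          ⬝ᵥ ((4 * s) • a *ᵥ Sᶜ.piecewise (fun i => η i ω) 0))) :=
        (hvec.piecewise_zero S).expMoment_add_dotProduct_le
          (U := fun ω => Sᶜ.piecewise (fun i => η i ω) 0) (f := fun _ => 0)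
          (h := fun y => (4 * s) • a *ᵥ y)
          (indepFun_piecewise_zero hη hind disjoint_compl_left) (by fun_prop) (by fun_prop)
          (by fun_prop) (by fun_prop)
    _ = expMoment μ (fun ω => 1 / 2 * (Sᶜ.piecewise (fun i => η i ω) 0
          ⬝ᵥ B *ᵥ Sᶜ.piecewise (fun i => η i ω) 0)) := by
        congr 1 with ω
        simp only [B, smul_mulVec, dotProduct_smul, smul_dotProduct, smul_eq_mul,
          dotProduct_transpose_mul_self_mulVec]
        ring
    _ ≤ ofReal (exp (k * B.trace)) :=
        (hvec.piecewise_zero Sᶜ).expMoment_quadratic_le (by fun_prop) hB hnorm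
    _ = ofReal (exp (16 * s ^ 2 * k ^ 2 * (aᵀ * a).trace)) := by
        rw [trace_smul, smul_eq_mul]
        ring_nf

theorem expMoment_offDiag_le (hη : ∀ i, Measurable (η i)) (hind : iIndepFun η μ)
    (hsub : ∀ i, HasSubgaussianMGF (η i) k μ) (hs : |s| * (8 * k * opNorm a) ≤ 1) :
    expMoment μ (fun ω => s * ((fun i => η i ω) ⬝ᵥ (a - diagonal a.diag) *ᵥ fun i => η i ω))
      ≤ ofReal (exp (16 * s ^ 2 * k ^ 2 * (aᵀ * a).trace)) := by
  simp only [dotProduct_offDiag_mulVec_eq_average, Finset.mul_sum, mul_left_comm s]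
  simp only [mul_left_comm 4 s]
  refine expMoment_sum_smul_le (fun S _ => by fun_prop) (fun S _ => by positivity) ?_
    fun S _ => expMoment_decoupled_le hη hind hsub hs S
  rw [Finset.sum_const, Finset.card_univ, Fintype.card_finset, nsmul_eq_mul]
  simp

omit [DecidableEq ι] in
theorem expMoment_diag_le (hη : ∀ i, Measurable (η i)) (hind : iIndepFun η μ)
    (hsub : ∀ i, HasSubgaussianMGF (η i) k μ) (hvar : ∀ i, ∫ ω, η i ω ^ 2 ∂μ = 1) {c : ι → ℝ}
    (hc : ∀ i, |c i| * (8 * k) ≤ 1) :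
    expMoment μ (fun ω => ∑ i, c i * (η i ω ^ 2 - 1))
      ≤ ofReal (exp (256 * k ^ 2 * ∑ i, c i ^ 2)) := by
  refine (expMoment_sum_of_iIndepFun (X := fun i ω => c i * (η i ω ^ 2 - 1)) (fun i => by fun_prop)
    (hind.comp (fun i y => c i * (y ^ 2 - 1)) fun i => by fun_prop)).trans_le ?_
  rw [Finset.mul_sum, ofReal_exp_sum]
  refine Finset.prod_le_prod' fun i _ => ?_
  rw [mul_right_comm]
  exact expMoment_mul_sq_sub_one_le (hη i) (hsub i) (hvar i) (hc i)

end Decoupling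

section HansonWright

variable {ι m : Type*} [Fintype ι] [DecidableEq ι] [Fintype m] {Ω : Type*} [MeasurableSpace Ω]
  {μ : Measure Ω} [IsProbabilityMeasure μ] {η : ι → Ω → ℝ} {k : ℝ≥0}

theorem dotProduct_mulVec_sub_trace (a : Matrix ι ι ℝ) (x : ι → ℝ) :
    x ⬝ᵥ a *ᵥ x - a.trace
      = x ⬝ᵥ (a - diagonal a.diag) *ᵥ x + ∑ i, a i i * (x i ^ 2 - 1) := by
  have hdiag : x ⬝ᵥ diagonal a.diag *ᵥ x = ∑ i, a i i * x i ^ 2 :=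
    Finset.sum_congr rfl fun i _ => by rw [mulVec_diagonal, diag_apply]; ring
  simp only [sub_mulVec, dotProduct_sub, hdiag, mul_sub, mul_one, Finset.sum_sub_distrib, trace,
    diag_apply]
  ring

omit [DecidableEq ι] in
theorem sum_sq_diag_le (a : Matrix ι ι ℝ) : ∑ i, a i i ^ 2 ≤ (aᵀ * a).trace := by
  rw [trace_transpose_mul_self]
  exact Finset.sum_le_sum fun i _ =>
    Finset.single_le_sum (f := fun j => a i j ^ 2) (fun j _ => sq_nonneg _) (Finset.mem_univ i)

theorem expMoment_normSq_sub_trace_le (hη : ∀ i, Measurable (η i)) (hind : iIndepFun η μ)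
    (hsub : ∀ i, HasSubgaussianMGF (η i) k μ) (hvar : ∀ i, ∫ ω, η i ω ^ 2 ∂μ = 1)
    (M : Matrix m ι ℝ) {s : ℝ} (hs : |s| * (16 * k * opNorm M ^ 2) ≤ 1) :
    expMoment μ (fun ω => s * ((M *ᵥ fun i => η i ω) ⬝ᵥ (M *ᵥ fun i => η i ω) - (Mᵀ * M).trace))
      ≤ ofReal (exp (544 * s ^ 2 * k ^ 2 * (opNorm M ^ 2 * (Mᵀ * M).trace))) := by
  classical
  set a := Mᵀ * M
  have hnorm : opNorm a = opNorm M ^ 2 := opNorm_transpose_mul_self M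
  have hs2 : |2 * s| * (8 * k * opNorm a) ≤ 1 := by
    rw [hnorm, abs_mul, abs_two]
    linarith
  have hoff := expMoment_offDiag_le hη hind hsub hs2
  have hdiag := expMoment_diag_le hη hind hsub hvar (c := fun i => 2 * s * a i i) fun i => by
    calc |2 * s * a i i| * (8 * k) = |2 * s| * (8 * k * |a i i|) := by rw [abs_mul]; ring
      _ ≤ |2 * s| * (8 * k * opNorm a) := by gcongr; exact abs_apply_self_le_opNorm a i
      _ ≤ 1 := hs2
  have htrace : (aᵀ * a).trace ≤ opNorm M ^ 2 * a.trace := by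
    have h := trace_transpose_mul_self_mul_le Mᵀ M
    rwa [opNorm_transpose] at h
  have hsum := expMoment_add_le_of_two_mul (μ := μ)
    (X := fun ω => s * ((fun i => η i ω) ⬝ᵥ (a - diagonal a.diag) *ᵥ fun i => η i ω))
    (Y := fun ω => s * ∑ i, a i i * (η i ω ^ 2 - 1)) (by fun_prop) (by fun_prop)
    (a := 32 * s ^ 2 * k ^ 2 * (aᵀ * a).trace) (b := 512 * s ^ 2 * k ^ 2 * ∑ i, a i i ^ 2)
    (by convert hoff using 3 <;> ring_nf)
    (by
      convert hdiag using 3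
      · simp only [Finset.mul_sum]; ring_nf
      · simp only [Finset.mul_sum]; ring_nf)
  simp only [← mul_add, ← dotProduct_mulVec_sub_trace] at hsum
  simp only [← dotProduct_transpose_mul_self_mulVec]
  refine hsum.trans ?_
  gcongr
  nlinarith [sum_sq_diag_le a, mul_nonneg (sq_nonneg s) (sq_nonneg (k : ℝ))]

theorem measure_le_mul_normSq_sub_trace_le (hη : ∀ i, Measurable (η i)) (hind : iIndepFun η μ)
    (hsub : ∀ i, HasSubgaussianMGF (η i) k μ) (hvar : ∀ i, ∫ ω, η i ω ^ 2 ∂μ = 1)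
    (M : Matrix m ι ℝ) {s r β T : ℝ} (hs : |s| * (16 * k * β) ≤ 1) (hβ : opNorm M ^ 2 ≤ β)
    (hT : (Mᵀ * M).trace ≤ T) :
    μ {ω | r ≤ s * ((M *ᵥ fun i => η i ω) ⬝ᵥ (M *ᵥ fun i => η i ω) - (Mᵀ * M).trace)}
      ≤ ofReal (exp (544 * s ^ 2 * k ^ 2 * (β * T) - r)) := by
  have hs' : |s| * (16 * k * opNorm M ^ 2) ≤ 1 := le_trans (by gcongr) hs
  calc μ {ω | r ≤ s * ((M *ᵥ fun i => η i ω) ⬝ᵥ (M *ᵥ fun i => η i ω) - (Mᵀ * M).trace)}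
      ≤ ofReal (exp (-r))
          * ofReal (exp (544 * s ^ 2 * k ^ 2 * (opNorm M ^ 2 * (Mᵀ * M).trace))) := by
        refine (measure_le_exp_neg_mul_expMoment (by fun_prop) r).trans ?_
        gcongr
        exact expMoment_normSq_sub_trace_le hη hind hsub hvar M hs'
    _ = ofReal (exp (544 * s ^ 2 * k ^ 2 * (opNorm M ^ 2 * (Mᵀ * M).trace) - r)) := by
        rw [← ENNReal.ofReal_mul (Real.exp_nonneg _), ← Real.exp_add, neg_add_eq_sub]
    _ ≤ ofReal (exp (544 * s ^ 2 * k ^ 2 * (β * T) - r)) := by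
        gcongr
        · exact trace_transpose_mul_self_nonneg M
        · exact (sq_nonneg _).trans hβ

/-- The Hanson–Wright inequality, in the sub-Gaussian regime `ε ≤ 1`. -/
theorem measure_mul_le_abs_normSq_sub_trace_le (hη : ∀ i, Measurable (η i))
    (hind : iIndepFun η μ) (hsub : ∀ i, HasSubgaussianMGF (η i) k μ)
    (hvar : ∀ i, ∫ ω, η i ω ^ 2 ∂μ = 1) (hk : 1 ≤ k) (M : Matrix m ι ℝ) {ε β T : ℝ}
    (hε : 0 < ε) (hε1 : ε ≤ 1) (hβ0 : 0 < β) (hβ : opNorm M ^ 2 ≤ β)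
    (hT : (Mᵀ * M).trace ≤ T) :
    μ {ω | ε * T ≤ |(M *ᵥ fun i => η i ω) ⬝ᵥ (M *ᵥ fun i => η i ω) - (Mᵀ * M).trace|}
      ≤ ofReal (2 * exp (-(ε ^ 2 * T / (2176 * k ^ 2 * β)))) := by
  have : (1 : ℝ) ≤ k := hk
  set D : Ω → ℝ := fun ω =>
    (M *ᵥ fun i => η i ω) ⬝ᵥ (M *ᵥ fun i => η i ω) - (Mᵀ * M).trace
  set s := ε / (1088 * k ^ 2 * β) with hs_def
  have hs0 : 0 < s := by positivity
  have hs : s * (16 * k * β) ≤ 1 := by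
    rw [hs_def, div_mul_eq_mul_div, div_le_one (by positivity)]
    have : ε * k ≤ k ^ 2 := by nlinarith
    nlinarith
  have hone : ∀ r, |r| = s → μ {ω | s * (ε * T) ≤ r * D ω}
      ≤ ofReal (exp (-(ε ^ 2 * T / (2176 * k ^ 2 * β)))) := fun r hr => by
    refine (measure_le_mul_normSq_sub_trace_le hη hind hsub hvar M (s := r) (hr.symm ▸ hs) hβ
      hT).trans_eq ?_
    rw [← sq_abs r, hr, hs_def]
    congr 2
    field_simp
    ring
  have hsplit : {ω | ε * T ≤ |D ω|}
      ⊆ {ω | s * (ε * T) ≤ s * D ω} ∪ {ω | s * (ε * T) ≤ -s * D ω} := fun ω hω => by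
    refine (le_abs.mp (Set.mem_ofPred_eq ▸ hω)).imp (fun h => ?_) fun h => ?_
    · exact mul_le_mul_of_nonneg_left h hs0.le
    · simpa [neg_mul_comm] using mul_le_mul_of_nonneg_left h hs0.le
  calc μ {ω | ε * T ≤ |D ω|} ≤ _ := (measure_mono hsplit).trans (measure_union_le _ _)
    _ ≤ _ := add_le_add (hone s (abs_of_pos hs0)) (hone (-s) (by rw [abs_neg, abs_of_pos hs0]))
    _ = _ := by rw [← ENNReal.ofReal_add (by positivity) (by positivity), two_mul]

end HansonWright

section Net

section Normed

variable {E : Type*} [NormedAddCommGroup E] [NormedSpace ℝ E] [FiniteDimensional ℝ E]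

theorem packingNumber_closedBall_le :
    Metric.packingNumber 1 (Metric.closedBall (0 : E) 2) ≤ (5 ^ Module.finrank ℝ E : ℕ) := by
  refine iSup₂_le fun s hs => iSup_le fun hsep => ?_
  by_contra! hlt
  obtain ⟨r, hrs, hr⟩ := Set.exists_subset_encard_eq (Order.add_one_le_of_lt hlt)
  have hfin : r.Finite := Set.finite_of_encard_eq_coe (k := 5 ^ Module.finrank ℝ E + 1) hr
  have hcard := Besicovitch.card_le_of_separated hfin.toFinset
    (fun c hc => mem_closedBall_zero_iff.mp (hs (hrs (hfin.mem_toFinset.mp hc))))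
    fun c hc d hd hcd => by
      have h : ((1 : ℝ≥0) : ℝ≥0∞) < edist c d :=
        hsep (hrs (hfin.mem_toFinset.mp hc)) (hrs (hfin.mem_toFinset.mp hd)) hcd
      rw [edist_nndist, ENNReal.coe_lt_coe, ← NNReal.coe_lt_coe, coe_nndist, dist_eq_norm] at h
      exact h.le
  rw [hfin.encard_eq_coe_toFinset_card] at hr
  have : hfin.toFinset.card = 5 ^ Module.finrank ℝ E + 1 := by exact_mod_cast hr
  omega

theorem exists_finset_isCover_closedBall :
    ∃ N : Finset E, N.card ≤ 5 ^ Module.finrank ℝ E ∧ (∀ c ∈ N, ‖c‖ ≤ 1) ∧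
      ∀ x : E, ‖x‖ ≤ 1 → ∃ c ∈ N, ‖x - c‖ ≤ 1 / 2 := by
  classical
  have hle := (Metric.coveringNumber_le_packingNumber 1 (Metric.closedBall (0 : E) 2)).trans
    packingNumber_closedBall_le
  obtain ⟨C, hCball, hCfin, hCcover, hCcard⟩ :=
    Metric.exists_set_encard_eq_coveringNumber (ne_top_of_le_ne_top (ENat.natCast_ne_top _) hle)
  refine ⟨hCfin.toFinset.image fun c => (1 / 2 : ℝ) • c, Finset.card_image_le.trans ?_, ?_,
    fun x hx => ?_⟩
  · rw [← hCcard, hCfin.encard_eq_coe_toFinset_card] at hle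
    exact_mod_cast hle
  · simp only [Finset.forall_mem_image, Set.Finite.mem_toFinset]
    intro c hc
    have hc2 : ‖c‖ ≤ 2 := mem_closedBall_zero_iff.mp (hCball hc)
    rw [norm_smul, Real.norm_of_nonneg one_half_pos.le]
    linarith
  · obtain ⟨c, hc, hxc⟩ := hCcover (x := (2 : ℝ) • x) <| mem_closedBall_zero_iff.mpr <| by
      rw [norm_smul, Real.norm_ofNat]
      linarith
    refine ⟨(1 / 2 : ℝ) • c, Finset.mem_image_of_mem _ (hCfin.mem_toFinset.mpr hc), ?_⟩
    rw [show x - (1 / 2 : ℝ) • c = (1 / 2 : ℝ) • ((2 : ℝ) • x - c) by module, norm_smul,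
      Real.norm_of_nonneg one_half_pos.le, ← dist_eq_norm]
    have hdist : dist ((2 : ℝ) • x) c ≤ 1 := by
      change edist _ _ ≤ _ at hxc
      rwa [edist_nndist, ENNReal.coe_le_coe, ← NNReal.coe_le_coe] at hxc
    linarith

end Normed

theorem norm_le_two_mul_of_forall_abs_inner_le {E : Type*} [NormedAddCommGroup E]
    [InnerProductSpace ℝ E] {N : Set E} (hN : ∀ x : E, ‖x‖ ≤ 1 → ∃ c ∈ N, ‖x - c‖ ≤ 1 / 2) {u : E}
    {m : ℝ} (hm : ∀ c ∈ N, |inner ℝ u c| ≤ m) : ‖u‖ ≤ 2 * m := by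
  obtain ⟨c, hc, huc⟩ := hN (‖u‖⁻¹ • u) <| by
    rw [norm_smul, norm_inv, norm_norm]
    exact inv_mul_le_one
  have hle : ‖u‖ ≤ m + ‖u‖ * (1 / 2) :=
    calc ‖u‖ = inner ℝ u (‖u‖⁻¹ • u) := by
          rw [inner_smul_right, real_inner_self_eq_norm_mul_norm, ← mul_assoc, inv_mul_mul_self]
      _ = inner ℝ u c + inner ℝ u (‖u‖⁻¹ • u - c) := by rw [← inner_add_right, add_sub_cancel]
      _ ≤ m + ‖u‖ * (1 / 2) := by
          refine add_le_add ((le_abs_self _).trans (hm c hc)) ((real_inner_le_norm _ _).trans ?_)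
          gcongr
  linarith

variable {ι : Type*} [Fintype ι]

theorem exists_finset_isCover_vnorm :
    ∃ N : Finset (ι → ℝ), N.card ≤ 5 ^ Fintype.card ι ∧ (∀ c ∈ N, vnorm c ≤ 1) ∧
      ∀ (u : ι → ℝ) (m : ℝ), (∀ c ∈ N, |u ⬝ᵥ c| ≤ m) → vnorm u ≤ 2 * m := by
  classical
  obtain ⟨N, hcard, hball, hcover⟩ := exists_finset_isCover_closedBall (E := EuclideanSpace ℝ ι)
  refine ⟨N.image WithLp.ofLp, Finset.card_image_le.trans ?_, ?_, fun u m hm => ?_⟩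
  · rwa [finrank_euclideanSpace] at hcard
  · exact Finset.forall_mem_image.mpr hball
  · refine norm_le_two_mul_of_forall_abs_inner_le hcover fun c hc => ?_
    rw [EuclideanSpace.inner_eq_star_dotProduct, star_trivial, dotProduct_comm]
    exact hm _ (Finset.mem_image_of_mem _ hc)

theorem dotProduct_mulVec_polarization {S : Matrix ι ι ℝ} (hS : Sᵀ = S) (c d : ι → ℝ) :
    c ⬝ᵥ S *ᵥ d = ((1 / 2 : ℝ) • (c + d)) ⬝ᵥ S *ᵥ (1 / 2 : ℝ) • (c + d)
      - ((1 / 2 : ℝ) • (c - d)) ⬝ᵥ S *ᵥ (1 / 2 : ℝ) • (c - d) := by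
  have hsymm : d ⬝ᵥ S *ᵥ c = c ⬝ᵥ S *ᵥ d := by
    rw [← dotProduct_transpose_mulVec, hS, dotProduct_comm]
  simp only [mulVec_smul, dotProduct_smul, smul_dotProduct, mulVec_add, mulVec_sub,
    dotProduct_add, dotProduct_sub, add_dotProduct, sub_dotProduct, hsymm, smul_eq_mul]
  ring

theorem vnorm_half_smul_add_smul_le {c d : ι → ℝ} (hc : vnorm c ≤ 1) (hd : vnorm d ≤ 1) {s : ℝ}
    (hs : ‖s‖ = 1) : vnorm ((1 / 2 : ℝ) • (c + s • d)) ≤ 1 := by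
  have hadd := norm_add_le (WithLp.toLp 2 c) (s • WithLp.toLp 2 d)
  rw [norm_smul, hs, one_mul] at hadd
  refine (norm_smul_le (1 / 2 : ℝ) (WithLp.toLp 2 c + s • WithLp.toLp 2 d)).trans ?_
  rw [Real.norm_of_nonneg one_half_pos.le]
  linarith [show ‖WithLp.toLp 2 c‖ ≤ 1 from hc, show ‖WithLp.toLp 2 d‖ ≤ 1 from hd]

theorem exists_finset_forall_abs_quadratic_le :
    ∃ D : Finset (ι → ℝ), D.card ≤ 2 * 25 ^ Fintype.card ι ∧ (∀ v ∈ D, v ⬝ᵥ v ≤ 1) ∧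
      ∀ S : Matrix ι ι ℝ, Sᵀ = S → ∀ m : ℝ, (∀ v ∈ D, |v ⬝ᵥ S *ᵥ v| ≤ m) →
        ∀ x, |x ⬝ᵥ S *ᵥ x| ≤ 8 * m * (x ⬝ᵥ x) := by
  classical
  obtain ⟨N, hcard, hball, hN⟩ := exists_finset_isCover_vnorm (ι := ι)
  let half (s : ℝ) (p : (ι → ℝ) × (ι → ℝ)) : ι → ℝ := (1 / 2 : ℝ) • (p.1 + s • p.2)
  refine ⟨(N ×ˢ N).image (half 1) ∪ (N ×ˢ N).image (half (-1)), ?_, ?_, fun S hS m hm x => ?_⟩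
  · have hsq : N.card * N.card ≤ 25 ^ Fintype.card ι := by
      calc N.card * N.card ≤ 5 ^ Fintype.card ι * 5 ^ Fintype.card ι := Nat.mul_le_mul hcard hcard
        _ = 25 ^ Fintype.card ι := by rw [← mul_pow]; norm_num
    refine (Finset.card_union_le _ _).trans ?_
    have hhalf (s : ℝ) : ((N ×ˢ N).image (half s)).card ≤ 25 ^ Fintype.card ι :=
      Finset.card_image_le.trans ((Finset.card_product _ _).trans_le hsq)
    linarith [hhalf 1, hhalf (-1)]
  · have hhalf {s : ℝ} (hs : ‖s‖ = 1) {v} (hv : v ∈ (N ×ˢ N).image (half s)) : v ⬝ᵥ v ≤ 1 := by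
      obtain ⟨p, hp, rfl⟩ := Finset.mem_image.mp hv
      rw [← vnorm_sq]
      exact pow_le_one₀ (vnorm_nonneg _) (vnorm_half_smul_add_smul_le
        (hball _ (Finset.mem_product.mp hp).1) (hball _ (Finset.mem_product.mp hp).2) hs)
    exact Finset.forall_mem_union.mpr ⟨fun v => hhalf norm_one, fun v => hhalf (by simp)⟩
  · have hcd (c) (hc : c ∈ N) (d) (hd : d ∈ N) : |c ⬝ᵥ S *ᵥ d| ≤ 2 * m := by
      have hadd := hm _ (Finset.mem_union_left _
        (Finset.mem_image_of_mem (half 1) (Finset.mk_mem_product hc hd)))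
      have hsub := hm _ (Finset.mem_union_right _
        (Finset.mem_image_of_mem (half (-1)) (Finset.mk_mem_product hc hd)))
      simp only [half, one_smul, neg_smul, ← sub_eq_add_neg] at hadd hsub
      rw [dotProduct_mulVec_polarization hS, two_mul]
      exact (abs_sub _ _).trans (add_le_add hadd hsub)
    have hSc (c) (hc : c ∈ N) : vnorm (S *ᵥ c) ≤ 4 * m := by
      have := hN (S *ᵥ c) (2 * m) fun d hd => by rw [dotProduct_comm]; exact hcd d hd c hc
      linarith
    have hSx : vnorm (S *ᵥ x) ≤ 2 * (vnorm x * (4 * m)) := hN _ _ fun c hc => by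
      rw [← hS, dotProduct_transpose_mulVec]
      exact (abs_dotProduct_le _ _).trans (mul_le_mul_of_nonneg_left (hSc c hc) (vnorm_nonneg x))
    calc |x ⬝ᵥ S *ᵥ x| ≤ vnorm x * vnorm (S *ᵥ x) := abs_dotProduct_le _ _
      _ ≤ vnorm x * (2 * (vnorm x * (4 * m))) := by gcongr; exact vnorm_nonneg x
      _ = 8 * m * (x ⬝ᵥ x) := by rw [← vnorm_sq]; ring

theorem exists_isUnit_det_forall_dotProduct_mulVec_eq [DecidableEq ι] {V : Matrix ι ι ℝ}
    (hV : V.PosDef) :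
    ∃ R : Matrix ι ι ℝ, IsUnit R.det ∧ ∀ x, x ⬝ᵥ V *ᵥ x = (R *ᵥ x) ⬝ᵥ (R *ᵥ x) := by
  obtain ⟨R, -, rfl, -⟩ := exists_mul_transpose_eq_of_posSemidef hV.posSemidef
  refine ⟨Rᵀ, ?_, fun x => ?_⟩
  · rw [det_transpose]
    exact isUnit_of_mul_isUnit_left (det_mul R Rᵀ ▸ (isUnit_iff_isUnit_det _).mp hV.isUnit)
  · simpa only [transpose_transpose] using dotProduct_transpose_mul_self_mulVec Rᵀ x

theorem exists_finset_forall_abs_quadratic_le_of_posDef {V : Matrix ι ι ℝ} (hV : V.PosDef) :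
    ∃ D : Finset (ι → ℝ), D.card ≤ 2 * 25 ^ Fintype.card ι ∧ (∀ v ∈ D, v ⬝ᵥ V *ᵥ v ≤ 1) ∧
      ∀ S : Matrix ι ι ℝ, Sᵀ = S → ∀ m : ℝ, (∀ v ∈ D, |v ⬝ᵥ S *ᵥ v| ≤ m) →
        ∀ x, |x ⬝ᵥ S *ᵥ x| ≤ 8 * m * (x ⬝ᵥ V *ᵥ x) := by
  classical
  obtain ⟨R, hR, hquad⟩ := exists_isUnit_det_forall_dotProduct_mulVec_eq hV
  obtain ⟨D, hcard, hD, hDS⟩ := exists_finset_forall_abs_quadratic_le (ι := ι)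
  refine ⟨D.image (R⁻¹ *ᵥ ·), Finset.card_image_le.trans hcard, ?_, fun S hS m hm x => ?_⟩
  · refine Finset.forall_mem_image.mpr fun v hv => ?_
    rw [hquad, mulVec_mulVec, mul_nonsing_inv _ hR, one_mulVec]
    exact hD v hv
  · have hx := hDS (R⁻¹ᵀ * S * R⁻¹) ?_ m (fun v hv => ?_) (R *ᵥ x)
    · rwa [dotProduct_transpose_mul_mul_mulVec, mulVec_mulVec, nonsing_inv_mul _ hR, one_mulVec,
        ← hquad] at hx
    · rw [transpose_mul, transpose_mul, transpose_transpose, hS, Matrix.mul_assoc]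
    · rw [dotProduct_transpose_mul_mul_mulVec]
      exact hm _ (Finset.mem_image_of_mem _ hv)

theorem exists_finset_forall_abs_dotProduct_le_of_posDef {V : Matrix ι ι ℝ} (hV : V.PosDef) :
    ∃ N : Finset (ι → ℝ), N.card ≤ 5 ^ Fintype.card ι ∧ (∀ v ∈ N, v ⬝ᵥ V *ᵥ v ≤ 1) ∧
      ∀ (u : ι → ℝ) (m : ℝ), (∀ v ∈ N, |u ⬝ᵥ v| ≤ m) → ∀ x, |u ⬝ᵥ x| ≤ 2 * m * √(x ⬝ᵥ V *ᵥ x) := by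
  classical
  obtain ⟨R, hR, hquad⟩ := exists_isUnit_det_forall_dotProduct_mulVec_eq hV
  obtain ⟨N, hcard, hN, hNu⟩ := exists_finset_isCover_vnorm (ι := ι)
  refine ⟨N.image (R⁻¹ *ᵥ ·), Finset.card_image_le.trans hcard, ?_, fun u m hm x => ?_⟩
  · refine Finset.forall_mem_image.mpr fun v hv => ?_
    rw [hquad, mulVec_mulVec, mul_nonsing_inv _ hR, one_mulVec, ← vnorm_sq]
    exact pow_le_one₀ (vnorm_nonneg v) (hN v hv)
  · have hu : vnorm (R⁻¹ᵀ *ᵥ u) ≤ 2 * m := hNu _ m fun v hv => by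
      rw [dotProduct_transpose_mulVec]
      exact hm _ (Finset.mem_image_of_mem _ hv)
    calc |u ⬝ᵥ x| = |(R⁻¹ᵀ *ᵥ u) ⬝ᵥ (R *ᵥ x)| := by
          rw [dotProduct_transpose_mulVec, mulVec_mulVec, nonsing_inv_mul _ hR, one_mulVec]
      _ ≤ vnorm (R⁻¹ᵀ *ᵥ u) * vnorm (R *ᵥ x) := abs_dotProduct_le _ _
      _ ≤ 2 * m * √(x ⬝ᵥ V *ᵥ x) := by
          rw [hquad, ← vnorm_sq, Real.sqrt_sq (vnorm_nonneg _)]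
          exact mul_le_mul_of_nonneg_right hu (vnorm_nonneg _)

end Net

section UnionBound

variable {Ω : Type*} [MeasurableSpace Ω] {μ : Measure Ω} {ι : Type*} [Fintype ι]

theorem measure_not_forall_abs_quadratic_le_of_posDef {V : Matrix ι ι ℝ} (hV : V.PosDef)
    {S : Ω → Matrix ι ι ℝ} (hS : ∀ ω, (S ω)ᵀ = S ω) {r : ℝ} {b : ℝ≥0∞}
    (hb : ∀ v, v ⬝ᵥ V *ᵥ v ≤ 1 → μ {ω | r ≤ |v ⬝ᵥ S ω *ᵥ v|} ≤ b) :
    μ {ω | ¬ ∀ v, |v ⬝ᵥ S ω *ᵥ v| ≤ 8 * r * (v ⬝ᵥ V *ᵥ v)} ≤ 2 * 25 ^ Fintype.card ι * b := by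
  obtain ⟨D, hcard, hball, hnorm⟩ := exists_finset_forall_abs_quadratic_le_of_posDef hV
  calc μ {ω | ¬ ∀ v, |v ⬝ᵥ S ω *ᵥ v| ≤ 8 * r * (v ⬝ᵥ V *ᵥ v)}
      ≤ μ (⋃ v ∈ D, {ω | r ≤ |v ⬝ᵥ S ω *ᵥ v|}) := by
        refine measure_mono fun ω hω => ?_
        by_contra hgood
        simp only [Set.mem_iUnion, Set.mem_ofPred_eq, not_exists, not_le] at hgood
        exact hω (hnorm (S ω) (hS ω) r fun v hv => (hgood v hv).le)
    _ ≤ ∑ v ∈ D, μ {ω | r ≤ |v ⬝ᵥ S ω *ᵥ v|} := measure_biUnion_finset_le _ _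
    _ ≤ D.card * b := by
        rw [← nsmul_eq_mul]
        exact Finset.sum_le_card_nsmul _ _ _ fun v hv => hb v (hball v hv)
    _ ≤ 2 * 25 ^ Fintype.card ι * b := by
        gcongr
        exact_mod_cast hcard

theorem measure_not_forall_abs_dotProduct_le_of_posDef {V : Matrix ι ι ℝ} (hV : V.PosDef)
    {u : Ω → ι → ℝ} {G : Set Ω} {r : ℝ} {b : ℝ≥0∞}
    (hb : ∀ v, v ⬝ᵥ V *ᵥ v ≤ 1 → μ {ω ∈ G | r ≤ |u ω ⬝ᵥ v|} ≤ b) :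
    μ {ω ∈ G | ¬ ∀ v, |u ω ⬝ᵥ v| ≤ 2 * r * √(v ⬝ᵥ V *ᵥ v)} ≤ 5 ^ Fintype.card ι * b := by
  obtain ⟨N, hcard, hball, hnorm⟩ := exists_finset_forall_abs_dotProduct_le_of_posDef hV
  calc μ {ω ∈ G | ¬ ∀ v, |u ω ⬝ᵥ v| ≤ 2 * r * √(v ⬝ᵥ V *ᵥ v)}
      ≤ μ (⋃ v ∈ N, {ω ∈ G | r ≤ |u ω ⬝ᵥ v|}) := by
        refine measure_mono fun ω hω => ?_
        by_contra hgood
        simp only [Set.mem_iUnion, Set.mem_ofPred_eq, not_exists, not_and, not_le] at hgood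
        exact hω.2 (hnorm (u ω) r fun v hv => (hgood v hv hω.1).le)
    _ ≤ ∑ v ∈ N, μ {ω ∈ G | r ≤ |u ω ⬝ᵥ v|} := measure_biUnion_finset_le _ _
    _ ≤ N.card * b := by
        rw [← nsmul_eq_mul]
        exact Finset.sum_le_card_nsmul _ _ _ fun v hv => hb v (hball v hv)
    _ ≤ 5 ^ Fintype.card ι * b := by
        gcongr
        exact_mod_cast hcard

end UnionBound

/-- The quadratic form of `P` is a Lyapunov function for the dynamics `v ↦ F v` that dissipates at
least the stage cost `|v|² + |K v|²` at each step. -/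
structure IsLyapunov {n q : Type*} [Fintype n] [Fintype q] (P F : Matrix n n ℝ)
    (K : Matrix q n ℝ) : Prop where
  nonneg : ∀ v, 0 ≤ v ⬝ᵥ P *ᵥ v
  step_le : ∀ v, (F *ᵥ v) ⬝ᵥ P *ᵥ (F *ᵥ v) + (v ⬝ᵥ v + (K *ᵥ v) ⬝ᵥ (K *ᵥ v)) ≤ v ⬝ᵥ P *ᵥ v

section Lyapunov

variable {n q : Type*} [Fintype n] [Fintype q] {P F : Matrix n n ℝ} {K : Matrix q n ℝ}

theorem pow_succ_mulVec [DecidableEq n] (F : Matrix n n ℝ) (j : ℕ) (v : n → ℝ) :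
    F ^ (j + 1) *ᵥ v = F *ᵥ (F ^ j *ᵥ v) := by
  rw [pow_succ', Matrix.mulVec_mulVec]

theorem sum_dotProduct_pow_mulVec_le_sub [DecidableEq n]
    (hstep : ∀ v, (F *ᵥ v) ⬝ᵥ P *ᵥ (F *ᵥ v) + v ⬝ᵥ v ≤ v ⬝ᵥ P *ᵥ v) (v : n → ℝ) (j : ℕ) :
    ∑ i ∈ range j, (F ^ i *ᵥ v) ⬝ᵥ (F ^ i *ᵥ v)
      ≤ v ⬝ᵥ P *ᵥ v - (F ^ j *ᵥ v) ⬝ᵥ P *ᵥ (F ^ j *ᵥ v) := by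
  induction j with
  | zero => simp
  | succ j ih =>
    rw [Finset.sum_range_succ, pow_succ_mulVec]
    linarith [hstep (F ^ j *ᵥ v)]

theorem IsStable.tendsto_pow_mulVec [DecidableEq n] (hF : IsStable F) (v : n → ℝ) :
    Filter.Tendsto (fun j : ℕ => F ^ j *ᵥ v) Filter.atTop (nhds 0) := by
  obtain ⟨C, r, -, hr0, hr1, hbound⟩ := hF.exists_bound
  refine tendsto_pi_nhds.mpr fun i => ?_
  have hlim : Filter.Tendsto (fun j : ℕ => (C * ∑ l, |v l|) * r ^ j) Filter.atTop (nhds 0) := by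
    simpa using (tendsto_pow_atTop_nhds_zero_of_lt_one hr0 hr1).const_mul (C * ∑ l, |v l|)
  refine squeeze_zero_norm (fun j => ?_) hlim
  calc ‖(F ^ j *ᵥ v) i‖ ≤ ∑ l, |(F ^ j) i l| * |v l| := by
        simpa only [Matrix.mulVec, dotProduct, Real.norm_eq_abs, abs_mul] using
          Finset.abs_sum_le_sum_abs (fun l => (F ^ j) i l * v l) Finset.univ
    _ ≤ ∑ l, C * r ^ j * |v l| := by gcongr; exact hbound _ _ _
    _ = (C * ∑ l, |v l|) * r ^ j := by rw [← Finset.mul_sum]; ring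

theorem IsLyapunov.of_isStable [DecidableEq n] (hF : IsStable F)
    (hstep : ∀ v, (F *ᵥ v) ⬝ᵥ P *ᵥ (F *ᵥ v) + (v ⬝ᵥ v + (K *ᵥ v) ⬝ᵥ (K *ᵥ v)) ≤ v ⬝ᵥ P *ᵥ v) :
    IsLyapunov P F K where
  step_le := hstep
  nonneg v := by
    have hcont : Continuous fun y : n → ℝ => y ⬝ᵥ P *ᵥ y := by
      simp only [Matrix.mulVec, dotProduct]
      fun_prop
    have hlim : Filter.Tendsto (fun j : ℕ => (F ^ j *ᵥ v) ⬝ᵥ P *ᵥ (F ^ j *ᵥ v))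
        Filter.atTop (nhds 0) := by
      simpa [Function.comp_def] using (hcont.tendsto 0).comp (hF.tendsto_pow_mulVec v)
    refine le_of_tendsto' hlim fun j => sub_nonneg.mp (le_trans ?_
      (sum_dotProduct_pow_mulVec_le_sub (fun y => ?_) v j))
    · exact Finset.sum_nonneg fun i _ => dotProduct_self_nonneg _
    · linarith [hstep y, dotProduct_self_nonneg (K *ᵥ y)]

theorem isLyapunov_lyapP {n m : ℕ} {A : Matrix (Fin n) (Fin n) ℝ} {B : Matrix (Fin n) (Fin m) ℝ}
    {Q : Matrix (Fin n) (Fin n) ℝ} {K : Matrix (Fin m) (Fin n) ℝ} (hQ : (Q - 1).PosSemidef)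
    (hst : IsStable (A + B * K)) : IsLyapunov (lyapP A B Q K) (A + B * K) K := by
  refine .of_isStable hst fun v => ?_
  have hlyap : lyapP A B Q K = (A + B * K)ᵀ * lyapP A B Q K * (A + B * K) + (Q + Kᵀ * K) :=
    dlyap_eq (A + B * K) (Q + Kᵀ * K) hst
  have hQv := hQ.dotProduct_mulVec_nonneg v
  rw [star_trivial, Matrix.sub_mulVec, Matrix.one_mulVec, dotProduct_sub] at hQv
  have : v ⬝ᵥ lyapP A B Q K *ᵥ v
      = ((A + B * K) *ᵥ v) ⬝ᵥ lyapP A B Q K *ᵥ ((A + B * K) *ᵥ v) + v ⬝ᵥ Q *ᵥ v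
        + (K *ᵥ v) ⬝ᵥ (K *ᵥ v) := by
    conv_lhs => rw [hlyap]
    rw [Matrix.add_mulVec, Matrix.add_mulVec, dotProduct_add, dotProduct_add,
      dotProduct_transpose_mul_mul_mulVec, dotProduct_transpose_mul_self_mulVec, add_assoc]
  linarith

namespace IsLyapunov

variable [DecidableEq n] (hP : IsLyapunov P F K)

include hP

omit [DecidableEq n] in
theorem add_le (v : n → ℝ) : v ⬝ᵥ v + (K *ᵥ v) ⬝ᵥ (K *ᵥ v) ≤ v ⬝ᵥ P *ᵥ v := by
  linarith [hP.step_le v, hP.nonneg (F *ᵥ v)]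

theorem sum_dotProduct_pow_mulVec_le (v : n → ℝ) (j : ℕ) :
    ∑ i ∈ range j, (F ^ i *ᵥ v) ⬝ᵥ (F ^ i *ᵥ v) ≤ opNorm P * (v ⬝ᵥ v) := by
  have hsum := sum_dotProduct_pow_mulVec_le_sub (P := P) (F := F)
    (fun y => by linarith [hP.step_le y, dotProduct_self_nonneg (K *ᵥ y)]) v j
  linarith [hP.nonneg (F ^ j *ᵥ v), dotProduct_mulVec_self_le_opNorm_mul P v]

theorem one_le_opNorm [Nonempty n] : 1 ≤ opNorm P := by
  obtain ⟨i⟩ := ‹Nonempty n›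
  have hle := (hP.add_le (Pi.single i 1)).trans (dotProduct_mulVec_self_le_opNorm_mul P _)
  have hsingle : (Pi.single i (1 : ℝ) : n → ℝ) ⬝ᵥ Pi.single i 1 = 1 := by simp
  rw [hsingle] at hle
  linarith [dotProduct_self_nonneg (K *ᵥ Pi.single i (1 : ℝ))]

theorem one_sub_inv_nonneg [Nonempty n] : 0 ≤ 1 - 1 / opNorm P :=
  sub_nonneg.mpr (by simpa using inv_le_one_of_one_le₀ hP.one_le_opNorm)

theorem dotProduct_mulVec_step_le [Nonempty n] (v : n → ℝ) :
    (F *ᵥ v) ⬝ᵥ P *ᵥ (F *ᵥ v) ≤ (1 - 1 / opNorm P) * (v ⬝ᵥ P *ᵥ v) := by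
  have hp := zero_lt_one.trans_le hP.one_le_opNorm
  have : 1 / opNorm P * (v ⬝ᵥ P *ᵥ v) ≤ v ⬝ᵥ v := by
    rw [one_div, inv_mul_le_iff₀ hp]
    exact dotProduct_mulVec_self_le_opNorm_mul P v
  linarith [hP.step_le v, dotProduct_self_nonneg (K *ᵥ v)]

theorem pow_mulVec_le [Nonempty n] (v : n → ℝ) (j : ℕ) :
    (F ^ j *ᵥ v) ⬝ᵥ (F ^ j *ᵥ v) + (K *ᵥ (F ^ j *ᵥ v)) ⬝ᵥ (K *ᵥ (F ^ j *ᵥ v))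
      ≤ opNorm P * (1 - 1 / opNorm P) ^ j * (v ⬝ᵥ v) := by
  have hρ := hP.one_sub_inv_nonneg
  have hdecay : (F ^ j *ᵥ v) ⬝ᵥ P *ᵥ (F ^ j *ᵥ v)
      ≤ (1 - 1 / opNorm P) ^ j * (v ⬝ᵥ P *ᵥ v) := by
    induction j with
    | zero => simp
    | succ j ih =>
      rw [pow_succ_mulVec, pow_succ' (1 - 1 / opNorm P), mul_assoc]
      exact (hP.dotProduct_mulVec_step_le _).trans (mul_le_mul_of_nonneg_left ih hρ)
  have := mul_le_mul_of_nonneg_left (dotProduct_mulVec_self_le_opNorm_mul P v) (pow_nonneg hρ j)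
  linarith [hP.add_le (F ^ j *ᵥ v)]

end IsLyapunov

theorem sum_pow_le_inv_one_sub {r : ℝ} (hr0 : 0 ≤ r) (hr1 : r < 1) (N : ℕ) :
    ∑ j ∈ range N, r ^ j ≤ (1 - r)⁻¹ := by
  rw [← tsum_geometric_of_lt_one hr0 hr1]
  exact (summable_geometric_of_lt_one hr0 hr1).sum_le_tsum _ fun _ _ => pow_nonneg hr0 _

theorem sum_sqrt_mul_geometric_le {p : ℝ} (hp : 1 ≤ p) (N : ℕ) :
    ∑ j ∈ range N, √(p * (1 - 1 / p) ^ j) ≤ 2 * p * √p := by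
  have hp0 : 0 < p := by linarith
  have hinv1 : 1 / p ≤ 1 := by rwa [div_le_one hp0]
  set r := √(1 - 1 / p)
  have hr0 : 0 ≤ r := Real.sqrt_nonneg _
  have hr2 : r ^ 2 = 1 - 1 / p := Real.sq_sqrt (by linarith)
  have hr : r ≤ 1 - 1 / (2 * p) := by
    refine Real.sqrt_le_iff.mpr ⟨by rw [mul_comm, ← div_div]; linarith, ?_⟩
    rw [mul_comm, ← div_div]
    linarith [sq_nonneg (1 / p / 2)]
  have hr1 : r < 1 := hr.trans_lt (by simpa using hp0)
  have hterm : ∀ j, √(p * (1 - 1 / p) ^ j) = √p * r ^ j := fun j => by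
    rw [Real.sqrt_mul hp0.le, ← hr2, pow_right_comm, Real.sqrt_sq (by positivity)]
  calc ∑ j ∈ range N, √(p * (1 - 1 / p) ^ j) = √p * ∑ j ∈ range N, r ^ j := by
        simp only [hterm, Finset.mul_sum]
    _ ≤ √p * (1 / (2 * p))⁻¹ := by
        gcongr
        refine (sum_pow_le_inv_one_sub hr0 hr1 N).trans (inv_anti₀ (by positivity) ?_)
        linarith
    _ = 2 * p * √p := by rw [one_div, inv_inv, mul_comm]

/-- Young's inequality for causal convolutions. -/
theorem sum_sq_convolution_le {k y : ℕ → ℝ} (hk : ∀ j, 0 ≤ k j) {c : ℝ}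
    (hc : ∀ N, ∑ j ∈ range N, k j ≤ c) (t : ℕ) :
    ∑ s ∈ range t, (∑ r ∈ range s, k (s - 1 - r) * y r) ^ 2 ≤ c ^ 2 * ∑ r ∈ range t, y r ^ 2 := by
  have hc0 : 0 ≤ c := by simpa using hc 0
  calc ∑ s ∈ range t, (∑ r ∈ range s, k (s - 1 - r) * y r) ^ 2
      ≤ ∑ s ∈ range t, c * ∑ r ∈ range s, k (s - 1 - r) * y r ^ 2 := by
        gcongr with s
        refine (Finset.sum_sq_le_sum_mul_sum_of_sq_le_mul (range s)
          (f := fun r => k (s - 1 - r)) (g := fun r => k (s - 1 - r) * y r ^ 2) (fun _ _ => hk _)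
          (fun _ _ => mul_nonneg (hk _) (sq_nonneg _)) (fun _ _ => (by ring : _ = _).le)).trans ?_
        gcongr
        · exact Finset.sum_nonneg fun _ _ => mul_nonneg (hk _) (sq_nonneg _)
        · exact (Finset.sum_range_reflect k s).trans_le (hc s)
    _ = c * ∑ r ∈ range t, (∑ s ∈ Finset.Ico (r + 1) t, k (s - 1 - r)) * y r ^ 2 := by
        simp only [← Finset.mul_sum, Finset.sum_mul]
        congr 1
        refine Finset.sum_comm' fun s r => ?_
        simp only [Finset.mem_range, Finset.mem_Ico]
        omega
    _ ≤ c * ∑ r ∈ range t, c * y r ^ 2 := by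
        gcongr with r _
        rw [Finset.sum_Ico_eq_sum_range]
        refine (Finset.sum_congr rfl fun j _ => congrArg k ?_).trans_le (hc (t - (r + 1)))
        omega
    _ = c ^ 2 * ∑ r ∈ range t, y r ^ 2 := by rw [← Finset.mul_sum]; ring

end Lyapunov

theorem sum_range_ite_lt_eq {s t : ℕ} (hst : s < t) (f : ℕ → ℝ) (c : ℝ) :
    ∑ r ∈ range t, (if r < s then f r else if r = s then c else 0) = ∑ r ∈ range s, f r + c := by
  rw [← Finset.sum_subset (Finset.range_mono (Nat.succ_le_of_lt hst)), Finset.sum_range_succ]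
  · refine congrArg₂ _ (Finset.sum_congr rfl fun r hr => ?_) (by simp)
    rw [if_pos (Finset.mem_range.mp hr)]
  · intro r _ hr
    rw [Finset.mem_range] at hr
    rw [if_neg (by omega), if_neg (by omega)]

theorem sum_range_sum_range_reflect (f : ℕ → ℝ) (t : ℕ) :
    ∑ s ∈ range t, ∑ r ∈ range s, f (s - 1 - r)
      = ∑ s ∈ range (t - 1), ∑ j ∈ range (s + 1), f j := by
  cases t with
  | zero => simp
  | succ t =>
    rw [Finset.sum_range_succ', Finset.sum_range_zero, add_zero, Nat.add_sub_cancel]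
    exact Finset.sum_congr rfl fun s _ => Finset.sum_range_reflect f (s + 1)

section NoiseDrivenState

variable {n m κ : Type*} [Fintype n] [DecidableEq n] [Fintype m] [Fintype κ]

/-- The state reached at time `s` from `0` by `x_{r+1} = F x_r + G η_r`. -/
def noiseState (F : Matrix n n ℝ) (G : Matrix n κ ℝ) (η : ℕ → κ → ℝ) (s : ℕ) : n → ℝ :=
  ∑ r ∈ range s, F ^ (s - 1 - r) *ᵥ G *ᵥ η r

/-- The pair formed by the noise-driven state and the second component of the noise at time `s`. -/
def noisePair (F : Matrix n n ℝ) (G : Matrix n (n ⊕ m) ℝ) (η : ℕ → n ⊕ m → ℝ) (s : ℕ) : n ⊕ m → ℝ :=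
  Sum.elim (noiseState F G η s) (η s ∘ Sum.inr)

/-- The average over the times `s < t` of the covariance of `noisePair` for white noise. -/
def noiseCov [DecidableEq m] (F : Matrix n n ℝ) (G : Matrix n κ ℝ) (t : ℕ) :
    Matrix (n ⊕ m) (n ⊕ m) ℝ :=
  fromBlocks ((t : ℝ)⁻¹ • ∑ s ∈ range (t - 1), ∑ j ∈ range (s + 1), (F ^ j * G) * (F ^ j * G)ᵀ)
    0 0 1

/-- The coefficients of the noise at time `r` in the direction `v` of `noisePair` at time `s`. -/
def noiseResponse (F : Matrix n n ℝ) (G : Matrix n (n ⊕ m) ℝ) (v : n ⊕ m → ℝ) (s r : ℕ) :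
    n ⊕ m → ℝ :=
  if r < s then (F ^ (s - 1 - r) * G)ᵀ *ᵥ (v ∘ Sum.inl)
  else if r = s then Sum.elim 0 (v ∘ Sum.inr) else 0

/-- The matrix of the map from the noise at times `r < t` to the direction `v` of `noisePair` at
times `s < t`. -/
def responseMatrix (F : Matrix n n ℝ) (G : Matrix n (n ⊕ m) ℝ) (t : ℕ) (v : n ⊕ m → ℝ) :
    Matrix (Fin t) (Fin t × (n ⊕ m)) ℝ :=
  Matrix.of fun s p => noiseResponse F G v s p.1 p.2

variable {F : Matrix n n ℝ}

theorem dotProduct_noiseState (F : Matrix n n ℝ) (G : Matrix n κ ℝ) (a : n → ℝ) (η : ℕ → κ → ℝ)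
    (s : ℕ) : a ⬝ᵥ noiseState F G η s
      = ∑ r ∈ range s, ((F ^ (s - 1 - r) * G)ᵀ *ᵥ a) ⬝ᵥ η r := by
  simp only [noiseState, dotProduct_sum, Matrix.mulVec_mulVec, dotProduct_transpose_mulVec]

section Covariance

variable [DecidableEq m] {G : Matrix n κ ℝ}

theorem dotProduct_noiseCov_mulVec (t : ℕ) (v : n ⊕ m → ℝ) :
    v ⬝ᵥ noiseCov F G t *ᵥ v
      = (t : ℝ)⁻¹ * ∑ s ∈ range (t - 1), ∑ j ∈ range (s + 1),
          ((F ^ j * G)ᵀ *ᵥ (v ∘ Sum.inl)) ⬝ᵥ ((F ^ j * G)ᵀ *ᵥ (v ∘ Sum.inl))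
        + (v ∘ Sum.inr) ⬝ᵥ (v ∘ Sum.inr) := by
  simp only [noiseCov, dotProduct_mulVec_fromBlocks_diagonal, Matrix.smul_mulVec, dotProduct_smul,
    smul_eq_mul, Matrix.sum_mulVec, dotProduct_sum, dotProduct_mul_transpose_self_mulVec,
    Matrix.one_mulVec]

theorem le_dotProduct_noiseCov_mulVec (hG : ∀ a, a ⬝ᵥ a ≤ (Gᵀ *ᵥ a) ⬝ᵥ (Gᵀ *ᵥ a)) {t : ℕ}
    (ht : 2 ≤ t) (v : n ⊕ m → ℝ) :
    1 / 2 * ((v ∘ Sum.inl) ⬝ᵥ (v ∘ Sum.inl)) + (v ∘ Sum.inr) ⬝ᵥ (v ∘ Sum.inr)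
      ≤ v ⬝ᵥ noiseCov F G t *ᵥ v := by
  rw [dotProduct_noiseCov_mulVec]
  refine add_le_add ?_ le_rfl
  set a := v ∘ Sum.inl
  have hsum : ((t - 1 : ℕ) : ℝ) * (a ⬝ᵥ a) ≤ ∑ s ∈ range (t - 1), ∑ j ∈ range (s + 1),
      ((F ^ j * G)ᵀ *ᵥ a) ⬝ᵥ ((F ^ j * G)ᵀ *ᵥ a) := by
    have hterm : ∀ s ∈ range (t - 1), a ⬝ᵥ a ≤ ∑ j ∈ range (s + 1),
        ((F ^ j * G)ᵀ *ᵥ a) ⬝ᵥ ((F ^ j * G)ᵀ *ᵥ a) := fun s _ => by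
      refine le_trans ?_ (Finset.single_le_sum
        (f := fun j => ((F ^ j * G)ᵀ *ᵥ a) ⬝ᵥ ((F ^ j * G)ᵀ *ᵥ a))
        (fun _ _ => dotProduct_self_nonneg _) (Finset.mem_range.mpr s.succ_pos))
      simpa only [pow_zero, Matrix.one_mul] using hG a
    simpa using Finset.card_nsmul_le_sum _ _ _ hterm
  have ht2 : (t : ℝ) ≤ 2 * ((t - 1 : ℕ) : ℝ) := by exact_mod_cast (by omega : t ≤ 2 * (t - 1))
  rw [inv_mul_eq_div, le_div_iff₀ (by positivity)]
  linarith [mul_le_mul_of_nonneg_right ht2 (dotProduct_self_nonneg a)]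

theorem dotProduct_self_le_two_mul_noiseCov (hG : ∀ a, a ⬝ᵥ a ≤ (Gᵀ *ᵥ a) ⬝ᵥ (Gᵀ *ᵥ a)) {t : ℕ}
    (ht : 2 ≤ t) (v : n ⊕ m → ℝ) : v ⬝ᵥ v ≤ 2 * (v ⬝ᵥ noiseCov F G t *ᵥ v) := by
  rw [dotProduct_sum_type v v]
  linarith [le_dotProduct_noiseCov_mulVec (F := F) hG ht v, dotProduct_self_nonneg (v ∘ Sum.inr)]

omit [Fintype m] in
theorem noiseCov_isHermitian (t : ℕ) :
    (noiseCov F G t : Matrix (n ⊕ m) (n ⊕ m) ℝ).IsHermitian := by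
  refine Matrix.IsHermitian.fromBlocks ?_ (by simp) Matrix.isHermitian_one
  simp [Matrix.IsHermitian, Matrix.conjTranspose_eq_transpose_of_trivial, Matrix.transpose_sum,
    Matrix.transpose_mul]

omit [Fintype m] in
theorem noiseCov_posDef [Finite m] (hG : ∀ a, a ⬝ᵥ a ≤ (Gᵀ *ᵥ a) ⬝ᵥ (Gᵀ *ᵥ a)) {t : ℕ}
    (ht : 2 ≤ t) :
    (noiseCov F G t : Matrix (n ⊕ m) (n ⊕ m) ℝ).PosDef := by
  cases nonempty_fintype m
  refine .of_dotProduct_mulVec_pos (noiseCov_isHermitian t) fun v hv => ?_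
  have hpos : 0 < v ⬝ᵥ v :=
    (dotProduct_self_nonneg v).lt_of_ne fun h => hv (dotProduct_self_eq_zero.mp h.symm)
  rw [star_trivial]
  linarith [dotProduct_self_le_two_mul_noiseCov (F := F) hG ht v]

end Covariance

variable {G : Matrix n (n ⊕ m) ℝ}

omit [Fintype m] in
theorem sum_fin_noiseResponse {t : ℕ} (s : Fin t) (v : n ⊕ m → ℝ) (φ : ℕ → (n ⊕ m → ℝ) → ℝ)
    (hφ : ∀ r, φ r 0 = 0) : ∑ r : Fin t, φ r (noiseResponse F G v s r)
      = ∑ r ∈ range s, φ r ((F ^ (s - 1 - r : ℕ) * G)ᵀ *ᵥ (v ∘ Sum.inl))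
        + φ s (Sum.elim 0 (v ∘ Sum.inr)) := by
  rw [← sum_range_ite_lt_eq s.2, Finset.sum_range]
  refine Finset.sum_congr rfl fun r _ => ?_
  unfold noiseResponse
  split_ifs with h1 h2
  · rfl
  · rw [h2]
  · exact hφ r

theorem dotProduct_noisePair (v : n ⊕ m → ℝ) (η : ℕ → n ⊕ m → ℝ) (s : ℕ) :
    v ⬝ᵥ noisePair F G η s
      = (v ∘ Sum.inl) ⬝ᵥ noiseState F G η s + (v ∘ Sum.inr) ⬝ᵥ (η s ∘ Sum.inr) := by
  rw [noisePair, dotProduct_sum_type, Sum.elim_comp_inl, Sum.elim_comp_inr]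

theorem responseMatrix_mulVec (t : ℕ) (v : n ⊕ m → ℝ) (η : ℕ → n ⊕ m → ℝ) (s : Fin t) :
    (responseMatrix F G t v *ᵥ fun p => η p.1 p.2) s = v ⬝ᵥ noisePair F G η s := by
  have hsum := sum_fin_noiseResponse (F := F) (G := G) s v (fun r c => c ⬝ᵥ η r)
    fun r => zero_dotProduct _
  rw [dotProduct_noisePair, dotProduct_noiseState, Matrix.mulVec, dotProduct,
    Fintype.sum_prod_type]
  refine hsum.trans (congrArg _ ?_)
  rw [dotProduct_sum_type, Sum.elim_comp_inl, Sum.elim_comp_inr, zero_dotProduct, zero_add]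

theorem dotProduct_responseMatrix_mulVec_self (t : ℕ) (v : n ⊕ m → ℝ) (η : ℕ → n ⊕ m → ℝ) :
    (responseMatrix F G t v *ᵥ fun p => η p.1 p.2) ⬝ᵥ (responseMatrix F G t v *ᵥ fun p => η p.1 p.2)
      = ∑ s ∈ range t, (v ⬝ᵥ noisePair F G η s) ^ 2 := by
  rw [Finset.sum_range, dotProduct]
  exact Finset.sum_congr rfl fun s _ => by rw [responseMatrix_mulVec, sq]

theorem trace_responseMatrix [DecidableEq m] {t : ℕ} (ht : t ≠ 0) (v : n ⊕ m → ℝ) :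
    ((responseMatrix F G t v)ᵀ * responseMatrix F G t v).trace
      = t * (v ⬝ᵥ noiseCov F G t *ᵥ v) := by
  have hrow (s : Fin t) : ∑ r : Fin t, noiseResponse F G v s r ⬝ᵥ noiseResponse F G v s r
      = ∑ r ∈ range s, ((F ^ (s - 1 - r : ℕ) * G)ᵀ *ᵥ (v ∘ Sum.inl)) ⬝ᵥ
          ((F ^ (s - 1 - r : ℕ) * G)ᵀ *ᵥ (v ∘ Sum.inl)) + (v ∘ Sum.inr) ⬝ᵥ (v ∘ Sum.inr) := by
    refine (sum_fin_noiseResponse s v (fun _ c => c ⬝ᵥ c) fun _ => zero_dotProduct _).trans ?_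
    rw [dotProduct_sum_type (Sum.elim _ _), Sum.elim_comp_inl, Sum.elim_comp_inr, zero_dotProduct,
      zero_add]
  calc ((responseMatrix F G t v)ᵀ * responseMatrix F G t v).trace
      = ∑ s : Fin t, ∑ r : Fin t, noiseResponse F G v s r ⬝ᵥ noiseResponse F G v s r := by
        simp only [trace_transpose_mul_self, Fintype.sum_prod_type, dotProduct, ← sq]
        rfl
    _ = ∑ s ∈ range (t - 1), ∑ j ∈ range (s + 1),
          ((F ^ j * G)ᵀ *ᵥ (v ∘ Sum.inl)) ⬝ᵥ ((F ^ j * G)ᵀ *ᵥ (v ∘ Sum.inl))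
        + t * ((v ∘ Sum.inr) ⬝ᵥ (v ∘ Sum.inr)) := by
        simp only [hrow, Finset.sum_add_distrib]
        rw [← sum_range_sum_range_reflect fun j =>
          ((F ^ j * G)ᵀ *ᵥ (v ∘ Sum.inl)) ⬝ᵥ ((F ^ j * G)ᵀ *ᵥ (v ∘ Sum.inl)), Finset.sum_range]
        simp
    _ = t * (v ⬝ᵥ noiseCov F G t *ᵥ v) := by
        rw [dotProduct_noiseCov_mulVec, mul_add, mul_inv_cancel_left₀ (Nat.cast_ne_zero.mpr ht)]

end NoiseDrivenState

namespace IsLyapunov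

variable {n q κ : Type*} [Fintype n] [DecidableEq n] [Nonempty n] [Fintype q] [Fintype κ]
  [DecidableEq κ] {P F : Matrix n n ℝ} {K : Matrix q n ℝ} (hP : IsLyapunov P F K)

include hP

theorem opNorm_fromRows_mul_pow_sq_le (j : ℕ) :
    opNorm (fromRows (1 : Matrix n n ℝ) K * F ^ j) ^ 2 ≤ opNorm P * (1 - 1 / opNorm P) ^ j := by
  refine opNorm_sq_le_of_forall ?_ fun v => ?_
  · exact mul_nonneg (opNorm_nonneg P) (pow_nonneg hP.one_sub_inv_nonneg j)
  · rw [← Matrix.mulVec_mulVec, Matrix.fromRows_mulVec, Matrix.one_mulVec,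
      sumElim_dotProduct_sumElim]
    exact hP.pow_mulVec_le v j

theorem vnorm_pow_mulVec_le (v : n → ℝ) (j : ℕ) :
    vnorm (F ^ j *ᵥ v) ≤ √(opNorm P * (1 - 1 / opNorm P) ^ j) * vnorm v := by
  refine abs_le_of_sq_le_sq' ?_ (mul_nonneg (Real.sqrt_nonneg _) (vnorm_nonneg v)) |>.2
  rw [mul_pow, vnorm_sq, vnorm_sq, Real.sq_sqrt
    (mul_nonneg (opNorm_nonneg P) (pow_nonneg hP.one_sub_inv_nonneg j))]
  linarith [hP.pow_mulVec_le v j, dotProduct_self_nonneg (K *ᵥ (F ^ j *ᵥ v))]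

theorem sum_decay_le (N : ℕ) :
    ∑ j ∈ range N, opNorm P * (1 - 1 / opNorm P) ^ j ≤ opNorm P ^ 2 := by
  have hp := zero_lt_one.trans_le hP.one_le_opNorm
  have hgeom := sum_pow_le_inv_one_sub hP.one_sub_inv_nonneg (sub_lt_self _ (by positivity)) N
  rw [sub_sub_cancel, one_div, inv_inv] at hgeom
  rw [← Finset.mul_sum, sq, one_div]
  exact mul_le_mul_of_nonneg_left hgeom hp.le

theorem sum_sq_dotProduct_noiseState_le (G : Matrix n κ ℝ) (a : n → ℝ) (η : ℕ → κ → ℝ) (t : ℕ) :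
    ∑ s ∈ range t, (a ⬝ᵥ noiseState F G η s) ^ 2
      ≤ 4 * opNorm P ^ 3 * opNorm G ^ 2 * (a ⬝ᵥ a) * ∑ r ∈ range t, η r ⬝ᵥ η r := by
  set p := opNorm P
  have hp1 : 1 ≤ p := hP.one_le_opNorm
  set k : ℕ → ℝ := fun j => √(p * (1 - 1 / p) ^ j)
  have hk (j) : 0 ≤ k j := Real.sqrt_nonneg _
  have hconv (s : ℕ) : |a ⬝ᵥ noiseState F G η s|
      ≤ vnorm a * ∑ r ∈ range s, k (s - 1 - r) * vnorm (G *ᵥ η r) := by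
    rw [noiseState, dotProduct_sum, Finset.mul_sum]
    refine (Finset.abs_sum_le_sum_abs _ _).trans (Finset.sum_le_sum fun r _ => ?_)
    exact (abs_dotProduct_le _ _).trans
      (mul_le_mul_of_nonneg_left (hP.vnorm_pow_mulVec_le _ _) (vnorm_nonneg a))
  calc ∑ s ∈ range t, (a ⬝ᵥ noiseState F G η s) ^ 2
      ≤ ∑ s ∈ range t, (vnorm a * ∑ r ∈ range s, k (s - 1 - r) * vnorm (G *ᵥ η r)) ^ 2 :=
        Finset.sum_le_sum fun s _ => sq_le_sq' (neg_le_of_abs_le (hconv s))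
          (le_of_abs_le (hconv s))
    _ = (a ⬝ᵥ a) * ∑ s ∈ range t, (∑ r ∈ range s, k (s - 1 - r) * vnorm (G *ᵥ η r)) ^ 2 := by
        rw [Finset.mul_sum]
        exact Finset.sum_congr rfl fun s _ => by rw [mul_pow, vnorm_sq]
    _ ≤ (a ⬝ᵥ a) * ((2 * p * √p) ^ 2 * ∑ r ∈ range t, vnorm (G *ᵥ η r) ^ 2) := by
        gcongr
        · exact dotProduct_self_nonneg a
        · exact sum_sq_convolution_le hk (sum_sqrt_mul_geometric_le hp1) t
    _ ≤ (a ⬝ᵥ a) * ((2 * p * √p) ^ 2 * ∑ r ∈ range t, opNorm G ^ 2 * (η r ⬝ᵥ η r)) := by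
        gcongr
        · exact dotProduct_self_nonneg a
        · rw [vnorm_sq]
          exact dotProduct_mulVec_self_le G _
    _ = 4 * p ^ 3 * opNorm G ^ 2 * (a ⬝ᵥ a) * ∑ r ∈ range t, η r ⬝ᵥ η r := by
        rw [← Finset.mul_sum, mul_pow, Real.sq_sqrt (zero_le_one.trans hp1)]
        ring

theorem sum_dotProduct_pow_mul_transpose_mulVec_le (G : Matrix n κ ℝ) (v : n ⊕ q → ℝ) (N : ℕ) :
    ∑ j ∈ range N, ((F ^ j * G)ᵀ *ᵥ (fromRows (1 : Matrix n n ℝ) K)ᵀ *ᵥ v) ⬝ᵥ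
        ((F ^ j * G)ᵀ *ᵥ (fromRows (1 : Matrix n n ℝ) K)ᵀ *ᵥ v)
      ≤ opNorm G ^ 2 * opNorm P ^ 2 * (v ⬝ᵥ v) := by
  classical
  have hterm (j : ℕ) : ((F ^ j * G)ᵀ *ᵥ (fromRows (1 : Matrix n n ℝ) K)ᵀ *ᵥ v) ⬝ᵥ
      ((F ^ j * G)ᵀ *ᵥ (fromRows (1 : Matrix n n ℝ) K)ᵀ *ᵥ v)
      ≤ opNorm G ^ 2 * (opNorm P * (1 - 1 / opNorm P) ^ j * (v ⬝ᵥ v)) := by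
    have hcomp : (F ^ j * G)ᵀ *ᵥ (fromRows (1 : Matrix n n ℝ) K)ᵀ *ᵥ v
        = Gᵀ *ᵥ (fromRows (1 : Matrix n n ℝ) K * F ^ j)ᵀ *ᵥ v := by
      simp only [Matrix.mulVec_mulVec, ← Matrix.transpose_mul, Matrix.mul_assoc]
    rw [hcomp]
    refine (dotProduct_mulVec_self_le _ _).trans ?_
    rw [opNorm_transpose]
    gcongr
    refine (dotProduct_mulVec_self_le _ _).trans ?_
    rw [opNorm_transpose]
    gcongr
    · exact dotProduct_self_nonneg v
    · exact hP.opNorm_fromRows_mul_pow_sq_le j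
  refine (Finset.sum_le_sum fun j _ => hterm j).trans ?_
  rw [← Finset.mul_sum, ← Finset.sum_mul, mul_assoc]
  gcongr
  · exact dotProduct_self_nonneg v
  · exact hP.sum_decay_le N

end IsLyapunov

theorem sq_dotProduct_inr_le {n m : Type*} [Fintype n] [Fintype m] (b : m → ℝ) (x : n ⊕ m → ℝ) :
    (b ⬝ᵥ (x ∘ Sum.inr)) ^ 2 ≤ (b ⬝ᵥ b) * (x ⬝ᵥ x) := by
  rw [← sq_abs]
  calc |b ⬝ᵥ (x ∘ Sum.inr)| ^ 2 ≤ (vnorm b * vnorm (x ∘ Sum.inr)) ^ 2 := by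
        gcongr; exact abs_dotProduct_le _ _
    _ ≤ (b ⬝ᵥ b) * (x ⬝ᵥ x) := by
        rw [mul_pow, vnorm_sq, vnorm_sq, dotProduct_sum_type x]
        exact mul_le_mul_of_nonneg_left
          (le_add_of_nonneg_left (dotProduct_self_nonneg _)) (dotProduct_self_nonneg b)

section ResponseNorm

variable {n m q : Type*} [Fintype n] [DecidableEq n] [Nonempty n] [Fintype m] [DecidableEq m]
  [Fintype q] {P F : Matrix n n ℝ} {K : Matrix q n ℝ} {G : Matrix n (n ⊕ m) ℝ}

theorem IsLyapunov.opNorm_responseMatrix_sq_le (hP : IsLyapunov P F K) {γ : ℝ} (hγ : 1 ≤ γ)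
    (hG : opNorm G ^ 2 ≤ γ) (t : ℕ) (v : n ⊕ m → ℝ) :
    opNorm (responseMatrix F G t v) ^ 2 ≤ 8 * opNorm P ^ 3 * γ * (v ⬝ᵥ v) := by
  have hp1 : 1 ≤ opNorm P ^ 3 := one_le_pow₀ hP.one_le_opNorm
  refine opNorm_sq_le_of_forall
    (mul_nonneg (by positivity) (dotProduct_self_nonneg v)) fun y => ?_
  set η : ℕ → n ⊕ m → ℝ := fun r i => if h : r < t then y (⟨r, h⟩, i) else 0 with hη
  have hy : y = fun p => η p.1 p.2 := by simp [hη]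
  rw [hy]
  clear_value η
  set S := ∑ r ∈ range t, η r ⬝ᵥ η r with hS
  have hS0 : 0 ≤ S := Finset.sum_nonneg fun _ _ => dotProduct_self_nonneg _
  set a := v ∘ Sum.inl
  set b := v ∘ Sum.inr
  have hstate : ∑ s ∈ range t, (a ⬝ᵥ noiseState F G η s) ^ 2
      ≤ 4 * opNorm P ^ 3 * γ * (a ⬝ᵥ a) * S := by
    refine (hP.sum_sq_dotProduct_noiseState_le G a η t).trans ?_
    gcongr
    exact dotProduct_self_nonneg a
  have hinput : ∑ s ∈ range t, (b ⬝ᵥ (η s ∘ Sum.inr)) ^ 2 ≤ (b ⬝ᵥ b) * S := by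
    rw [hS, Finset.mul_sum]
    exact Finset.sum_le_sum fun s _ => sq_dotProduct_inr_le b (η s)
  calc _ = ∑ s ∈ range t, (a ⬝ᵥ noiseState F G η s + b ⬝ᵥ (η s ∘ Sum.inr)) ^ 2 := by
        rw [dotProduct_responseMatrix_mulVec_self]
        exact Finset.sum_congr rfl fun s _ => by rw [dotProduct_noisePair]
    _ ≤ ∑ s ∈ range t, (2 * (a ⬝ᵥ noiseState F G η s) ^ 2 + 2 * (b ⬝ᵥ (η s ∘ Sum.inr)) ^ 2) :=
        Finset.sum_le_sum fun s _ => by rw [← mul_add]; exact add_sq_le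
    _ ≤ 2 * (4 * opNorm P ^ 3 * γ * (a ⬝ᵥ a) * S) + 2 * ((b ⬝ᵥ b) * S) := by
        rw [Finset.sum_add_distrib, ← Finset.mul_sum, ← Finset.mul_sum]
        gcongr
    _ ≤ 2 * (4 * opNorm P ^ 3 * γ * (a ⬝ᵥ a) * S)
          + 2 * (4 * opNorm P ^ 3 * γ * (b ⬝ᵥ b) * S) := by
        have : 1 ≤ 4 * opNorm P ^ 3 * γ := by nlinarith
        gcongr
        exact le_mul_of_one_le_left (dotProduct_self_nonneg b) this
    _ = 8 * opNorm P ^ 3 * γ * (v ⬝ᵥ v) * S := by rw [dotProduct_sum_type v]; ring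
    _ = _ := by
        rw [hS, Finset.sum_range]
        exact congrArg _ (Fintype.sum_prod_type' fun (s : Fin t) i => η s i * η s i).symm

end ResponseNorm

section ClosedLoop

variable {n m : ℕ} {A : Matrix (Fin n) (Fin n) ℝ} {B : Matrix (Fin n) (Fin m) ℝ}
  {K : Matrix (Fin m) (Fin n) ℝ} {σu : ℝ}

/-- The matrix by which the pair of process noise and exploration noise enters the closed loop. -/
def noiseInput (B : Matrix (Fin n) (Fin m) ℝ) (σu : ℝ) : Matrix (Fin n) (Fin n ⊕ Fin m) ℝ :=
  fromCols 1 (σu • B)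

/-- The matrix that maps the pair of state and exploration noise to the pair of state and
input. -/
def feedbackMap (K : Matrix (Fin m) (Fin n) ℝ) (σu : ℝ) :
    Matrix (Fin n ⊕ Fin m) (Fin n ⊕ Fin m) ℝ :=
  fromBlocks 1 0 K (σu • 1)

theorem one_le_Psi (B : Matrix (Fin n) (Fin m) ℝ) : 1 ≤ Psi B := le_max_left _ _

theorem opNorm_le_Psi (B : Matrix (Fin n) (Fin m) ℝ) : opNorm B ≤ Psi B := le_max_right _ _

theorem noiseInput_mul_transpose (B : Matrix (Fin n) (Fin m) ℝ) (σu : ℝ) :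
    noiseInput B σu * (noiseInput B σu)ᵀ = σu ^ 2 • (B * Bᵀ) + 1 := by
  rw [noiseInput, Matrix.transpose_fromCols, Matrix.fromCols_mul_fromRows, Matrix.transpose_one,
    Matrix.one_mul, Matrix.transpose_smul, Matrix.smul_mul, Matrix.mul_smul, smul_smul, ← sq,
    add_comm]

theorem dotProduct_noiseInput_transpose_mulVec (a : Fin n → ℝ) :
    ((noiseInput B σu)ᵀ *ᵥ a) ⬝ᵥ ((noiseInput B σu)ᵀ *ᵥ a)
      = σu ^ 2 * ((Bᵀ *ᵥ a) ⬝ᵥ (Bᵀ *ᵥ a)) + a ⬝ᵥ a := by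
  rw [← dotProduct_mul_transpose_self_mulVec, noiseInput_mul_transpose, Matrix.add_mulVec,
    dotProduct_add, Matrix.smul_mulVec, dotProduct_smul, dotProduct_mul_transpose_self_mulVec,
    Matrix.one_mulVec, smul_eq_mul]

theorem dotProduct_self_le_noiseInput_transpose_mulVec (a : Fin n → ℝ) :
    a ⬝ᵥ a ≤ ((noiseInput B σu)ᵀ *ᵥ a) ⬝ᵥ ((noiseInput B σu)ᵀ *ᵥ a) := by
  rw [dotProduct_noiseInput_transpose_mulVec]
  exact le_add_of_nonneg_left (mul_nonneg (sq_nonneg _) (dotProduct_self_nonneg _))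

theorem opNorm_noiseInput_sq_le (hσu : σu ^ 2 ≤ 1) :
    opNorm (noiseInput B σu) ^ 2 ≤ 2 * Psi B ^ 2 := by
  rw [← opNorm_transpose]
  refine opNorm_sq_le_of_forall (by positivity) fun a => ?_
  have ha := dotProduct_self_nonneg a
  have hinput : (Bᵀ *ᵥ a) ⬝ᵥ (Bᵀ *ᵥ a) ≤ Psi B ^ 2 * (a ⬝ᵥ a) := by
    refine (dotProduct_mulVec_self_le _ _).trans ?_
    rw [opNorm_transpose]
    gcongr
    exacts [opNorm_nonneg B, opNorm_le_Psi B]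
  rw [dotProduct_noiseInput_transpose_mulVec]
  linarith [mul_le_of_le_one_left (dotProduct_self_nonneg (Bᵀ *ᵥ a)) hσu,
    le_mul_of_one_le_left ha (one_le_pow₀ (one_le_Psi B) (n := 2))]

theorem avgCov_eq (t : ℕ) : avgCov A B K σu t
    = feedbackMap K σu * noiseCov (A + B * K) (noiseInput B σu) t * (feedbackMap K σu)ᵀ := by
  have hconj (S : Matrix (Fin n) (Fin n) ℝ) :
      feedbackMap K σu * fromBlocks S 0 0 1 * (feedbackMap K σu)ᵀ
        = fromRows 1 K * S * (fromRows 1 K)ᵀ + fromBlocks 0 0 0 (σu ^ 2 • 1) := by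
    simp [feedbackMap, Matrix.fromBlocks_multiply, Matrix.fromBlocks_transpose,
      Matrix.transpose_fromRows, Matrix.fromRows_mul, Matrix.fromBlocks_add,
      smul_smul, sq]
  rw [noiseCov, hconj, avgCov]
  simp only [Matrix.mul_smul, Matrix.smul_mul, Matrix.mul_sum, Matrix.sum_mul,
    ← noiseInput_mul_transpose, Matrix.transpose_mul, Matrix.mul_assoc]

theorem dotProduct_avgCov_mulVec (t : ℕ) (v : Fin n ⊕ Fin m → ℝ) :
    v ⬝ᵥ avgCov A B K σu t *ᵥ v = ((feedbackMap K σu)ᵀ *ᵥ v) ⬝ᵥ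
      noiseCov (A + B * K) (noiseInput B σu) t *ᵥ ((feedbackMap K σu)ᵀ *ᵥ v) := by
  rw [avgCov_eq, ← dotProduct_transpose_mul_mul_mulVec, Matrix.transpose_transpose]

theorem feedbackMap_transpose_mulVec (v : Fin n ⊕ Fin m → ℝ) :
    (feedbackMap K σu)ᵀ *ᵥ v
      = Sum.elim ((fromRows 1 K)ᵀ *ᵥ v) (σu • (v ∘ Sum.inr)) := by
  simp [feedbackMap, Matrix.fromBlocks_transpose, Matrix.fromBlocks_mulVec,
    Matrix.transpose_fromRows, Matrix.fromCols_mulVec, Matrix.smul_mulVec]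

theorem inv_mul_sum_range_pred_le {f : ℕ → ℝ} {D : ℝ} (hD : 0 ≤ D) (hf : ∀ s, f s ≤ D) (t : ℕ) :
    (t : ℝ)⁻¹ * ∑ s ∈ range (t - 1), f s ≤ D := by
  have hsum : ∑ s ∈ range (t - 1), f s ≤ t * D :=
    calc ∑ s ∈ range (t - 1), f s ≤ ((t - 1 : ℕ) : ℝ) * D := by
          simpa using Finset.sum_le_card_nsmul (range (t - 1)) f D fun s _ => hf s
      _ ≤ t * D := by gcongr; exact t.sub_le 1
  calc (t : ℝ)⁻¹ * ∑ s ∈ range (t - 1), f s ≤ (t : ℝ)⁻¹ * (t * D) := by gcongr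
    _ ≤ D := by
      rw [← mul_assoc]
      exact mul_le_of_le_one_left hD inv_mul_le_one

theorem IsLyapunov.dotProduct_avgCov_mulVec_le [NeZero n] {P : Matrix (Fin n) (Fin n) ℝ}
    (hP : IsLyapunov P (A + B * K) K) (hσu : σu ^ 2 ≤ 1) (t : ℕ) (v : Fin n ⊕ Fin m → ℝ) :
    v ⬝ᵥ avgCov A B K σu t *ᵥ v ≤ 3 * opNorm P ^ 2 * Psi B ^ 2 * (v ⬝ᵥ v) := by
  have hv := dotProduct_self_nonneg v
  have hp2 : 1 ≤ opNorm P ^ 2 := one_le_pow₀ hP.one_le_opNorm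
  have hΨ : 1 ≤ Psi B ^ 2 := one_le_pow₀ (one_le_Psi B)
  have hstate (s : ℕ) := (hP.sum_dotProduct_pow_mul_transpose_mulVec_le (noiseInput B σu) v
    (s + 1)).trans (mul_le_mul_of_nonneg_right (mul_le_mul_of_nonneg_right
      (opNorm_noiseInput_sq_le hσu) (sq_nonneg _)) hv)
  have hinput : (σu • (v ∘ Sum.inr)) ⬝ᵥ (σu • (v ∘ Sum.inr))
      ≤ opNorm P ^ 2 * Psi B ^ 2 * (v ⬝ᵥ v) := by
    rw [smul_dotProduct, dotProduct_smul, smul_eq_mul, smul_eq_mul, ← mul_assoc, ← sq]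
    refine mul_le_mul (hσu.trans (one_le_mul_of_one_le_of_one_le hp2 hΨ)) ?_
      (dotProduct_self_nonneg _) (by positivity)
    rw [dotProduct_sum_type v]
    exact le_add_of_nonneg_left (dotProduct_self_nonneg _)
  rw [dotProduct_avgCov_mulVec, feedbackMap_transpose_mulVec, dotProduct_noiseCov_mulVec,
    Sum.elim_comp_inl, Sum.elim_comp_inr]
  linarith [inv_mul_sum_range_pred_le (by positivity) hstate t]

end ClosedLoop

section Supermartingale

variable {Ω : Type*} [MeasurableSpace Ω] {μ : Measure Ω}

theorem measure_le_and_le_le_exp {X Y : Ω → ℝ} (hX : Measurable X) (hY : Measurable Y) {k V r : ℝ}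
    (hk : 0 < k) (hV : 0 < V) (hr : 0 ≤ r)
    (h : ∀ l : ℝ, expMoment μ (fun ω => l * X ω - k / 2 * (l ^ 2 * Y ω)) ≤ 1) :
    μ {ω | Y ω ≤ V ∧ r ≤ X ω} ≤ ofReal (exp (-(r ^ 2 / (2 * k * V)))) := by
  set l := r / (k * V) with hl
  have : 0 ≤ l := by positivity
  calc μ {ω | Y ω ≤ V ∧ r ≤ X ω}
      ≤ μ {ω | r ^ 2 / (2 * k * V) ≤ l * X ω - k / 2 * (l ^ 2 * Y ω)} := by
        refine measure_mono fun ω ⟨hYω, hXω⟩ => ?_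
        calc r ^ 2 / (2 * k * V) = l * r - k / 2 * (l ^ 2 * V) := by rw [hl]; field_simp; ring
          _ ≤ l * X ω - k / 2 * (l ^ 2 * Y ω) := by gcongr
    _ ≤ ofReal (exp (-(r ^ 2 / (2 * k * V)))) := by
        refine (measure_le_exp_neg_mul_expMoment (by fun_prop) _).trans ?_
        exact mul_le_of_le_one_right' (h l)

theorem measure_le_and_le_abs_le_exp {X Y : Ω → ℝ} (hX : Measurable X) (hY : Measurable Y)
    {k V r : ℝ} (hk : 0 < k) (hV : 0 < V) (hr : 0 ≤ r)
    (h : ∀ l : ℝ, expMoment μ (fun ω => l * X ω - k / 2 * (l ^ 2 * Y ω)) ≤ 1) :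
    μ {ω | Y ω ≤ V ∧ r ≤ |X ω|} ≤ ofReal (2 * exp (-(r ^ 2 / (2 * k * V)))) := by
  have hneg (l : ℝ) : expMoment μ (fun ω => l * -X ω - k / 2 * (l ^ 2 * Y ω)) ≤ 1 := by
    simpa only [neg_mul, mul_neg, neg_sq] using h (-l)
  have hsplit : {ω | Y ω ≤ V ∧ r ≤ |X ω|}
      = {ω | Y ω ≤ V ∧ r ≤ X ω} ∪ {ω | Y ω ≤ V ∧ r ≤ -X ω} := by
    ext ω
    simp only [le_abs, Set.mem_ofPred_eq, Set.mem_union]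
    tauto
  rw [hsplit, two_mul, ENNReal.ofReal_add (Real.exp_nonneg _) (Real.exp_nonneg _)]
  exact (measure_union_le _ _).trans (add_le_add (measure_le_and_le_le_exp hX hY hk hV hr h)
    (measure_le_and_le_le_exp hX.neg hY hk hV hr hneg))

variable {α β : Type*} [Fintype α] [Fintype β]

/-- The indices of the noise revealed when the component `α` of the noise at time `t` is drawn:
all noise before time `t` and the component `β` at time `t`. -/
def pastIndices (α β : Type*) [Fintype α] [Fintype β] (t : ℕ) : Finset (ℕ × (α ⊕ β)) :=
  {p ∈ range (t + 1) ×ˢ Finset.univ | p.1 < t ∨ p.2.isRight}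

/-- At each time, the process `H` depends on the revealed noise only. -/
def IsCausal {γ : Type*} (H : ℕ → (ℕ × (α ⊕ β) → ℝ) → γ) : Prop :=
  ∀ s e e', (∀ p ∈ pastIndices α β s, e p = e' p) → H s e = H s e'

/-- The logarithm of the exponential supermartingale that controls the transform of the component
`α` of the noise by `H`, for noise of variance proxy `k`. -/
def logSupermartingale (k : ℝ≥0) (H : ℕ → (ℕ × (α ⊕ β) → ℝ) → α → ℝ) (t : ℕ)
    (e : ℕ × (α ⊕ β) → ℝ) : ℝ :=
  ∑ s ∈ range t, (H s e ⬝ᵥ (fun i => e (s, Sum.inl i)) - k / 2 * (H s e ⬝ᵥ H s e))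

theorem mem_pastIndices_of_lt {s t : ℕ} (hst : s < t) (i : α ⊕ β) :
    (s, i) ∈ pastIndices α β t := by
  simp only [pastIndices, Finset.mem_filter, Finset.mem_product, Finset.mem_range,
    Finset.mem_univ, and_true]
  omega

theorem inr_mem_pastIndices (t : ℕ) (j : β) : (t, Sum.inr j) ∈ pastIndices α β t := by
  simp [pastIndices]

theorem inl_notMem_pastIndices (t : ℕ) (i : α) : (t, Sum.inl i) ∉ pastIndices α β t := by
  simp [pastIndices]

theorem pastIndices_mono : Monotone (pastIndices α β) := by
  intro s t hst p
  simp only [pastIndices, Finset.mem_filter, Finset.mem_product, Finset.mem_range,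
    Finset.mem_univ, and_true]
  rintro ⟨hps, hp⟩
  exact ⟨by omega, hp.imp_left fun h => h.trans_le hst⟩

theorem IsCausal.logSupermartingale_congr {k : ℝ≥0} {H : ℕ → (ℕ × (α ⊕ β) → ℝ) → α → ℝ}
    (hH : IsCausal H) {t : ℕ} {e e' : ℕ × (α ⊕ β) → ℝ} (h : ∀ p ∈ pastIndices α β t, e p = e' p) :
    logSupermartingale k H t e = logSupermartingale k H t e' := by
  refine Finset.sum_congr rfl fun s hs => ?_
  have hst := Finset.mem_range.mp hs
  rw [hH s e e' fun p hp => h p (pastIndices_mono hst.le hp),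
    funext fun i => h (s, Sum.inl i) (mem_pastIndices_of_lt hst _)]

omit [Fintype β] in
@[fun_prop]
theorem measurable_logSupermartingale {k : ℝ≥0} {H : ℕ → (ℕ × (α ⊕ β) → ℝ) → α → ℝ}
    (hH : ∀ s, Measurable (H s)) (t : ℕ) : Measurable (logSupermartingale k H t) := by
  unfold logSupermartingale
  fun_prop

theorem indepFun_pastIndices [DecidableEq α] [DecidableEq β] {η : ℕ × (α ⊕ β) → Ω → ℝ}
    (hη : ∀ p, Measurable (η p)) (hind : iIndepFun η μ) (t : ℕ) :
    IndepFun (fun ω => (pastIndices α β t).piecewise (fun p => η p ω) 0)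
      (fun ω i => η (t, Sum.inl i) ω) μ := by
  set S : Finset (ℕ × (α ⊕ β)) := Finset.univ.image fun i => (t, Sum.inl i)
  have hdisj : Disjoint (pastIndices α β t) S := by
    rw [Finset.disjoint_right]
    intro p hp
    obtain ⟨i, -, rfl⟩ := Finset.mem_image.mp hp
    exact inl_notMem_pastIndices t i
  have hpick : (fun (e : ℕ × (α ⊕ β) → ℝ) i => e (t, Sum.inl i)) ∘
      (fun ω => S.piecewise (fun p => η p ω) 0) = fun ω i => η (t, Sum.inl i) ω :=
    funext₂ fun ω i => S.piecewise_eq_of_mem (fun p => η p ω) 0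
      (Finset.mem_image_of_mem _ (Finset.mem_univ i))
  rw [← hpick]
  exact (indepFun_piecewise_zero hη hind hdisj).comp measurable_id (by fun_prop)

theorem expMoment_logSupermartingale_le_one [IsProbabilityMeasure μ] {η : ℕ × (α ⊕ β) → Ω → ℝ}
    {k : ℝ≥0} (hη : ∀ p, Measurable (η p)) (hind : iIndepFun η μ)
    (hsub : ∀ s i, HasSubgaussianMGF (η (s, Sum.inl i)) k μ)
    {H : ℕ → (ℕ × (α ⊕ β) → ℝ) → α → ℝ} (hH : ∀ s, Measurable (H s)) (hcausal : IsCausal H)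
    (t : ℕ) : expMoment μ (fun ω => logSupermartingale k H t fun p => η p ω) ≤ 1 := by
  classical
  induction t with
  | zero => simp [logSupermartingale, expMoment]
  | succ t ih =>
    set U : Ω → ℕ × (α ⊕ β) → ℝ := fun ω => (pastIndices α β t).piecewise (fun p => η p ω) 0
    have hU : ∀ ω, ∀ p ∈ pastIndices α β t, η p ω = U ω p := fun ω p hp =>
      ((pastIndices α β t).piecewise_eq_of_mem (fun p => η p ω) 0 hp).symm
    have hsubvec : HasSubgaussianVec (fun ω i => η (t, Sum.inl i) ω) k μ :=
      hasSubgaussianVec_of_iIndepFun (hind.precomp fun i j hij => by simpa using hij) (hsub t)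
    have hpast (ω : Ω) :
        logSupermartingale k H t (fun p => η p ω) = logSupermartingale k H t (U ω) :=
      hcausal.logSupermartingale_congr (hU ω)
    have hstep (ω : Ω) : logSupermartingale k H (t + 1) (fun p => η p ω)
        = (logSupermartingale k H t (U ω) - k / 2 * (H t (U ω) ⬝ᵥ H t (U ω)))
          + H t (U ω) ⬝ᵥ fun i => η (t, Sum.inl i) ω := by
      rw [← hpast, ← hcausal t _ _ (hU ω), logSupermartingale, Finset.sum_range_succ,
        logSupermartingale]
      ring
    simp only [hstep]
    refine (hsubvec.expMoment_add_dotProduct_le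
      (f := fun e => logSupermartingale k H t e - k / 2 * (H t e ⬝ᵥ H t e))
      (indepFun_pastIndices hη hind t) (by fun_prop) (by fun_prop) (by fun_prop) (hH t)).trans ?_
    simp only [hpast] at ih
    simpa only [sub_add_cancel] using ih

end Supermartingale

section CovarianceConcentration

/-- Over the times `s < t`, the empirical second moments of `ζ` agree with the matrix `V` up to a
factor `1 ± 1 / 2`. -/
def IsCovClose {ι : Type*} [Fintype ι] (V : Matrix ι ι ℝ) (ζ : ℕ → ι → ℝ) (t : ℕ) : Prop :=
  ∀ v, |∑ s ∈ range t, (v ⬝ᵥ ζ s) ^ 2 - t * (v ⬝ᵥ V *ᵥ v)| ≤ t / 2 * (v ⬝ᵥ V *ᵥ v)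

theorem dotProduct_sum_vecMulVec_sub_smul_mulVec {ι : Type*} [Fintype ι] (V : Matrix ι ι ℝ)
    (ζ : ℕ → ι → ℝ) (t : ℕ) (v : ι → ℝ) :
    v ⬝ᵥ (∑ s ∈ range t, vecMulVec (ζ s) (ζ s) - (t : ℝ) • V) *ᵥ v
      = ∑ s ∈ range t, (v ⬝ᵥ ζ s) ^ 2 - t * (v ⬝ᵥ V *ᵥ v) := by
  have hterm (s : ℕ) : v ⬝ᵥ vecMulVec (ζ s) (ζ s) *ᵥ v = (v ⬝ᵥ ζ s) ^ 2 := by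
    rw [vecMulVec_mulVec, op_smul_eq_smul, dotProduct_smul, smul_eq_mul, dotProduct_comm (ζ s) v,
      sq]
  simp only [Matrix.sub_mulVec, Matrix.sum_mulVec, Matrix.smul_mulVec, dotProduct_sub,
    dotProduct_sum, dotProduct_smul, smul_eq_mul, hterm]

variable {Ω : Type*} [MeasurableSpace Ω] {μ : Measure Ω} [IsProbabilityMeasure μ]
  {n m q : Type*} [Fintype n] [DecidableEq n] [Nonempty n] [Fintype m] [DecidableEq m]
  [Fintype q] {P F : Matrix n n ℝ} {K : Matrix q n ℝ} {G : Matrix n (n ⊕ m) ℝ}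
  {η : ℕ × (n ⊕ m) → Ω → ℝ} {k : ℝ≥0} {γ : ℝ} {t : ℕ}

theorem IsLyapunov.measure_le_abs_sum_noisePair_sq_sub_le (hP : IsLyapunov P F K) (hγ : 1 ≤ γ)
    (hG : opNorm G ^ 2 ≤ γ) (hG1 : ∀ a, a ⬝ᵥ a ≤ (Gᵀ *ᵥ a) ⬝ᵥ (Gᵀ *ᵥ a)) (ht : 2 ≤ t)
    (hη : ∀ p, Measurable (η p)) (hind : iIndepFun η μ) (hk : 1 ≤ k)
    (hsub : ∀ p, HasSubgaussianMGF (η p) k μ) (hvar : ∀ p, ∫ ω, η p ω ^ 2 ∂μ = 1)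
    {v : n ⊕ m → ℝ} (hv : v ⬝ᵥ noiseCov F G t *ᵥ v ≤ 1) :
    μ {ω | t / 16 ≤ |∑ s ∈ range t, (v ⬝ᵥ noisePair F G (fun r i => η (r, i) ω) s) ^ 2
        - t * (v ⬝ᵥ noiseCov F G t *ᵥ v)|}
      ≤ ofReal (2 * exp (-(t / (8912896 * k ^ 2 * opNorm P ^ 3 * γ)))) := by
  have hp1 : 1 ≤ opNorm P ^ 3 := one_le_pow₀ hP.one_le_opNorm
  let index (p : Fin t × (n ⊕ m)) : ℕ × (n ⊕ m) := (p.1, p.2)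
  have hindex : Function.Injective index := fun p p' h =>
    have ⟨htime, hcoord⟩ := Prod.ext_iff.mp h
    Prod.ext (Fin.ext htime) hcoord
  have hnorm : opNorm (responseMatrix F G t v) ^ 2 ≤ 16 * opNorm P ^ 3 * γ := by
    have hvv := dotProduct_self_le_two_mul_noiseCov (F := F) hG1 ht v
    calc opNorm (responseMatrix F G t v) ^ 2 ≤ 8 * opNorm P ^ 3 * γ * (v ⬝ᵥ v) :=
          hP.opNorm_responseMatrix_sq_le hγ hG t v
      _ ≤ 8 * opNorm P ^ 3 * γ * 2 := by gcongr; linarith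
      _ = 16 * opNorm P ^ 3 * γ := by ring
  have htrace := trace_responseMatrix (F := F) (G := G) (by omega : t ≠ 0) v
  have htail := measure_mul_le_abs_normSq_sub_trace_le (η := fun p => η (index p))
    (fun p => hη _) (hind.precomp hindex) (fun p => hsub _) (fun p => hvar _) hk
    (responseMatrix F G t v) (ε := 1 / 16) (T := t) (by norm_num) (by norm_num) (by positivity)
    hnorm (htrace.trans_le (mul_le_of_le_one_right t.cast_nonneg hv))
  convert htail using 4 with ω
  · rw [htrace, ← dotProduct_responseMatrix_mulVec_self t v fun r i => η (r, i) ω,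
      one_div_mul_eq_div]
  · field_simp
    norm_num

theorem IsLyapunov.measure_not_isCovClose_noisePair_le (hP : IsLyapunov P F K) (hγ : 1 ≤ γ)
    (hG : opNorm G ^ 2 ≤ γ) (hG1 : ∀ a, a ⬝ᵥ a ≤ (Gᵀ *ᵥ a) ⬝ᵥ (Gᵀ *ᵥ a)) (ht : 2 ≤ t)
    (hη : ∀ p, Measurable (η p)) (hind : iIndepFun η μ) (hk : 1 ≤ k)
    (hsub : ∀ p, HasSubgaussianMGF (η p) k μ) (hvar : ∀ p, ∫ ω, η p ω ^ 2 ∂μ = 1) :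
    μ {ω | ¬ IsCovClose (noiseCov F G t) (noisePair F G fun r i => η (r, i) ω) t}
      ≤ 2 * 25 ^ (Fintype.card n + Fintype.card m)
        * ofReal (2 * exp (-(t / (8912896 * k ^ 2 * opNorm P ^ 3 * γ)))) := by
  let deviation (ω : Ω) : Matrix (n ⊕ m) (n ⊕ m) ℝ :=
    ∑ s ∈ range t, vecMulVec (noisePair F G (fun r i => η (r, i) ω) s)
      (noisePair F G (fun r i => η (r, i) ω) s) - (t : ℝ) • noiseCov F G t
  have hsymm (ω : Ω) : (deviation ω)ᵀ = deviation ω := by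
    have hV : (noiseCov F G t : Matrix (n ⊕ m) (n ⊕ m) ℝ)ᵀ = noiseCov F G t :=
      noiseCov_isHermitian t
    simp only [deviation, transpose_sub, transpose_sum, transpose_vecMulVec, transpose_smul, hV]
  have hunion := measure_not_forall_abs_quadratic_le_of_posDef (μ := μ) (r := t / 16)
    (noiseCov_posDef (F := F) hG1 ht) hsymm fun v hv => by
      simp only [deviation, dotProduct_sum_vecMulVec_sub_smul_mulVec]
      exact hP.measure_le_abs_sum_noisePair_sq_sub_le hγ hG hG1 ht hη hind hk hsub hvar hv
  simp only [deviation, dotProduct_sum_vecMulVec_sub_smul_mulVec, Fintype.card_sum,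
    show 8 * ((t : ℝ) / 16) = t / 2 by ring] at hunion
  exact hunion

end CovarianceConcentration

theorem exp_neg_log_one_div {δ : ℝ} (hδ : 0 < δ) : exp (-log (1 / δ)) = δ := by
  rw [one_div, Real.log_inv, neg_neg, Real.exp_log hδ]

theorem two_mul_pow_mul_exp_neg_le {δ : ℝ} (hδ : 0 < δ) (hδ2 : δ < 1 / 2) (N : ℕ) :
    2 * 25 ^ N * (2 * exp (-(5 * (N + log (1 / δ))))) ≤ δ / 2 := by
  have hexp : exp (-(5 * (N + log (1 / δ)))) = exp (-5) ^ N * δ ^ 5 := by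
    conv_rhs => rw [← exp_neg_log_one_div hδ, ← Real.exp_nat_mul, ← Real.exp_nat_mul,
      ← Real.exp_add]
    congr 1
    push_cast
    ring
  have h25 : 25 * exp (-5) ≤ 1 := by
    rw [Real.exp_neg, mul_inv_le_iff₀ (Real.exp_pos 5), one_mul]
    calc (25 : ℝ) ≤ 2 ^ 5 := by norm_num
      _ ≤ exp 1 ^ 5 := by gcongr; linarith [Real.add_one_le_exp (1 : ℝ)]
      _ = exp 5 := by rw [← Real.exp_nat_mul]; norm_num
  calc 2 * 25 ^ N * (2 * exp (-(5 * (N + log (1 / δ)))))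
      = (25 * exp (-5)) ^ N * (4 * δ ^ 4 * δ) := by rw [hexp, mul_pow]; ring
    _ ≤ 1 * (4 * (1 / 2) ^ 4 * δ) := by
        gcongr
        exact pow_le_one₀ (by positivity) h25
    _ ≤ δ / 2 := by linarith

theorem pow_mul_two_mul_exp_neg_le {δ : ℝ} (hδ : 0 < δ) (hδ2 : δ < 1 / 2) {d : ℕ} (hd : d ≠ 0) :
    5 ^ d * (2 * exp (-(6 * (d * log (1 / δ))))) ≤ δ / 2 := by
  have hexp : exp (-(6 * (d * log (1 / δ)))) = (δ ^ 6) ^ d := by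
    conv_rhs => rw [← exp_neg_log_one_div hδ, ← Real.exp_nat_mul, ← Real.exp_nat_mul]
    congr 1
    push_cast
    ring
  have hδ6 : 5 * δ ^ 6 ≤ 5 / 32 * δ := by
    calc 5 * δ ^ 6 = 5 * δ ^ 5 * δ := by ring
      _ ≤ 5 * (1 / 2) ^ 5 * δ := by gcongr
      _ = 5 / 32 * δ := by ring
  calc 5 ^ d * (2 * exp (-(6 * (d * log (1 / δ))))) = 2 * (5 * δ ^ 6) ^ d := by
        rw [hexp, mul_pow]
        ring
    _ ≤ 2 * (5 * δ ^ 6) := by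
        gcongr
        exact pow_le_of_le_one (by positivity) (by linarith) hd
    _ ≤ δ / 2 := by linarith

theorem expMoment_comp_prodMk_le {Ω α β : Type*} [MeasurableSpace Ω] {μ : Measure Ω}
    [IsProbabilityMeasure μ] [MeasurableSpace α] [MeasurableSpace β] {X : Ω → α} {Y : Ω → β}
    (hXY : IndepFun X Y μ) (hX : Measurable X) (hY : Measurable Y) {f : α × β → ℝ}
    (hf : Measurable f) {c : ℝ≥0∞} (h : ∀ a, expMoment μ (fun ω => f (a, Y ω)) ≤ c) :
    expMoment μ (fun ω => f (X ω, Y ω)) ≤ c := by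
  have hlaw := (indepFun_iff_map_prod_eq_prod_map_map hX.aemeasurable hY.aemeasurable).mp hXY
  have := Measure.isProbabilityMeasure_map (μ := μ) hX.aemeasurable
  calc expMoment μ (fun ω => f (X ω, Y ω))
      = expMoment ((μ.map X).prod (μ.map Y)) f := by rw [← hlaw, expMoment_map (hX.prodMk hY) hf]
    _ = ∫⁻ a, expMoment μ (fun ω => f (a, Y ω)) ∂(μ.map X) := by
        rw [expMoment, lintegral_prod _ hf.exp.ennreal_ofReal.aemeasurable]
        exact lintegral_congr fun a => expMoment_map (f := fun b => f (a, b)) hY (by fun_prop)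
    _ ≤ ∫⁻ _, c ∂(μ.map X) := lintegral_mono h
    _ = c := by simp

theorem noiseState_succ {n κ : Type*} [Fintype n] [DecidableEq n] [Fintype κ] (F : Matrix n n ℝ)
    (G : Matrix n κ ℝ) (η : ℕ → κ → ℝ) (s : ℕ) :
    noiseState F G η (s + 1) = F *ᵥ noiseState F G η s + G *ᵥ η s := by
  rw [noiseState, Finset.sum_range_succ, noiseState, Matrix.mulVec_sum]
  refine congrArg₂ _ (Finset.sum_congr rfl fun r hr => ?_) (by simp)
  have := Finset.mem_range.mp hr
  rw [Matrix.mulVec_mulVec (M := F), ← pow_succ', show s + 1 - 1 - r = s - 1 - r + 1 by omega]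

theorem isCausal_noisePair {n m : Type*} [Fintype n] [DecidableEq n] [Fintype m] (F : Matrix n n ℝ)
    (G : Matrix n (n ⊕ m) ℝ) :
    IsCausal fun s (e : ℕ × (n ⊕ m) → ℝ) => noisePair F G (fun r i => e (r, i)) s := by
  intro s e e' h
  have hstate : noiseState F G (fun r i => e (r, i)) s
      = noiseState F G (fun r i => e' (r, i)) s := by
    refine Finset.sum_congr rfl fun r hr => ?_
    simp only [h (r, _) (mem_pastIndices_of_lt (Finset.mem_range.mp hr) _)]
  have hinput : (fun i => e (s, i)) ∘ Sum.inr = (fun i => e' (s, i)) ∘ Sum.inr :=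
    funext fun j => h (s, Sum.inr j) (inr_mem_pastIndices s j)
  simp only [noisePair, hstate, hinput]

section Rollout

variable {n m : ℕ} {A : Matrix (Fin n) (Fin n) ℝ} {B : Matrix (Fin n) (Fin m) ℝ}
  {K : Matrix (Fin m) (Fin n) ℝ} {σu : ℝ}

/-- The pair of state and input at time `s` of the closed loop, as a function of the initial state
and of the noise. -/
def closedLoopPair (A : Matrix (Fin n) (Fin n) ℝ) (B : Matrix (Fin n) (Fin m) ℝ)
    (K : Matrix (Fin m) (Fin n) ℝ) (σu : ℝ) (x₀ : Fin n → ℝ) (s : ℕ)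
    (e : ℕ × (Fin n ⊕ Fin m) → ℝ) : Fin n ⊕ Fin m → ℝ :=
  feedbackMap K σu *ᵥ (Sum.elim ((A + B * K) ^ s *ᵥ x₀) 0
    + noisePair (A + B * K) (noiseInput B σu) (fun r i => e (r, i)) s)

theorem isCausal_closedLoopPair (x₀ : Fin n → ℝ) : IsCausal (closedLoopPair A B K σu x₀) :=
  fun s e e' h => by simp only [closedLoopPair, isCausal_noisePair _ _ s e e' h]

theorem measurable_closedLoopPair (s : ℕ) :
    Measurable fun p : (Fin n → ℝ) × (ℕ × (Fin n ⊕ Fin m) → ℝ) =>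
      closedLoopPair A B K σu p.1 s p.2 := by
  refine measurable_mulVec _ (measurable_pi_lambda _ fun i => ?_)
  rcases i with i | j
  · simp only [noisePair, noiseState, Pi.add_apply, Sum.elim_inl, Finset.sum_apply]
    fun_prop
  · simp only [noisePair, Pi.add_apply, Sum.elim_inr, Function.comp_apply]
    fun_prop

variable {Ω : Type*}

/-- The coordinates of process and exploration noise as a single family. -/
def jointNoise (w : ℕ → Ω → Fin n → ℝ) (g : ℕ → Ω → Fin m → ℝ) (p : ℕ × (Fin n ⊕ Fin m)) (ω : Ω) :
    ℝ :=
  Sum.elim (w p.1 ω) (g p.1 ω) p.2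

variable [MeasurableSpace Ω] {μ : Measure Ω} {σ : ℝ≥0} {x : ℕ → Ω → Fin n → ℝ}
  {u : ℕ → Ω → Fin m → ℝ} {w : ℕ → Ω → Fin n → ℝ} {g : ℕ → Ω → Fin m → ℝ}

namespace IsRollout

variable (h : IsRollout μ A B K σu σ x u w g)

include h

theorem state_eq_pow_mulVec_add (s : ℕ) (ω : Ω) : x s ω = (A + B * K) ^ s *ᵥ x 0 ω
    + noiseState (A + B * K) (noiseInput B σu) (fun r i => jointNoise w g (r, i) ω) s := by
  induction s with
  | zero => simp [noiseState]
  | succ s ih =>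
    have hnoise : noiseInput B σu *ᵥ (fun i => jointNoise w g (s, i) ω)
        = w s ω + σu • B *ᵥ g s ω := by
      rw [noiseInput, Matrix.fromCols_mulVec, Matrix.one_mulVec, Matrix.smul_mulVec]
      rfl
    have hloop : x (s + 1) ω = (A + B * K) *ᵥ x s ω + (w s ω + σu • B *ᵥ g s ω) := by
      rw [h.state_eq, h.input_eq, Matrix.mulVec_add, Matrix.add_mulVec, Matrix.mulVec_mulVec,
        Matrix.mulVec_smul]
      abel
    rw [hloop, ih, noiseState_succ, hnoise, pow_succ', ← Matrix.mulVec_mulVec, Matrix.mulVec_add,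
      add_assoc]

theorem sumElim_eq_closedLoopPair (s : ℕ) (ω : Ω) :
    Sum.elim (x s ω) (u s ω)
      = closedLoopPair A B K σu (x 0 ω) s fun p => jointNoise w g p ω := by
  have hpair : Sum.elim ((A + B * K) ^ s *ᵥ x 0 ω) 0 + noisePair (A + B * K) (noiseInput B σu)
      (fun r i => jointNoise w g (r, i) ω) s = Sum.elim (x s ω) (g s ω) := by
    rw [h.state_eq_pow_mulVec_add s ω]
    ext (i | j) <;> simp [noisePair, jointNoise]
  rw [closedLoopPair, hpair, feedbackMap, Matrix.fromBlocks_mulVec, h.input_eq]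
  simp [Matrix.smul_mulVec]

theorem measurable_jointNoise (p : ℕ × (Fin n ⊕ Fin m)) : Measurable (jointNoise w g p) := by
  rcases p with ⟨s, i | j⟩
  · exact (measurable_pi_apply i).comp (h.measurable_w s)
  · exact (measurable_pi_apply j).comp (h.measurable_g s)

theorem measurable_sumElim (s : ℕ) : Measurable fun ω => Sum.elim (x s ω) (u s ω) := by
  have hnoise : Measurable fun ω p => jointNoise w g p ω :=
    measurable_pi_lambda _ h.measurable_jointNoise
  have hpair := (measurable_closedLoopPair (A := A) (B := B) (K := K) (σu := σu) s).comp
    (h.measurable_init.prodMk hnoise)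
  exact (funext fun ω => h.sumElim_eq_closedLoopPair s ω) ▸ hpair

theorem integral_jointNoise_sq (p : ℕ × (Fin n ⊕ Fin m)) : ∫ ω, jointNoise w g p ω ^ 2 ∂μ = 1 := by
  rcases p with ⟨s, i | j⟩
  · simpa only [jointNoise, Sum.elim_inl, sq, if_true] using h.cov_w s i i
  · exact integral_sq_of_map_eq_gaussianReal (h.measurable_jointNoise (s, Sum.inr j))
      (h.gaussian_g s j)

variable [IsProbabilityMeasure μ]

theorem one_le_sigma_sq [NeZero n] : 1 ≤ σ ^ 2 := by
  have hle := integral_sq_le_of_hasSubgaussianMGF (h.subgaussian_w 0 0)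
  rw [show ∫ ω, w 0 ω 0 ^ 2 ∂μ = 1 from h.integral_jointNoise_sq (0, Sum.inl 0)] at hle
  exact_mod_cast hle

theorem hasSubgaussianMGF_jointNoise [NeZero n] (p : ℕ × (Fin n ⊕ Fin m)) :
    HasSubgaussianMGF (jointNoise w g p) (σ ^ 2) μ := by
  rcases p with ⟨s, i | j⟩
  · exact h.subgaussian_w s i
  · exact hasSubgaussianMGF_mono (hasSubgaussianMGF_of_map_eq_gaussianReal
      (h.measurable_jointNoise (s, Sum.inr j)) (h.gaussian_g s j)) h.one_le_sigma_sq

theorem measure_not_isCovClose_le [NeZero n] {P : Matrix (Fin n) (Fin n) ℝ}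
    (hP : IsLyapunov P (A + B * K) K) (hσu : σu ^ 2 ≤ 1) {t : ℕ} (ht : 2 ≤ t) {δ : ℝ} (hδ : 0 < δ)
    (hδ2 : δ < 1 / 2)
    (hτ : 89128960 * (σ ^ 4 * opNorm P ^ 3 * Psi B ^ 2 * (n + m + log (1 / δ))) ≤ t) :
    μ {ω | ¬ IsCovClose (noiseCov (A + B * K) (noiseInput B σu) t)
        (noisePair (A + B * K) (noiseInput B σu) fun r i => jointNoise w g (r, i) ω) t}
      ≤ ofReal (δ / 2) := by
  have hΨ : 1 ≤ Psi B ^ 2 := one_le_pow₀ (one_le_Psi B)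
  have hp : 0 < opNorm P := zero_lt_one.trans_le hP.one_le_opNorm
  have : 0 < (σ ^ 2 : ℝ≥0) := zero_lt_one.trans_le h.one_le_sigma_sq
  have hΨ0 : 0 < Psi B := zero_lt_one.trans_le (one_le_Psi B)
  have hcount : (2 * 25 ^ (n + m) : ℝ≥0∞) = ofReal (2 * 25 ^ (n + m)) := by
    rw [ENNReal.ofReal_mul zero_le_two, ENNReal.ofReal_pow (by norm_num)]
    norm_num
  have hrate : 5 * ((n + m : ℕ) + log (1 / δ))
      ≤ t / (8912896 * (σ ^ 2 : ℝ≥0) ^ 2 * opNorm P ^ 3 * (2 * Psi B ^ 2)) := by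
    rw [le_div_iff₀ (by positivity)]
    push_cast
    linarith
  refine (hP.measure_not_isCovClose_noisePair_le (by linarith) (opNorm_noiseInput_sq_le hσu)
    dotProduct_self_le_noiseInput_transpose_mulVec ht h.measurable_jointNoise h.indep_noise
    h.one_le_sigma_sq h.hasSubgaussianMGF_jointNoise h.integral_jointNoise_sq).trans ?_
  rw [Fintype.card_fin, Fintype.card_fin]
  calc 2 * 25 ^ (n + m) * ofReal (2 * exp (-(t / (8912896 * (σ ^ 2 : ℝ≥0) ^ 2 * opNorm P ^ 3
        * (2 * Psi B ^ 2)))))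
      ≤ 2 * 25 ^ (n + m) * ofReal (2 * exp (-(5 * ((n + m : ℕ) + log (1 / δ))))) := by
        gcongr
    _ = ofReal (2 * 25 ^ (n + m) * (2 * exp (-(5 * ((n + m : ℕ) + log (1 / δ)))))) := by
        rw [hcount, ← ENNReal.ofReal_mul (by positivity)]
    _ ≤ ofReal (δ / 2) := ENNReal.ofReal_le_ofReal (two_mul_pow_mul_exp_neg_le hδ hδ2 (n + m))

theorem expMoment_sum_dotProduct_noise_le_one {f : (Fin n ⊕ Fin m → ℝ) → Fin n → ℝ}
    (hf : Measurable f) (t : ℕ) :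
    expMoment μ (fun ω => ∑ s ∈ range t, (f (Sum.elim (x s ω) (u s ω)) ⬝ᵥ w s ω
      - (σ ^ 2 : ℝ≥0) / 2 * (f (Sum.elim (x s ω) (u s ω)) ⬝ᵥ f (Sum.elim (x s ω) (u s ω)))))
      ≤ 1 := by
  let H (x₀ : Fin n → ℝ) (s : ℕ) (e : ℕ × (Fin n ⊕ Fin m) → ℝ) : Fin n → ℝ :=
    f (closedLoopPair A B K σu x₀ s e)
  have hH (s : ℕ) : Measurable fun p : (Fin n → ℝ) × (ℕ × (Fin n ⊕ Fin m) → ℝ) => H p.1 s p.2 :=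
    hf.comp (measurable_closedLoopPair s)
  have hcausal (x₀ : Fin n → ℝ) : IsCausal (H x₀) := fun s e e' he =>
    congrArg f (isCausal_closedLoopPair x₀ s e e' he)
  have hfixed (x₀ : Fin n → ℝ) : expMoment μ
      (fun ω => logSupermartingale (σ ^ 2) (H x₀) t fun p => jointNoise w g p ω) ≤ 1 :=
    expMoment_logSupermartingale_le_one h.measurable_jointNoise h.indep_noise h.subgaussian_w
      (fun s => (hH s).comp measurable_prodMk_left) (hcausal x₀) t
  have hjoint : Measurable fun p : (Fin n → ℝ) × (ℕ × (Fin n ⊕ Fin m) → ℝ) =>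
      logSupermartingale (σ ^ 2) (H p.1) t p.2 := by
    unfold logSupermartingale
    fun_prop
  simp only [h.sumElim_eq_closedLoopPair]
  exact expMoment_comp_prodMk_le h.indep_init h.measurable_init
    (measurable_pi_lambda _ h.measurable_jointNoise) hjoint hfixed

theorem measure_le_abs_sum_dotProduct_noise_le [NeZero n] {f : (Fin n ⊕ Fin m → ℝ) → Fin n → ℝ}
    (hf : Measurable f) (t : ℕ) {V r : ℝ} (hV : 0 < V) (hr : 0 ≤ r) :
    μ {ω | ∑ s ∈ range t, f (Sum.elim (x s ω) (u s ω)) ⬝ᵥ f (Sum.elim (x s ω) (u s ω)) ≤ V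
        ∧ r ≤ |∑ s ∈ range t, f (Sum.elim (x s ω) (u s ω)) ⬝ᵥ w s ω|}
      ≤ ofReal (2 * exp (-(r ^ 2 / (2 * (σ ^ 2 : ℝ≥0) * V)))) := by
  have hz := h.measurable_sumElim
  have hw := h.measurable_w
  refine measure_le_and_le_abs_le_exp (by fun_prop) (by fun_prop)
    (zero_lt_one.trans_le (by exact_mod_cast h.one_le_sigma_sq)) hV hr fun l => ?_
  refine le_of_eq_of_le (congrArg _ (funext fun ω => ?_))
    (h.expMoment_sum_dotProduct_noise_le_one (hf.const_smul l) t)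
  simp only [Pi.smul_apply, smul_dotProduct, dotProduct_smul, smul_eq_mul, Finset.sum_sub_distrib,
    Finset.mul_sum, sq, mul_assoc]

end IsRollout

end Rollout

/-- The Gram matrix of the first `t` regressors `z` is comparable to `t` times `V`. -/
def IsGramComparable {ι : Type*} [Fintype ι] (V : Matrix ι ι ℝ) (z : ℕ → ι → ℝ) (t : ℕ) : Prop :=
  ∀ v, t / 8 * (v ⬝ᵥ V *ᵥ v) ≤ ∑ s ∈ range t, (v ⬝ᵥ z s) ^ 2
    ∧ ∑ s ∈ range t, (v ⬝ᵥ z s) ^ 2 ≤ 4 * t * (v ⬝ᵥ V *ᵥ v)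

theorem IsCovClose.isGramComparable_add {ι : Type*} [Fintype ι] {V : Matrix ι ι ℝ}
    {ξ ζ : ℕ → ι → ℝ} {t : ℕ} (hζ : IsCovClose V ζ t)
    (hξ : ∀ v, ∑ s ∈ range t, (v ⬝ᵥ ξ s) ^ 2 ≤ t / 8 * (v ⬝ᵥ V *ᵥ v)) :
    IsGramComparable V (fun s => ξ s + ζ s) t := by
  intro v
  have hclose := abs_le.mp (hζ v)
  have := (abs_nonneg _).trans (hζ v)
  have hdrift := hξ v
  have hlower : 1 / 2 * ∑ s ∈ range t, (v ⬝ᵥ ζ s) ^ 2 - ∑ s ∈ range t, (v ⬝ᵥ ξ s) ^ 2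
      ≤ ∑ s ∈ range t, (v ⬝ᵥ (ξ s + ζ s)) ^ 2 := by
    rw [Finset.mul_sum, ← Finset.sum_sub_distrib]
    refine Finset.sum_le_sum fun s _ => ?_
    rw [dotProduct_add]
    nlinarith [sq_nonneg (v ⬝ᵥ ζ s + 2 * (v ⬝ᵥ ξ s))]
  have hupper : ∑ s ∈ range t, (v ⬝ᵥ (ξ s + ζ s)) ^ 2
      ≤ 2 * ∑ s ∈ range t, (v ⬝ᵥ ζ s) ^ 2 + 2 * ∑ s ∈ range t, (v ⬝ᵥ ξ s) ^ 2 := by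
    rw [Finset.mul_sum, Finset.mul_sum, ← Finset.sum_add_distrib]
    refine Finset.sum_le_sum fun s _ => ?_
    rw [dotProduct_add]
    linarith [add_sq_le (a := v ⬝ᵥ ξ s) (b := v ⬝ᵥ ζ s)]
  constructor <;> linarith

theorem IsLyapunov.sum_sq_dotProduct_drift_le {n m q : Type*} [Fintype n] [DecidableEq n]
    [Fintype m] [DecidableEq m] [Fintype q] {P F : Matrix n n ℝ} {K : Matrix q n ℝ}
    {G : Matrix n (n ⊕ m) ℝ} (hP : IsLyapunov P F K)
    (hG : ∀ a, a ⬝ᵥ a ≤ (Gᵀ *ᵥ a) ⬝ᵥ (Gᵀ *ᵥ a)) {t : ℕ} (ht : 2 ≤ t) {x₀ : n → ℝ}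
    (hx : 16 * (x₀ ⬝ᵥ x₀ * opNorm P) ≤ t) (v : n ⊕ m → ℝ) :
    ∑ s ∈ range t, (v ⬝ᵥ Sum.elim (F ^ s *ᵥ x₀) 0) ^ 2
      ≤ t / 8 * (v ⬝ᵥ noiseCov F G t *ᵥ v) := by
  set a := v ∘ Sum.inl
  have ha : a ⬝ᵥ a ≤ 2 * (v ⬝ᵥ noiseCov F G t *ᵥ v) := by
    linarith [le_dotProduct_noiseCov_mulVec (F := F) hG ht v, dotProduct_self_nonneg (v ∘ Sum.inr)]
  calc ∑ s ∈ range t, (v ⬝ᵥ Sum.elim (F ^ s *ᵥ x₀) 0) ^ 2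
      ≤ ∑ s ∈ range t, a ⬝ᵥ a * ((F ^ s *ᵥ x₀) ⬝ᵥ (F ^ s *ᵥ x₀)) := by
        refine Finset.sum_le_sum fun s _ => ?_
        rw [dotProduct_sum_type, Sum.elim_comp_inl, Sum.elim_comp_inr, dotProduct_zero, add_zero]
        simpa only [mul_pow, vnorm_sq, sq_abs]
          using pow_le_pow_left₀ (abs_nonneg _) (abs_dotProduct_le a (F ^ s *ᵥ x₀)) 2
    _ ≤ a ⬝ᵥ a * (opNorm P * (x₀ ⬝ᵥ x₀)) := by
        rw [← Finset.mul_sum]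
        exact mul_le_mul_of_nonneg_left (hP.sum_dotProduct_pow_mulVec_le x₀ t)
          (dotProduct_self_nonneg a)
    _ ≤ 2 * (v ⬝ᵥ noiseCov F G t *ᵥ v) * (t / 16) := by
        refine mul_le_mul ha (by linarith)
          (mul_nonneg (opNorm_nonneg P) (dotProduct_self_nonneg x₀)) ?_
        exact (dotProduct_self_nonneg a).trans ha
    _ = t / 8 * (v ⬝ᵥ noiseCov F G t *ᵥ v) := by ring

theorem IsRollout.isGramComparable {n m : ℕ} {A : Matrix (Fin n) (Fin n) ℝ}
    {B : Matrix (Fin n) (Fin m) ℝ} {K : Matrix (Fin m) (Fin n) ℝ} {σu : ℝ} {Ω : Type*}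
    [MeasurableSpace Ω] {μ : Measure Ω} {σ : ℝ≥0} {x : ℕ → Ω → Fin n → ℝ}
    {u : ℕ → Ω → Fin m → ℝ} {w : ℕ → Ω → Fin n → ℝ} {g : ℕ → Ω → Fin m → ℝ}
    (h : IsRollout μ A B K σu σ x u w g) {P : Matrix (Fin n) (Fin n) ℝ}
    (hP : IsLyapunov P (A + B * K) K) {t : ℕ} (ht : 2 ≤ t) {ω : Ω}
    (hx : 16 * (x 0 ω ⬝ᵥ x 0 ω * opNorm P) ≤ t)
    (hclose : IsCovClose (noiseCov (A + B * K) (noiseInput B σu) t)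
      (noisePair (A + B * K) (noiseInput B σu) fun r i => jointNoise w g (r, i) ω) t) :
    IsGramComparable (avgCov A B K σu t) (fun s => Sum.elim (x s ω) (u s ω)) t := by
  intro v
  rw [dotProduct_avgCov_mulVec]
  have hpair (s) : v ⬝ᵥ Sum.elim (x s ω) (u s ω) = ((feedbackMap K σu)ᵀ *ᵥ v) ⬝ᵥ
      (Sum.elim ((A + B * K) ^ s *ᵥ x 0 ω) 0 + noisePair (A + B * K) (noiseInput B σu)
        (fun r i => jointNoise w g (r, i) ω) s) := by
    rw [h.sumElim_eq_closedLoopPair, closedLoopPair, dotProduct_transpose_mulVec]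
  simp only [hpair]
  exact hclose.isGramComparable_add (hP.sum_sq_dotProduct_drift_le
    dotProduct_self_le_noiseInput_transpose_mulVec ht hx) _

section Projection

theorem lambdaMin_mul_dotProduct_self_le {ι : Type*} [Fintype ι] [DecidableEq ι]
    {S : Matrix ι ι ℝ} (hS : S.IsHermitian) (x : ι → ℝ) :
    lambdaMin S * (x ⬝ᵥ x) ≤ x ⬝ᵥ S *ᵥ x := by
  obtain ⟨U, hU, hUS⟩ := exists_orthogonal_diagonalization hS
  have hx : x ⬝ᵥ x = (Uᵀ *ᵥ x) ⬝ᵥ (Uᵀ *ᵥ x) := by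
    rw [dotProduct_transpose_mulVec, mulVec_mulVec, mul_eq_one_comm.mp hU, one_mulVec]
  have hSx : x ⬝ᵥ S *ᵥ x = (Uᵀ *ᵥ x) ⬝ᵥ diagonal hS.eigenvalues *ᵥ (Uᵀ *ᵥ x) := by
    rw [← dotProduct_transpose_mul_mul_mulVec, transpose_transpose, ← hUS]
  rw [hx, hSx, dotProduct, dotProduct, Finset.mul_sum]
  refine Finset.sum_le_sum fun i _ => ?_
  have hi : lambdaMin S ≤ hS.eigenvalues i := csInf_le (finite_real_spectrum (A := S)).bddBelow
    (hS.eigenvalues_mem_spectrum_real i)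
  rw [mulVec_diagonal]
  nlinarith [mul_le_mul_of_nonneg_right hi (mul_self_nonneg ((Uᵀ *ᵥ x) i))]

theorem nonempty_of_lambdaMin_pos {ι : Type*} [Fintype ι] [DecidableEq ι] {S : Matrix ι ι ℝ}
    (h : 0 < lambdaMin S) : Nonempty ι := by
  by_contra hempty
  rw [not_nonempty_iff] at hempty
  refine h.ne' ?_
  rw [lambdaMin, spectrum.of_subsingleton, Real.sInf_empty]

theorem posDef_of_lambdaMin_pos {ι : Type*} [Fintype ι] [DecidableEq ι] {S : Matrix ι ι ℝ}
    (hS : S.IsHermitian) (h : 0 < lambdaMin S) : S.PosDef := by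
  refine .of_dotProduct_mulVec_pos hS fun v hv => ?_
  have hpos : 0 < v ⬝ᵥ v :=
    (dotProduct_self_nonneg v).lt_of_ne fun h => hv (dotProduct_self_eq_zero.mp h.symm)
  exact (mul_pos h hpos).trans_le (lambdaMin_mul_dotProduct_self_le hS v)

variable {ι : Type*} [Fintype ι] {n : ℕ}

theorem dotProduct_kronecker_one_mulVec (S : Matrix ι ι ℝ) (q : ι × Fin n → ℝ) :
    q ⬝ᵥ (S ⊗ₖ (1 : Matrix (Fin n) (Fin n) ℝ)) *ᵥ q
      = ∑ i, (fun j => q (j, i)) ⬝ᵥ S *ᵥ fun j => q (j, i) := by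
  have h (j i) : ((S ⊗ₖ (1 : Matrix (Fin n) (Fin n) ℝ)) *ᵥ q) (j, i)
      = (S *ᵥ fun l => q (l, i)) j := by
    rw [mulVec, dotProduct, Fintype.sum_prod_type]
    simp [mulVec, dotProduct, Matrix.one_apply]
  simp only [dotProduct, Fintype.sum_prod_type, h]
  exact Finset.sum_comm

theorem dotProduct_kronecker_one_mulVec_le {S : Matrix ι ι ℝ} {c : ℝ}
    (hS : ∀ v, v ⬝ᵥ S *ᵥ v ≤ c * (v ⬝ᵥ v)) (q : ι × Fin n → ℝ) :
    q ⬝ᵥ (S ⊗ₖ (1 : Matrix (Fin n) (Fin n) ℝ)) *ᵥ q ≤ c * (q ⬝ᵥ q) := by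
  have hq : q ⬝ᵥ q = ∑ i, (fun j => q (j, i)) ⬝ᵥ fun j => q (j, i) := by
    simp only [dotProduct, Fintype.sum_prod_type]
    exact Finset.sum_comm
  rw [dotProduct_kronecker_one_mulVec, hq, Finset.mul_sum]
  exact Finset.sum_le_sum fun i _ => hS _

theorem kronId_transpose_mulVec_apply (z : ι → ℝ) (q : ι × Fin n → ℝ) (i : Fin n) :
    ((kronId n z)ᵀ *ᵥ q) i = (fun j => q (j, i)) ⬝ᵥ z := by
  simp only [mulVec, dotProduct, transpose_apply, kronId, Matrix.of_apply,
    Fintype.sum_prod_type, Matrix.one_apply]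
  refine Finset.sum_congr rfl fun j _ => ?_
  simp [mul_comm]

theorem kronId_transpose_mulVec_vec (M : Matrix (Fin n) ι ℝ) (z : ι → ℝ) :
    (kronId n z)ᵀ *ᵥ vec M = M *ᵥ z := by
  funext i
  rw [kronId_transpose_mulVec_apply]
  rfl

omit [Fintype ι] in
theorem vecMulVec_kronecker_one (z : ι → ℝ) :
    vecMulVec z z ⊗ₖ (1 : Matrix (Fin n) (Fin n) ℝ) = kronId n z * (kronId n z)ᵀ := by
  ext ⟨i, k⟩ ⟨j, l⟩
  simp [kronId, Matrix.mul_apply, vecMulVec_apply, Matrix.one_apply, mul_comm]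

theorem IsGramComparable.kronecker_one {V : Matrix ι ι ℝ} {z : ℕ → ι → ℝ} {t : ℕ}
    (hz : IsGramComparable V z t) (q : ι × Fin n → ℝ) :
    t / 8 * (q ⬝ᵥ (V ⊗ₖ (1 : Matrix (Fin n) (Fin n) ℝ)) *ᵥ q)
        ≤ ∑ s ∈ range t, ((kronId n (z s))ᵀ *ᵥ q) ⬝ᵥ ((kronId n (z s))ᵀ *ᵥ q) ∧
      ∑ s ∈ range t, ((kronId n (z s))ᵀ *ᵥ q) ⬝ᵥ ((kronId n (z s))ᵀ *ᵥ q)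
        ≤ 4 * t * (q ⬝ᵥ (V ⊗ₖ (1 : Matrix (Fin n) (Fin n) ℝ)) *ᵥ q) := by
  have hsum : ∑ s ∈ range t, ((kronId n (z s))ᵀ *ᵥ q) ⬝ᵥ ((kronId n (z s))ᵀ *ᵥ q)
      = ∑ i, ∑ s ∈ range t, ((fun j => q (j, i)) ⬝ᵥ z s) ^ 2 := by
    rw [Finset.sum_comm]
    refine Finset.sum_congr rfl fun s _ => ?_
    simp only [← kronId_transpose_mulVec_apply, sq]
    rfl
  rw [dotProduct_kronecker_one_mulVec, hsum, Finset.mul_sum, Finset.mul_sum]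
  exact ⟨Finset.sum_le_sum fun i _ => (hz _).1, Finset.sum_le_sum fun i _ => (hz _).2⟩

end Projection

section LeastSquares

theorem mulVec_symPinv_mulVec_of_posDef {ι : Type*} [Fintype ι] [DecidableEq ι]
    {S : Matrix ι ι ℝ} (hS : S.PosDef) (b : ι → ℝ) : S *ᵥ (symPinv S *ᵥ b) = b := by
  have hinv : S * symPinv S = 1 :=
    hS.isUnit.mul_right_cancel ((symPinv_spec S hS.1).1.trans (Matrix.one_mul S).symm)
  rw [mulVec_mulVec, hinv, one_mulVec]

variable {n m d : ℕ} {Φ : Matrix ((Fin n ⊕ Fin m) × Fin n) (Fin d) ℝ} {t : ℕ}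
  {x : ℕ → Fin n → ℝ} {u : ℕ → Fin m → ℝ}

theorem lsGram_eq_sum_transpose_mul_self : lsGram Φ t x u = ∑ s ∈ range t,
    ((kronId n (Sum.elim (x s) (u s)))ᵀ * Φ)ᵀ * ((kronId n (Sum.elim (x s) (u s)))ᵀ * Φ) := by
  simp only [lsGram, vecMulVec_kronecker_one, transpose_mul, transpose_transpose,
    Matrix.mul_assoc]

theorem lsGram_isHermitian : (lsGram Φ t x u).IsHermitian := by
  rw [Matrix.IsHermitian, conjTranspose_eq_transpose_of_trivial, lsGram_eq_sum_transpose_mul_self]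
  simp only [transpose_sum, transpose_mul, transpose_transpose]

theorem dotProduct_lsGram_mulVec (y θ : Fin d → ℝ) :
    y ⬝ᵥ lsGram Φ t x u *ᵥ θ = ∑ s ∈ range t,
      ((kronId n (Sum.elim (x s) (u s)))ᵀ *ᵥ (Φ *ᵥ y)) ⬝ᵥ
        ((kronId n (Sum.elim (x s) (u s)))ᵀ *ᵥ (Φ *ᵥ θ)) := by
  rw [lsGram_eq_sum_transpose_mul_self, Matrix.sum_mulVec, dotProduct_sum]
  refine Finset.sum_congr rfl fun s _ => ?_
  rw [← mulVec_mulVec, dotProduct_comm, dotProduct_transpose_mulVec, dotProduct_comm,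
    mulVec_mulVec, mulVec_mulVec]

theorem sum_dotProduct_lsEstimate (hpos : (lsGram Φ t x u).PosDef) (y : Fin d → ℝ) :
    ∑ s ∈ range t, ((kronId n (Sum.elim (x s) (u s)))ᵀ *ᵥ (Φ *ᵥ y)) ⬝ᵥ
        ((kronId n (Sum.elim (x s) (u s)))ᵀ *ᵥ (Φ *ᵥ lsEstimate Φ t x u))
      = ∑ s ∈ range t,
        ((kronId n (Sum.elim (x s) (u s)))ᵀ *ᵥ (Φ *ᵥ y)) ⬝ᵥ x (s + 1) := by
  rw [← dotProduct_lsGram_mulVec, lsEstimate, mulVec_symPinv_mulVec_of_posDef hpos,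
    dotProduct_sum]
  refine Finset.sum_congr rfl fun s _ => ?_
  rw [dotProduct_comm, dotProduct_transpose_mulVec, dotProduct_comm, dotProduct_transpose_mulVec]

end LeastSquares

section Regression

variable {κ ι d : Type*} [Fintype κ] [Fintype ι] [Fintype d] {t : ℕ}

omit [Fintype κ] [Fintype d] in
theorem sum_dotProduct_self_le_of_eq_add {a b w : ℕ → ι → ℝ} {ρ : ℝ}
    (h : ∑ s ∈ range t, a s ⬝ᵥ a s
      = ∑ s ∈ range t, a s ⬝ᵥ b s + ∑ s ∈ range t, a s ⬝ᵥ w s)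
    (hw : ∑ s ∈ range t, a s ⬝ᵥ w s ≤ 1 / 4 * ∑ s ∈ range t, a s ⬝ᵥ a s + ρ) :
    ∑ s ∈ range t, a s ⬝ᵥ a s ≤ 2 * (∑ s ∈ range t, b s ⬝ᵥ b s + ρ) := by
  have hcross : ∑ s ∈ range t, a s ⬝ᵥ b s
      ≤ 1 / 4 * ∑ s ∈ range t, a s ⬝ᵥ a s + ∑ s ∈ range t, b s ⬝ᵥ b s := by
    rw [Finset.mul_sum, ← Finset.sum_add_distrib]
    refine Finset.sum_le_sum fun s _ => ?_
    have := dotProduct_self_nonneg ((1 / 2 : ℝ) • a s - b s)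
    simp only [dotProduct_sub, sub_dotProduct, dotProduct_smul, smul_dotProduct, smul_eq_mul,
      dotProduct_comm (b s) (a s)] at this
    linarith
  linarith

theorem two_mul_mul_sqrt_le {t Q : ℝ} (ht : 0 < t) (hQ : 0 ≤ Q) (r : ℝ) :
    2 * r * √Q ≤ t / 32 * Q + 32 * r ^ 2 / t := by
  have hsq : t / 32 * Q + 32 * r ^ 2 / t - 2 * r * √Q = 32 / t * (t / 32 * √Q - r) ^ 2 := by
    field_simp
    linear_combination (-t ^ 2) * Real.sq_sqrt hQ
  have : 0 ≤ 32 / t * (t / 32 * √Q - r) ^ 2 := by positivity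
  linarith

omit [Fintype κ] [Fintype d] in
theorem energy_le_of_eq_add {a b w : ℕ → ι → ℝ}
    (h : ∑ s ∈ range t, a s ⬝ᵥ a s
      = ∑ s ∈ range t, a s ⬝ᵥ b s + ∑ s ∈ range t, a s ⬝ᵥ w s) (ht : 0 < t) {Q M r : ℝ}
    (hQ : 0 ≤ Q) (hlow : t / 8 * Q ≤ ∑ s ∈ range t, a s ⬝ᵥ a s)
    (hup : ∑ s ∈ range t, b s ⬝ᵥ b s ≤ t * M)
    (hnoise : |∑ s ∈ range t, a s ⬝ᵥ w s| ≤ 2 * r * √Q) :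
    Q ≤ 16 * (M + 32 * r ^ 2 / t ^ 2) := by
  have ht' : (0 : ℝ) < t := Nat.cast_pos.mpr ht
  have := two_mul_mul_sqrt_le ht' hQ r
  have henergy := sum_dotProduct_self_le_of_eq_add (ρ := 32 * r ^ 2 / t) h <| by
    linarith [le_abs_self (∑ s ∈ range t, a s ⬝ᵥ w s)]
  refine le_of_mul_le_mul_left ?_ (show 0 < (t : ℝ) / 8 by positivity)
  calc t / 8 * Q ≤ 2 * (t * M + 32 * r ^ 2 / t) := by linarith
    _ = t / 8 * (16 * (M + 32 * r ^ 2 / t ^ 2)) := by field_simp; ring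

variable {E : ℕ → Matrix ι κ ℝ} {Φ : Matrix κ d ℝ} {q : κ → ℝ} {θ : d → ℝ} {w : ℕ → ι → ℝ}

theorem sum_dotProduct_self_error_eq
    (hnormal : ∀ y, ∑ s ∈ range t, (E s *ᵥ (Φ *ᵥ y)) ⬝ᵥ (E s *ᵥ (Φ *ᵥ θ))
      = ∑ s ∈ range t, (E s *ᵥ (Φ *ᵥ y)) ⬝ᵥ (E s *ᵥ q + w s)) {e : d → ℝ} {v : κ → ℝ}
    (herr : Φ *ᵥ θ - q = Φ *ᵥ e - v) :
    ∑ s ∈ range t, (E s *ᵥ (Φ *ᵥ e)) ⬝ᵥ (E s *ᵥ (Φ *ᵥ e))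
      = ∑ s ∈ range t, (E s *ᵥ (Φ *ᵥ e)) ⬝ᵥ (E s *ᵥ v)
        + ∑ s ∈ range t, (E s *ᵥ (Φ *ᵥ e)) ⬝ᵥ w s := by
  have hE (s) : E s *ᵥ (Φ *ᵥ θ) = E s *ᵥ q + (E s *ᵥ (Φ *ᵥ e) - E s *ᵥ v) := by
    rw [← mulVec_sub, ← herr, mulVec_sub, add_sub_cancel]
  have horthogonal := hnormal e
  simp only [hE, dotProduct_add, dotProduct_sub, Finset.sum_add_distrib,
    Finset.sum_sub_distrib] at horthogonal
  linarith

variable [DecidableEq κ]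

theorem mulVec_sub_eq_sub_residual :
    Φ *ᵥ θ - q = Φ *ᵥ (θ - Φᵀ *ᵥ q) - (1 - Φ * Φᵀ) *ᵥ q := by
  rw [mulVec_sub, Matrix.sub_mulVec, one_mulVec, mulVec_mulVec]
  abel

variable [DecidableEq d]

theorem dotProduct_self_mulVec_sub_residual (horth : Φᵀ * Φ = 1) (e : d → ℝ) (q : κ → ℝ) :
    (Φ *ᵥ e - (1 - Φ * Φᵀ) *ᵥ q) ⬝ᵥ (Φ *ᵥ e - (1 - Φ * Φᵀ) *ᵥ q)
      = e ⬝ᵥ e + ((1 - Φ * Φᵀ) *ᵥ q) ⬝ᵥ ((1 - Φ * Φᵀ) *ᵥ q) := by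
  have hΦe : (Φ *ᵥ e) ⬝ᵥ (Φ *ᵥ e) = e ⬝ᵥ e := by
    rw [← dotProduct_transpose_mul_self_mulVec, horth, one_mulVec]
  have hperp : ((1 - Φ * Φᵀ) *ᵥ q) ⬝ᵥ (Φ *ᵥ e) = 0 := by
    rw [← dotProduct_transpose_mulVec, mulVec_mulVec, Matrix.mul_sub, Matrix.mul_one,
      ← Matrix.mul_assoc, horth, Matrix.one_mul, sub_self, Matrix.zero_mulVec, zero_dotProduct]
  rw [dotProduct_sub, sub_dotProduct, sub_dotProduct, hΦe, dotProduct_comm (Φ *ᵥ e), hperp]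
  ring

theorem dotProduct_self_estimate_sub_le (horth : Φᵀ * Φ = 1)
    (hnormal : ∀ y, ∑ s ∈ range t, (E s *ᵥ (Φ *ᵥ y)) ⬝ᵥ (E s *ᵥ (Φ *ᵥ θ))
      = ∑ s ∈ range t, (E s *ᵥ (Φ *ᵥ y)) ⬝ᵥ (E s *ᵥ q + w s)) (ht : 0 < t)
    {D : Matrix d d ℝ} {lam M r : ℝ} (hlam : 0 < lam)
    (hD : ∀ y, lam * (y ⬝ᵥ y) ≤ y ⬝ᵥ D *ᵥ y)
    (hlow : ∀ y, t / 8 * (y ⬝ᵥ D *ᵥ y)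
      ≤ ∑ s ∈ range t, (E s *ᵥ (Φ *ᵥ y)) ⬝ᵥ (E s *ᵥ (Φ *ᵥ y)))
    (hup : ∀ v, ∑ s ∈ range t, (E s *ᵥ v) ⬝ᵥ (E s *ᵥ v) ≤ t * (M * (v ⬝ᵥ v)))
    (hnoise : ∀ y, |∑ s ∈ range t, (E s *ᵥ (Φ *ᵥ y)) ⬝ᵥ w s| ≤ 2 * r * √(y ⬝ᵥ D *ᵥ y)) :
    (Φ *ᵥ θ - q) ⬝ᵥ (Φ *ᵥ θ - q)
      ≤ 16 * (M * (((1 - Φ * Φᵀ) *ᵥ q) ⬝ᵥ ((1 - Φ * Φᵀ) *ᵥ q)) + 32 * r ^ 2 / t ^ 2) / lam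
        + ((1 - Φ * Φᵀ) *ᵥ q) ⬝ᵥ ((1 - Φ * Φᵀ) *ᵥ q) := by
  rw [mulVec_sub_eq_sub_residual, dotProduct_self_mulVec_sub_residual horth]
  set e := θ - Φᵀ *ᵥ q
  have henergy := energy_le_of_eq_add
    (sum_dotProduct_self_error_eq hnormal mulVec_sub_eq_sub_residual) ht
    ((mul_nonneg hlam.le (dotProduct_self_nonneg e)).trans (hD e)) (hlow e) (hup _) (hnoise e)
  gcongr
  rw [le_div_iff₀' hlam]
  exact (hD e).trans henergy

end Regression

section Excitation

variable {n m d : ℕ} {A : Matrix (Fin n) (Fin n) ℝ} {B : Matrix (Fin n) (Fin m) ℝ}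
  {K : Matrix (Fin m) (Fin n) ℝ} {σu : ℝ} {Φ : Matrix ((Fin n ⊕ Fin m) × Fin n) (Fin d) ℝ}

theorem avgCov_isHermitian (t : ℕ) : (avgCov A B K σu t).IsHermitian := by
  rw [avgCov_eq, ← conjTranspose_eq_transpose_of_trivial]
  exact isHermitian_mul_mul_conjTranspose _ (noiseCov_isHermitian t)

theorem Delta_isHermitian (t : ℕ) : (Delta A B K σu t Φ).IsHermitian := by
  have havg := avgCov_isHermitian (A := A) (B := B) (K := K) (σu := σu) t
  rw [Delta, ← conjTranspose_eq_transpose_of_trivial]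
  refine isHermitian_conjTranspose_mul_mul _ ?_
  rw [Matrix.IsHermitian, conjTranspose_kronecker, havg.eq, conjTranspose_one]

theorem dotProduct_Delta_mulVec (t : ℕ) (y : Fin d → ℝ) : y ⬝ᵥ Delta A B K σu t Φ *ᵥ y
    = (Φ *ᵥ y) ⬝ᵥ (avgCov A B K σu t ⊗ₖ (1 : Matrix (Fin n) (Fin n) ℝ)) *ᵥ (Φ *ᵥ y) :=
  dotProduct_transpose_mul_mul_mulVec _ _ _

theorem IsLyapunov.lambdaMin_Delta_le [NeZero n] [NeZero d] {P : Matrix (Fin n) (Fin n) ℝ}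
    (hP : IsLyapunov P (A + B * K) K) (hσu : σu ^ 2 ≤ 1) (horth : Φᵀ * Φ = 1) (t : ℕ) :
    lambdaMin (Delta A B K σu t Φ) ≤ 3 * opNorm P ^ 2 * Psi B ^ 2 := by
  have hunit : (Pi.single 0 1 : Fin d → ℝ) ⬝ᵥ Pi.single 0 1 = 1 := by simp
  have hΦ : (Φ *ᵥ Pi.single 0 1) ⬝ᵥ (Φ *ᵥ Pi.single 0 1) = 1 := by
    rw [← dotProduct_transpose_mul_self_mulVec, horth, one_mulVec, hunit]
  have hlower := lambdaMin_mul_dotProduct_self_le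
    (Delta_isHermitian (A := A) (B := B) (K := K) (σu := σu) (Φ := Φ) t) (Pi.single 0 1)
  rw [hunit, mul_one, dotProduct_Delta_mulVec] at hlower
  refine hlower.trans ?_
  simpa only [hΦ, mul_one] using dotProduct_kronecker_one_mulVec_le
    (hP.dotProduct_avgCov_mulVec_le hσu t) (Φ *ᵥ Pi.single 0 1)

theorem IsGramComparable.lsGram_posDef {t : ℕ} {x : ℕ → Fin n → ℝ} {u : ℕ → Fin m → ℝ}
    (hgram : IsGramComparable (avgCov A B K σu t) (fun s => Sum.elim (x s) (u s)) t) (ht : 0 < t)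
    (hΔ : (Delta A B K σu t Φ).PosDef) : (lsGram Φ t x u).PosDef := by
  refine .of_dotProduct_mulVec_pos lsGram_isHermitian fun y hy => ?_
  have : (0 : ℝ) < t := Nat.cast_pos.mpr ht
  rw [star_trivial, dotProduct_lsGram_mulVec]
  refine lt_of_lt_of_le ?_ (hgram.kronecker_one (Φ *ᵥ y)).1
  rw [← dotProduct_Delta_mulVec]
  exact mul_pos (by positivity) (hΔ.dotProduct_mulVec_pos hy)

theorem neZero_of_transpose_mul_self_eq_one [NeZero d] (horth : Φᵀ * Φ = 1) : NeZero n := by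
  refine ⟨fun hn => ?_⟩
  subst hn
  have hentry := congrFun₂ horth 0 0
  rw [Matrix.mul_apply, Finset.univ_eq_empty, Finset.sum_empty, one_apply_eq] at hentry
  exact zero_ne_one hentry

end Excitation

section Estimation

theorem exists_measurableSet_forall_notMem {Ω : Type*} [MeasurableSpace Ω] {μ : Measure Ω}
    [IsProbabilityMeasure μ] {R S : Set Ω} {δ : ℝ} (hδ : 0 ≤ δ) (hR : μ R ≤ ofReal (δ / 2))
    (hS : μ S ≤ ofReal (δ / 2)) :
    ∃ E, MeasurableSet E ∧ ofReal (1 - δ) ≤ μ E ∧ ∀ ω ∈ E, ω ∉ R ∧ ω ∉ S := by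
  refine ⟨(toMeasurable μ (R ∪ S))ᶜ, (measurableSet_toMeasurable _ _).compl, ?_, fun ω hω => ?_⟩
  · rw [prob_compl_eq_one_sub (measurableSet_toMeasurable _ _), measure_toMeasurable,
      ENNReal.ofReal_sub _ hδ, ENNReal.ofReal_one]
    refine tsub_le_tsub_left ((measure_union_le R S).trans ((add_le_add hR hS).trans_eq ?_)) _
    rw [← ENNReal.ofReal_add (by positivity) (by positivity), add_halves]
  · exact not_or.mp fun hmem => hω (subset_toMeasurable μ (R ∪ S) hmem)

theorem error_bound_le_rate {p Ψ lam L t s D : ℝ} (hlam : 0 < lam) (ht : 0 < t)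
    (hle : lam ≤ 3 * p ^ 2 * Ψ ^ 2) (hD : 0 ≤ D) :
    16 * (12 * p ^ 2 * Ψ ^ 2 * D + 32 * (48 * s * t * L) / t ^ 2) / lam + D
      ≤ 24576 * (L * s / (t * lam) + p ^ 2 * Ψ ^ 2 * D / lam) := by
  have hmisfit : D ≤ 3 * (p ^ 2 * Ψ ^ 2 * D / lam) := by
    rw [← mul_div_assoc, le_div_iff₀ hlam]
    linarith [mul_le_mul_of_nonneg_left hle hD]
  have : 0 ≤ p ^ 2 * Ψ ^ 2 * D / lam := by positivity
  calc 16 * (12 * p ^ 2 * Ψ ^ 2 * D + 32 * (48 * s * t * L) / t ^ 2) / lam + D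
      = 24576 * (L * s / (t * lam)) + 192 * (p ^ 2 * Ψ ^ 2 * D / lam) + D := by
        field_simp
        ring
    _ ≤ 24576 * (L * s / (t * lam) + p ^ 2 * Ψ ^ 2 * D / lam) := by linarith

theorem sum_transpose_mulVec_mulVec_dotProduct {κ ι d : Type*} [Fintype κ] [Fintype ι] [Fintype d]
    (Φ : Matrix κ d ℝ) (G : ℕ → Matrix κ ι ℝ) (w : ℕ → ι → ℝ) (t : ℕ) (y : d → ℝ) :
    (∑ s ∈ range t, Φᵀ *ᵥ (G s *ᵥ w s)) ⬝ᵥ y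
      = ∑ s ∈ range t, ((G s)ᵀ *ᵥ (Φ *ᵥ y)) ⬝ᵥ w s := by
  rw [sum_dotProduct]
  refine Finset.sum_congr rfl fun s _ => ?_
  rw [dotProduct_transpose_mulVec, dotProduct_transpose_mulVec, dotProduct_comm]

theorem measurable_kronId_transpose_mulVec {ι : Type*} [Fintype ι] {n : ℕ}
    (q : ι × Fin n → ℝ) : Measurable fun z : ι → ℝ => (kronId n z)ᵀ *ᵥ q := by
  refine measurable_pi_lambda _ fun i => ?_
  simp only [kronId_transpose_mulVec_apply]
  fun_prop

theorem sq_sqrt_div_eq {δ σ t : ℝ} (hδ : 0 < δ) (hδ2 : δ < 1 / 2) (hσ : σ ≠ 0) (ht : 0 < t)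
    (d : ℕ) : √(48 * σ ^ 2 * t * (d * log (1 / δ))) ^ 2 / (2 * σ ^ 2 * (4 * t))
      = 6 * (d * log (1 / δ)) := by
  have : 0 ≤ log (1 / δ) := Real.log_nonneg (by rw [le_div_iff₀ hδ]; linarith)
  rw [Real.sq_sqrt (by positivity)]
  field_simp
  ring

theorem two_le_and_mul_le_of_tauLS_le {n m : ℕ} {σ p Ψ xbar δ c t : ℝ} (hc : 16 ≤ c)
    (hp : 0 ≤ p) (hx : 0 ≤ xbar) (h : c * tauLS n m σ p Ψ xbar δ ≤ t) :
    2 ≤ t ∧ 16 * (xbar * p) ≤ t := by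
  have hmul : 16 * (xbar * p + 1) ≤ t := calc
    16 * (xbar * p + 1) ≤ c * (xbar * p + 1) := by gcongr
    _ ≤ c * tauLS n m σ p Ψ xbar δ :=
      mul_le_mul_of_nonneg_left (le_max_right _ _) (by linarith)
    _ ≤ t := h
  have := mul_nonneg hx hp
  constructor <;> linarith

variable {n m d : ℕ} {A : Matrix (Fin n) (Fin n) ℝ} {B : Matrix (Fin n) (Fin m) ℝ}
  {K : Matrix (Fin m) (Fin n) ℝ} {σu : ℝ} {Ω : Type*} [MeasurableSpace Ω] {μ : Measure Ω}
  {σ : ℝ≥0} {x : ℕ → Ω → Fin n → ℝ} {u : ℕ → Ω → Fin m → ℝ}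
  {w : ℕ → Ω → Fin n → ℝ} {g : ℕ → Ω → Fin m → ℝ}

namespace IsRollout

variable (h : IsRollout μ A B K σu σ x u w g)

include h

theorem measure_not_noise_bound_le [IsProbabilityMeasure μ] [NeZero n] [NeZero d]
    (Φ : Matrix ((Fin n ⊕ Fin m) × Fin n) (Fin d) ℝ) {V : Matrix (Fin d) (Fin d) ℝ}
    (hV : V.PosDef) {t : ℕ} (ht : 0 < t) {δ : ℝ} (hδ : 0 < δ) (hδ2 : δ < 1 / 2) :
    μ {ω ∈ {ω | ∀ y, ∑ s ∈ range t,
            ((kronId n (Sum.elim (x s ω) (u s ω)))ᵀ *ᵥ (Φ *ᵥ y)) ⬝ᵥ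
              ((kronId n (Sum.elim (x s ω) (u s ω)))ᵀ *ᵥ (Φ *ᵥ y)) ≤ 4 * t * (y ⬝ᵥ V *ᵥ y)} |
        ¬ ∀ y, |∑ s ∈ range t,
              ((kronId n (Sum.elim (x s ω) (u s ω)))ᵀ *ᵥ (Φ *ᵥ y)) ⬝ᵥ w s ω|
          ≤ 2 * √(48 * (σ : ℝ) ^ 2 * t * (d * log (1 / δ))) * √(y ⬝ᵥ V *ᵥ y)}
      ≤ ofReal (δ / 2) := by
  have ht' : (0 : ℝ) < t := Nat.cast_pos.mpr ht
  have hσ : (σ : ℝ) ≠ 0 := NNReal.coe_ne_zero.mpr fun hzero => by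
    simpa [hzero] using h.one_le_sigma_sq
  have hnet := measure_not_forall_abs_dotProduct_le_of_posDef hV (μ := μ)
    (u := fun ω => ∑ s ∈ range t, Φᵀ *ᵥ (kronId n (Sum.elim (x s ω) (u s ω)) *ᵥ w s ω))
    (G := {ω | ∀ y, ∑ s ∈ range t, ((kronId n (Sum.elim (x s ω) (u s ω)))ᵀ *ᵥ (Φ *ᵥ y)) ⬝ᵥ
      ((kronId n (Sum.elim (x s ω) (u s ω)))ᵀ *ᵥ (Φ *ᵥ y)) ≤ 4 * t * (y ⬝ᵥ V *ᵥ y)})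
    (r := √(48 * (σ : ℝ) ^ 2 * t * (d * log (1 / δ))))
    (b := ofReal (2 * exp (-(6 * (d * log (1 / δ))))))
  simp only [sum_transpose_mulVec_mulVec_dotProduct] at hnet
  refine (hnet fun v hv => ?_).trans ?_
  · rw [← sq_sqrt_div_eq hδ hδ2 hσ ht']
    refine (measure_mono fun ω hω => ?_).trans
      (h.measure_le_abs_sum_dotProduct_noise_le (measurable_kronId_transpose_mulVec (Φ *ᵥ v)) t
        (show (0 : ℝ) < 4 * t by positivity) (Real.sqrt_nonneg _))
    exact ⟨(hω.1 v).trans (mul_le_of_le_one_right (by positivity) hv), hω.2⟩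
  · rw [Fintype.card_fin, show (5 : ℝ≥0∞) ^ d = ofReal (5 ^ d) by simp,
      ← ENNReal.ofReal_mul (by positivity)]
    exact ENNReal.ofReal_le_ofReal (pow_mul_two_mul_exp_neg_le hδ hδ2 (NeZero.ne d))

theorem vnorm_estimate_sub_sq_le [NeZero n] [NeZero d]
    {Φstar Φhat : Matrix ((Fin n ⊕ Fin m) × Fin n) (Fin d) ℝ} {θstar : Fin d → ℝ}
    (hvec : vec (fromCols A B) = Φstar *ᵥ θstar) (horth : Φhatᵀ * Φhat = 1)
    {P : Matrix (Fin n) (Fin n) ℝ} (hP : IsLyapunov P (A + B * K) K) (hσu : σu ^ 2 ≤ 1)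
    {t : ℕ} (ht : 0 < t) (hlam : 0 < lambdaMin (Delta A B K σu t Φhat)) {L : ℝ} (hL : 0 ≤ L)
    {ω : Ω} (hgram : IsGramComparable (avgCov A B K σu t)
      (fun s => Sum.elim (x s ω) (u s ω)) t)
    (hnoise : ∀ y, |∑ s ∈ range t,
          ((kronId n (Sum.elim (x s ω) (u s ω)))ᵀ *ᵥ (Φhat *ᵥ y)) ⬝ᵥ w s ω|
        ≤ 2 * √(48 * (σ : ℝ) ^ 2 * t * L) * √(y ⬝ᵥ Delta A B K σu t Φhat *ᵥ y)) :
    vnorm (Φhat *ᵥ lsEstimate Φhat t (fun s => x s ω) (fun s => u s ω) - Φstar *ᵥ θstar) ^ 2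
      ≤ 24576 * (L * (σ : ℝ) ^ 2 / (t * lambdaMin (Delta A B K σu t Φhat))
        + opNorm P ^ 2 * Psi B ^ 2 * (subspaceDist Φhat Φstar ^ 2 * vnorm θstar ^ 2)
          / lambdaMin (Delta A B K σu t Φhat)) := by
  set lam := lambdaMin (Delta A B K σu t Φhat)
  have ht' : (0 : ℝ) < t := Nat.cast_pos.mpr ht
  have hΔ := Delta_isHermitian (A := A) (B := B) (K := K) (σu := σu) (Φ := Φhat) t
  have hpred (s) : x (s + 1) ω
      = (kronId n (Sum.elim (x s ω) (u s ω)))ᵀ *ᵥ (Φstar *ᵥ θstar) + w s ω := by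
    rw [h.state_eq, ← hvec, kronId_transpose_mulVec_vec, fromCols_mulVec_sumElim]
  have hnormal := sum_dotProduct_lsEstimate
    (hgram.lsGram_posDef ht (posDef_of_lambdaMin_pos hΔ hlam))
  simp only [hpred] at hnormal
  have herr := dotProduct_self_estimate_sub_le horth hnormal ht hlam
    (lambdaMin_mul_dotProduct_self_le hΔ)
    (fun y => dotProduct_Delta_mulVec (Φ := Φhat) t y ▸ (hgram.kronecker_one (Φhat *ᵥ y)).1)
    (M := 12 * opNorm P ^ 2 * Psi B ^ 2)
    (fun v => (hgram.kronecker_one v).2.trans <| by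
      linarith [mul_le_mul_of_nonneg_left (dotProduct_kronecker_one_mulVec_le
        (hP.dotProduct_avgCov_mulVec_le hσu t) v) ht'.le])
    hnoise
  have hmisfit : ((1 - Φhat * Φhatᵀ) *ᵥ (Φstar *ᵥ θstar)) ⬝ᵥ
      ((1 - Φhat * Φhatᵀ) *ᵥ (Φstar *ᵥ θstar)) ≤ subspaceDist Φhat Φstar ^ 2 * vnorm θstar ^ 2 := by
    rw [mulVec_mulVec, vnorm_sq]
    exact dotProduct_mulVec_self_le _ _
  rw [vnorm_sq]
  refine herr.trans (le_trans ?_ (error_bound_le_rate hlam ht'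
    (hP.lambdaMin_Delta_le hσu horth t) (by positivity)))
  rw [Real.sq_sqrt (by positivity)]
  gcongr

theorem exists_measurableSet_vnorm_estimate_sub_sq_le [IsProbabilityMeasure μ] [NeZero n]
    [NeZero d] {Φstar Φhat : Matrix ((Fin n ⊕ Fin m) × Fin n) (Fin d) ℝ} {θstar : Fin d → ℝ}
    (hvec : vec (fromCols A B) = Φstar *ᵥ θstar) (horth : Φhatᵀ * Φhat = 1)
    {P : Matrix (Fin n) (Fin n) ℝ} (hP : IsLyapunov P (A + B * K) K) (hσu : σu ^ 2 ≤ 1)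
    {δ : ℝ} (hδ : 0 < δ) (hδ2 : δ < 1 / 2) {t : ℕ} (ht : 2 ≤ t)
    (hτ : 89128960 * (σ ^ 4 * opNorm P ^ 3 * Psi B ^ 2 * (n + m + log (1 / δ))) ≤ t)
    (hlam : 0 < lambdaMin (Delta A B K σu t Φhat)) :
    ∃ E : Set Ω, MeasurableSet E ∧ ofReal (1 - δ) ≤ μ E ∧
      ∀ ω ∈ E, 16 * (x 0 ω ⬝ᵥ x 0 ω * opNorm P) ≤ t →
        vnorm (Φhat *ᵥ lsEstimate Φhat t (fun s => x s ω) (fun s => u s ω)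
            - Φstar *ᵥ θstar) ^ 2
          ≤ 24576 * (d * log (1 / δ) * (σ : ℝ) ^ 2 / (t * lambdaMin (Delta A B K σu t Φhat))
            + opNorm P ^ 2 * Psi B ^ 2 * (subspaceDist Φhat Φstar ^ 2 * vnorm θstar ^ 2)
              / lambdaMin (Delta A B K σu t Φhat)) := by
  have ht0 : 0 < t := by lia
  have hL : 0 ≤ log (1 / δ) := Real.log_nonneg (by rw [le_div_iff₀ hδ]; linarith)
  have hΔ := posDef_of_lambdaMin_pos (Delta_isHermitian t) hlam
  obtain ⟨E, hE, hprob, hgood⟩ := exists_measurableSet_forall_notMem hδ.le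
    (h.measure_not_isCovClose_le hP hσu ht hδ hδ2 hτ)
    (h.measure_not_noise_bound_le Φhat hΔ ht0 hδ hδ2)
  refine ⟨E, hE, hprob, fun ω hω hx => ?_⟩
  obtain ⟨hclose, hnoise⟩ := hgood ω hω
  have hgram := h.isGramComparable hP ht hx (not_not.mp hclose)
  refine h.vnorm_estimate_sub_sq_le hvec horth hP hσu ht0 hlam (by positivity) hgram ?_
  refine not_not.mp fun hbad => hnoise ⟨fun y => ?_, hbad⟩
  rw [dotProduct_Delta_mulVec]
  exact (hgram.kronecker_one (Φhat *ᵥ y)).2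

end IsRollout

end Estimation

end LSEst

end

theorem mainTheorem3_general (n m d : ℕ)
    (A : Matrix (Fin n) (Fin n) ℝ) (B : Matrix (Fin n) (Fin m) ℝ)
    (Φstar Φhat : Matrix ((Fin n ⊕ Fin m) × Fin n) (Fin d) ℝ) (θstar : Fin d → ℝ)
    (Q : Matrix (Fin n) (Fin n) ℝ) (K : Matrix (Fin m) (Fin n) ℝ)
    (σu : ℝ) (σ : ℝ≥0) (δ : ℝ) (t : ℕ)
    (Ω : Type*) [MeasurableSpace Ω] (μ : Measure Ω) [IsProbabilityMeasure μ]
    (x : ℕ → Ω → Fin n → ℝ) (u : ℕ → Ω → Fin m → ℝ)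
    (w : ℕ → Ω → Fin n → ℝ) (g : ℕ → Ω → Fin m → ℝ)
    (hvec : vec (fromCols A B) = Φstar *ᵥ θstar) (horth : Φhatᵀ * Φhat = 1)
    (hQ : (Q - 1).PosSemidef) (hst : LSEst.IsStable (A + B * K)) (hσu : σu ^ 2 ≤ 1)
    (hδ : 0 < δ) (hδ2 : δ < 1 / 2) (h : LSEst.IsRollout μ A B K σu σ x u w g)
    (hlam : 0 < LSEst.lambdaMin (LSEst.Delta A B K σu t Φhat)) :
    ∃ E : Set Ω, MeasurableSet E ∧ ENNReal.ofReal (1 - δ) ≤ μ E ∧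
      ∀ ω ∈ E,
        89128960 * LSEst.tauLS n m σ (LSEst.opNorm (LSEst.lyapP A B Q K)) (LSEst.Psi B)
            (LSEst.vnorm (x 0 ω) ^ 2) δ ≤ (t : ℝ) →
        LSEst.vnorm (Φhat *ᵥ LSEst.lsEstimate Φhat t (fun s => x s ω) (fun s => u s ω)
            - Φstar *ᵥ θstar) ^ 2
          ≤ 24576 * ((d : ℝ) * (σ : ℝ) ^ 2
                / ((t : ℝ) * LSEst.lambdaMin (LSEst.Delta A B K σu t Φhat))
                * Real.log (1 / δ)
              + LSEst.opNorm (LSEst.lyapP A B Q K) ^ 2 * LSEst.Psi B ^ 2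
                  * LSEst.subspaceDist Φhat Φstar ^ 2 * LSEst.vnorm θstar ^ 2
                  / LSEst.lambdaMin (LSEst.Delta A B K σu t Φhat)) := by
  have : NeZero d := ⟨Fin.pos_iff_nonempty.mpr (LSEst.nonempty_of_lambdaMin_pos hlam) |>.ne'⟩
  have : NeZero n := LSEst.neZero_of_transpose_mul_self_eq_one horth
  have hP := LSEst.isLyapunov_lyapP hQ hst
  have hp := LSEst.opNorm_nonneg (LSEst.lyapP A B Q K)
  by_cases hT : 2 ≤ t ∧ 89128960 * ((σ : ℝ) ^ 4 * LSEst.opNorm (LSEst.lyapP A B Q K) ^ 3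
      * LSEst.Psi B ^ 2 * (n + m + Real.log (1 / δ))) ≤ t
  · obtain ⟨E, hE, hprob, hbound⟩ := h.exists_measurableSet_vnorm_estimate_sub_sq_le hvec horth
      hP hσu hδ hδ2 hT.1 hT.2 hlam
    refine ⟨E, hE, hprob, fun ω hω htau => (hbound ω hω ?_).trans_eq (by ring)⟩
    rw [← LSEst.vnorm_sq]
    exact (LSEst.two_le_and_mul_le_of_tauLS_le (by norm_num) hp (sq_nonneg _) htau).2
  · refine ⟨Set.univ, .univ, ?_, fun ω _ htau => absurd ⟨?_, ?_⟩ hT⟩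
    · rw [measure_univ]
      exact ENNReal.ofReal_le_one.mpr (by linarith)
    · exact_mod_cast
        (LSEst.two_le_and_mul_le_of_tauLS_le (by norm_num) hp (sq_nonneg _) htau).1
    · exact (mul_le_mul_of_nonneg_left (le_max_left _ _) (by norm_num)).trans htau

theorem mainTheorem3 :
    ∃ c C : ℝ, 0 < c ∧ 0 < C ∧
      ∀ (n m d : ℕ)
        (A : Matrix (Fin n) (Fin n) ℝ) (B : Matrix (Fin n) (Fin m) ℝ)
        (Φstar Φhat : Matrix ((Fin n ⊕ Fin m) × Fin n) (Fin d) ℝ) (θstar : Fin d → ℝ)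
        (Q : Matrix (Fin n) (Fin n) ℝ) (K : Matrix (Fin m) (Fin n) ℝ)
        (σu : ℝ) (σ : ℝ≥0) (δ : ℝ) (t : ℕ)
        (Ω : Type*) [MeasurableSpace Ω] (μ : Measure Ω) [IsProbabilityMeasure μ]
        (x : ℕ → Ω → Fin n → ℝ) (u : ℕ → Ω → Fin m → ℝ)
        (w : ℕ → Ω → Fin n → ℝ) (g : ℕ → Ω → Fin m → ℝ),
        Matrix.vec (Matrix.fromCols A B) = Φstar *ᵥ θstar →
        Φhatᵀ * Φhat = 1 →
        (Q - 1).PosSemidef →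
        LSEst.IsStable (A + B * K) →
        σu ^ 2 ≤ 1 →
        0 < δ → δ < 1 / 2 →
        LSEst.IsRollout μ A B K σu σ x u w g →
        0 < LSEst.lambdaMin (LSEst.Delta A B K σu t Φhat) →
        ∃ E : Set Ω, MeasurableSet E ∧ ENNReal.ofReal (1 - δ) ≤ μ E ∧
          ∀ ω ∈ E,
            c * LSEst.tauLS n m σ (LSEst.opNorm (LSEst.lyapP A B Q K)) (LSEst.Psi B)
                (LSEst.vnorm (x 0 ω) ^ 2) δ ≤ (t : ℝ) →
            LSEst.vnorm (Φhat *ᵥ LSEst.lsEstimate Φhat t (fun s => x s ω) (fun s => u s ω)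
                - Φstar *ᵥ θstar) ^ 2
              ≤ C * ((d : ℝ) * (σ : ℝ) ^ 2
                    / ((t : ℝ) * LSEst.lambdaMin (LSEst.Delta A B K σu t Φhat))
                    * Real.log (1 / δ)
                  + (1 + (σ : ℝ) ^ 4 * LSEst.opNorm (LSEst.lyapP A B Q K) ^ 7 * LSEst.Psi B ^ 6
                        * ((n : ℝ) + (m : ℝ) + Real.log (1 / δ))
                        / ((t : ℝ) * LSEst.lambdaMin (LSEst.Delta A B K σu t Φhat) ^ 2))
                    * (LSEst.opNorm (LSEst.lyapP A B Q K) ^ 2 * LSEst.Psi B ^ 2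
                        * LSEst.subspaceDist Φhat Φstar ^ 2 * LSEst.vnorm θstar ^ 2
                        / LSEst.lambdaMin (LSEst.Delta A B K σu t Φhat))) := by
  refine ⟨89128960, 24576, by norm_num, by norm_num, ?_⟩
  intro n m d A B Φstar Φhat θstar Q K σu σ δ t Ω _ μ _ x u w g hvec horth hQ hst hσu hδ hδ2 h
    hlam
  obtain ⟨E, hE, hprob, hbound⟩ := mainTheorem3_general n m d A B Φstar Φhat θstar Q K σu σ δ t
    Ω μ x u w g hvec horth hQ hst hσu hδ hδ2 h hlam
  refine ⟨E, hE, hprob, fun ω hω htau => (hbound ω hω htau).trans ?_⟩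
  have : 0 ≤ Real.log (1 / δ) := Real.log_nonneg (by rw [le_div_iff₀ hδ]; linarith)
  have := LSEst.opNorm_nonneg (LSEst.lyapP A B Q K)
  have : 0 ≤ LSEst.Psi B := zero_le_one.trans (LSEst.one_le_Psi B)
  gcongr
  exact le_mul_of_one_le_left (by positivity) (le_add_of_nonneg_right (by positivity))
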